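/- All graphs are finite and directed, parallel edges are allowed, and all input numbers are non-negative integers written in binary (edges, including parallel ones, are listed one by one). For a graph $G=(V,E)$ with node capacities $q:V\to\{0,1,2,\dots\}\cup\{\infty\}$ and distinct nodes $s,t$, let $\lambda^q_G(s,t)$ be the maximum value of an (integral) flow from $s$ to $t$, where every edge has capacity $1$ and every node $u\ne s,t$ has capacity $q_u$. Let $H(j)=\sum_{i=1}^{j}1/i$, with $H(0)=0$. **$a$-Based SNA.** Given are a graph $G=(V,E)$ with node capacities $q$, a node $a\in V$, a family $F$ of edges on $V$ each of which leaves $a$ and enters another node, a set $D$ of ordered pairs of distinct nodes with requirements $r_{sv}$ for $sv\in D$, and costs. Find a minimum-cost $I\subseteq F$ such that $\lambda^q_{G+I}(s,v)\ge r_{sv}$ for all $sv\in D$. With edge-costs $c:F\to\mathbb Z_{\ge 0}$ the cost of $I$ is $\sum_{e\in I}c_e$; with node-costs $c:V\to\mathbb Z_{\ge0}$ it is $\sum_u c_u$ over the set of all endnodes $u$ of the edges in $I$. Let $r(D)=\sum_{sv\in D}r_{sv}$, and let $p_{\max}$ be the maximum number of parallel edges in $F$. **SSL.** Given are a graph $G=(V,E)$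 with node-costs $c_v\ge 0$, demands $d_v$, flow-supplies $p_v$ and node capacities $q_v$ (all integers) with $1\le q_u\le p_u\le \max_{v} d_v$ for all $u\in V$. For $S\subseteq V$ and $v\in V$ let $\lambda^{p,q}_G(S,v)=\lambda^q_{G'}(s,v)$, where $G'$ is obtained from $G$ by adding a new node $s$ and $p_u$ parallel edges from $s$ to $u$ for every $u\in S$. Find $S\subseteq V$ of minimum cost $\sum_{u\in S}c_u$ such that $\lambda^{p,q}_G(S,v)\ge d_v$ for all $v\in V$. Put $d(V)=\sum_v d_v$ and $p_{\max}=\max_u p_u$. A problem admits approximation ratio $\rho$ (a function of the instance) if there is an algorithm that runs in time polynomial in the size of the input and that, on every instance with a feasible solution, outputs a feasible solution of cost at most $\rho$ times the cost of every feasible solution. **Theorem 2.** (1) Directed $a$-Based SNA with edge-costs admits approximation ratio $H(|D|)$. (2) Directed $a$-Based SNA with node-costs admits approximation ratio $H(\min\{r(D),\,|D|\cdot p_{\max}\})$. (3) Directed SSL admits approximation ratio $H(\min\{d(V),\,|V|\cdot p_{\max}\})$. -/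

import Mathlib

/-! ## A programming language with a bit-cost semantics

Values are natural numbers, pairs and lists. Programs are built from a few primitive operations
by composition, pairing, branching, list matching and unbounded loops. Every operation is charged
the bit sizes of what it reads and writes, so that cost and Turing machine time are
polynomially related. -/

/-- The data types of the language. -/
inductive Ty : Type
  | nat : Ty
  | prod : Ty → Ty → Ty
  | list : Ty → Ty

/-- The values of a data type. -/
@[reducible] def Ty.Val : Ty → Type
  | .nat => ℕ
  | .prod a b => a.Val × b.Val
  | .list a => List a.Val

/-- The bit size of a value; numbers are written in binary. -/
def Ty.size : (a : Ty) → a.Val → ℕ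
  | .nat, n => Nat.size n + 1
  | .prod a b, x => a.size x.1 + b.size x.2 + 1
  | .list a, l => (l.map fun x => a.size x + 1).sum + 1

/-- The primitive operations. -/
inductive Prim : Ty → Ty → Type
  | id (a : Ty) : Prim a a
  | fst (a b : Ty) : Prim (.prod a b) a
  | snd (a b : Ty) : Prim (.prod a b) b
  | const (a : Ty) (n : ℕ) : Prim a .nat
  | add : Prim (.prod .nat .nat) .nat
  | sub : Prim (.prod .nat .nat) .nat
  | mul : Prim (.prod .nat .nat) .nat
  | le : Prim (.prod .nat .nat) .nat
  | nil (a b : Ty) : Prim a (.list b)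
  | cons (a : Ty) : Prim (.prod a (.list a)) (.list a)

/-- The meaning of the primitive operations; `sub` is truncated subtraction, and `le` answers
`1` for yes and `0` for no. -/
def Prim.eval : {a b : Ty} → Prim a b → a.Val → b.Val
  | _, _, .id _, x => x
  | _, _, .fst _ _, x => x.1
  | _, _, .snd _ _, x => x.2
  | _, _, .const _ n, _ => n
  | _, _, .add, x => Nat.add x.1 x.2
  | _, _, .sub, x => Nat.sub x.1 x.2
  | _, _, .mul, x => Nat.mul x.1 x.2
  | _, _, .le, x => if Nat.ble x.1 x.2 then (1 : ℕ) else (0 : ℕ)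
  | _, _, .nil _ _, _ => []
  | _, _, .cons _, x => x.1 :: x.2

/-- Programs with an input of the first and an output of the second type. -/
inductive Prog : Ty → Ty → Type
  | prim {a b : Ty} (o : Prim a b) : Prog a b
  /-- first `f`, then `g` -/
  | comp {a b c : Ty} (f : Prog a b) (g : Prog b c) : Prog a c
  /-- `f` and `g` on the same input -/
  | pair {a b c : Ty} (f : Prog a b) (g : Prog a c) : Prog a (.prod b c)
  /-- `f` if `c` answers a nonzero number, and `g` otherwise -/
  | ite {a b : Ty} (c : Prog a .nat) (f g : Prog a b) : Prog a b
  /-- `f` if the list in the second component is empty; otherwise `g`, which gets the first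
  component, the head and the tail of the list -/
  | caseList {a b c : Ty} (f : Prog a c) (g : Prog (.prod a (.prod b (.list b))) c) :
      Prog (.prod a (.list b)) c
  /-- repeat `f` as long as `c` answers a nonzero number -/
  | loop {a : Ty} (c : Prog a .nat) (f : Prog a a) : Prog a a

/-- `P.Runs x y t`: on input `x` the program `P` halts with output `y` and total cost `t`. -/
inductive Prog.Runs : {a b : Ty} → Prog a b → a.Val → b.Val → ℕ → Prop
  | prim {a b : Ty} (o : Prim a b) (x : a.Val) :
      Prog.Runs (.prim o) x (o.eval x) (a.size x + b.size (o.eval x))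
  | comp {a b c : Ty} {f : Prog a b} {g : Prog b c} {x : a.Val} {y : b.Val} {z : c.Val}
      {t u : ℕ} (hf : Prog.Runs f x y t) (hg : Prog.Runs g y z u) :
      Prog.Runs (.comp f g) x z (t + u + 1)
  | pair {a b c : Ty} {f : Prog a b} {g : Prog a c} {x : a.Val} {y : b.Val} {z : c.Val}
      {t u : ℕ} (hf : Prog.Runs f x y t) (hg : Prog.Runs g x z u) :
      Prog.Runs (.pair f g) x ((y, z) : b.Val × c.Val) (a.size x + t + u + 1)
  | ite_true {a b : Ty} {c : Prog a .nat} {f g : Prog a b} {x : a.Val} {n : ℕ} {y : b.Val}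
      {t u : ℕ} (hc : Prog.Runs c x n t) (hn : n ≠ 0) (hf : Prog.Runs f x y u) :
      Prog.Runs (.ite c f g) x y (a.size x + t + u + 1)
  | ite_false {a b : Ty} {c : Prog a .nat} {f g : Prog a b} {x : a.Val} {y : b.Val}
      {t u : ℕ} (hc : Prog.Runs c x (0 : ℕ) t) (hg : Prog.Runs g x y u) :
      Prog.Runs (.ite c f g) x y (a.size x + t + u + 1)
  | case_nil {a b c : Ty} {f : Prog a c} {g : Prog (.prod a (.prod b (.list b))) c}
      {x : a.Val} {y : c.Val} {t : ℕ} (hf : Prog.Runs f x y t) :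
      Prog.Runs (.caseList f g) ((x, []) : a.Val × List b.Val) y (a.size x + t + 1)
  | case_cons {a b c : Ty} {f : Prog a c} {g : Prog (.prod a (.prod b (.list b))) c}
      {x : a.Val} {h : b.Val} {l : List b.Val} {y : c.Val} {t : ℕ}
      (hg : Prog.Runs g ((x, (h, l)) : a.Val × (b.Val × List b.Val)) y t) :
      Prog.Runs (.caseList f g) ((x, h :: l) : a.Val × List b.Val) y
        (a.size x + b.size h + (Ty.list b).size l + t + 1)
  | loop_done {a : Ty} {c : Prog a .nat} {f : Prog a a} {x : a.Val} {t : ℕ}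
      (hc : Prog.Runs c x (0 : ℕ) t) :
      Prog.Runs (.loop c f) x x (a.size x + t + 1)
  | loop_step {a : Ty} {c : Prog a .nat} {f : Prog a a} {x y z : a.Val} {n t u v : ℕ}
      (hc : Prog.Runs c x n t) (hn : n ≠ 0) (hf : Prog.Runs f x y u)
      (hl : Prog.Runs (.loop c f) y z v) :
      Prog.Runs (.loop c f) x z (a.size x + t + u + v + 1)

/-! ## Minimization problems and approximation ratios -/

/-- A minimization problem whose solutions are subsets of a ground set `Fin (ground x)` that
depends on the instance `x`. -/
structure MinProblem where
  /-- the instances -/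
  Inst : Type
  /-- the data type in which instances are given to a program -/
  inTy : Ty
  /-- how an instance is given to a program -/
  encode : Inst → inTy.Val
  /-- the size of the ground set -/
  ground : Inst → ℕ
  /-- the feasible solutions -/
  Feasible : (x : Inst) → Finset (Fin (ground x)) → Prop
  /-- the objective function -/
  cost : (x : Inst) → Finset (Fin (ground x)) → ℕ

/-- The list `l` lists exactly the members of `S`. -/
def ListsSubset {m : ℕ} (l : List ℕ) (S : Finset (Fin m)) : Prop :=
  ∀ i : ℕ, i ∈ l ↔ ∃ h : i < m, (⟨i, h⟩ : Fin m) ∈ S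

/-- The problem `P` admits approximation ratio `ρ`: a single program halts on every instance within
time polynomial in the size of the input and, whenever the instance has a feasible solution,
outputs a feasible solution whose cost is at most `ρ` times that of every feasible solution. -/
def MinProblem.AdmitsRatio (P : MinProblem) (ρ : P.Inst → ℚ) : Prop :=
  ∃ (A : Prog P.inTy (.list .nat)) (T : Polynomial ℕ), ∀ x : P.Inst,
    ∃ (out : List ℕ) (t : ℕ),
      A.Runs (P.encode x) out t ∧
      t ≤ T.eval (P.inTy.size (P.encode x)) ∧
      ((∃ S, P.Feasible x S) →
        ∃ S, ListsSubset out S ∧ P.Feasible x S ∧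
          ∀ S', P.Feasible x S' → (P.cost x S : ℚ) ≤ ρ x * (P.cost x S' : ℚ))

/-! ## `q`-connectivity in directed multigraphs -/

/-- In the directed multigraph with edges `i : ι` from `tail i` to `head i`, the integral function
`f` is a flow of value `k` from `s` to `t`: every edge has capacity `1`, and every node
`u ≠ s, t` has capacity `q u` and satisfies flow conservation. -/
def IsFlow {V ι : Type} [Fintype ι] [DecidableEq V] (tail head : ι → V) (q : V → ℕ∞) (s t : V)
    (f : ι → ℕ) (k : ℕ) : Prop :=
  (∀ i, f i ≤ 1) ∧
  (∀ u, u ≠ s → u ≠ t →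
    (∑ i with head i = u, f i) = (∑ i with tail i = u, f i) ∧
    ((∑ i with head i = u, f i : ℕ) : ℕ∞) ≤ q u) ∧
  (∑ i with tail i = s, f i) = (∑ i with head i = s, f i) + k

/-- The `q`-connectivity from `s` to `t` (for `s ≠ t`): the maximum value of a flow. -/
noncomputable def qConn {V ι : Type} [Fintype ι] [DecidableEq V] (tail head : ι → V) (q : V → ℕ∞)
    (s t : V) : ℕ :=
  sSup {k : ℕ | ∃ f : ι → ℕ, IsFlow tail head q s t f k}

/-! ## `a`-Based Survivable Network Augmentation -/

/-- The data of a directed `a`-Based SNA instance, apart from the costs. Parallel edges are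
allowed; they are told apart by their positions in the lists. -/
structure ABasedSNA where
  /-- the nodes are the elements of `Fin n` -/
  n : ℕ
  /-- the edges of the graph `G` -/
  E : List (Fin n × Fin n)
  /-- the edges that can be added to `G` -/
  F : List (Fin n × Fin n)
  /-- the node capacities -/
  q : Fin n → ℕ∞
  /-- the demand edges with their requirements -/
  D : List ((Fin n × Fin n) × ℕ)
  /-- the demand edges form a set -/
  D_nodup : (D.map Prod.fst).Nodup
  /-- a demand edge has distinct ends -/
  D_ne : ∀ d ∈ D, d.1.1 ≠ d.1.2
  /-- the center of the star `F` -/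
  a : Fin n
  /-- every edge of `F` leaves the center and enters another node -/
  star : ∀ e ∈ F, e.1 = a ∧ e.2 ≠ a

namespace ABasedSNA

/-- The `q`-connectivity from `s` to `t` in `G + I`. -/
noncomputable def conn (x : ABasedSNA) (I : Finset (Fin x.F.length)) (s t : Fin x.n) : ℕ :=
  qConn (ι := Fin x.E.length ⊕ {i // i ∈ I})
    (Sum.elim (fun i => (x.E.get i).1) (fun i => (x.F.get i.1).1))
    (Sum.elim (fun i => (x.E.get i).2) (fun i => (x.F.get i.1).2))
    x.q s t

/-- All requirements are met in `G + I`. -/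
def Feasible (x : ABasedSNA) (I : Finset (Fin x.F.length)) : Prop :=
  ∀ d ∈ x.D, d.2 ≤ x.conn I d.1.1 d.1.2

/-- The number of demand edges. -/
def numDemands (x : ABasedSNA) : ℕ := x.D.length

/-- The total requirement `r(D)`. -/
def totalReq (x : ABasedSNA) : ℕ := (x.D.map Prod.snd).sum

/-- The maximum number of parallel edges in `F`. -/
def pMax (x : ABasedSNA) : ℕ := Finset.univ.sup fun e : Fin x.n × Fin x.n => x.F.count e

/-- The set of the endnodes of the edges in `I`. -/
def endnodes (x : ABasedSNA) (I : Finset (Fin x.F.length)) : Finset (Fin x.n) :=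
  I.image (fun i => (x.F.get i).1) ∪ I.image (fun i => (x.F.get i).2)

end ABasedSNA

/-- The data type of a list of edges. -/
abbrev edgesTy : Ty := .list (.prod .nat .nat)

/-- A list of edges as a value. -/
def encodeEdges {n : ℕ} (l : List (Fin n × Fin n)) : edgesTy.Val :=
  l.map fun e => ((e.1 : ℕ), (e.2 : ℕ))

/-- A capacity as a number: `0` stands for an infinite capacity, and `m + 1` for capacity `m`. -/
def encodeCap : ℕ∞ → ℕ
  | none => 0
  | some m => m + 1

/-- The data type of instances of `a`-Based SNA without costs. -/
abbrev snaTy : Ty :=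
  .prod (.list .nat) (.prod edgesTy (.prod edgesTy
    (.prod (.list (.prod (.prod .nat .nat) .nat)) .nat)))

/-- The capacities, the edges of `G`, the edges of `F`, the demands and the center. -/
def ABasedSNA.encode (x : ABasedSNA) : snaTy.Val :=
  (List.ofFn fun u => encodeCap (x.q u), encodeEdges x.E, encodeEdges x.F,
    x.D.map (fun d => (((d.1.1 : ℕ), (d.1.2 : ℕ)), d.2)), (x.a : ℕ))

/-- Directed `a`-Based SNA with costs of the edges in `F`: find a cheapest feasible `I ⊆ F`. -/
def SNAEdgeCosts : MinProblem where
  Inst := (x : ABasedSNA) × (Fin x.F.length → ℕ)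
  inTy := .prod snaTy (.list .nat)
  encode x := (x.1.encode, List.ofFn x.2)
  ground x := x.1.F.length
  Feasible x I := x.1.Feasible I
  cost x I := ∑ i ∈ I, x.2 i

/-- Directed `a`-Based SNA with node costs: the cost of `I ⊆ F` is that of the set of its
endnodes. -/
def SNANodeCosts : MinProblem where
  Inst := (x : ABasedSNA) × (Fin x.n → ℕ)
  inTy := .prod snaTy (.list .nat)
  encode x := (x.1.encode, List.ofFn x.2)
  ground x := x.1.F.length
  Feasible x I := x.1.Feasible I
  cost x I := ∑ u ∈ x.1.endnodes I, x.2 u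

/-! ## Survivable Source Location -/

/-- A directed SSL instance. -/
structure SSLInstance where
  /-- the nodes are the elements of `Fin n` -/
  n : ℕ
  /-- the edges of the graph `G` -/
  E : List (Fin n × Fin n)
  /-- the node costs -/
  c : Fin n → ℕ
  /-- the demands -/
  d : Fin n → ℕ
  /-- the flow supplies -/
  p : Fin n → ℕ
  /-- the node capacities -/
  q : Fin n → ℕ
  one_le_q : ∀ u, 1 ≤ q u
  q_le_p : ∀ u, q u ≤ p u
  p_le_k : ∀ u, p u ≤ Finset.univ.sup d

namespace SSLInstance

/-- The `(S, v)`-`(p, q)`-connectivity: the `q`-connectivity from a new node `none` to `v` in the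
graph obtained from `G` by joining the new node to every `u ∈ S` by `p u` parallel edges. -/
noncomputable def conn (x : SSLInstance) (S : Finset (Fin x.n)) (v : Fin x.n) : ℕ :=
  qConn (V := Option (Fin x.n)) (ι := Fin x.E.length ⊕ ((u : {u // u ∈ S}) × Fin (x.p u)))
    (Sum.elim (fun i => some (x.E.get i).1) (fun _ => none))
    (Sum.elim (fun i => some (x.E.get i).2) (fun j => some j.1.1))
    (fun w => w.elim ⊤ fun u => (x.q u : ℕ∞)) none (some v)

/-- The total demand `d(V)`. -/
def totalDemand (x : SSLInstance) : ℕ := ∑ v, x.d v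

/-- The maximum flow supply. -/
def pMax (x : SSLInstance) : ℕ := Finset.univ.sup x.p

end SSLInstance

/-- Directed SSL: find a cheapest source set `S` whose `(p, q)`-connectivity to every node `v` is
at least `d v`. -/
def SSL : MinProblem where
  Inst := SSLInstance
  inTy := .prod edgesTy (.prod (.list .nat) (.prod (.list .nat) (.prod (.list .nat) (.list .nat))))
  encode x := (encodeEdges x.E, List.ofFn x.c, List.ofFn x.d, List.ofFn x.p, List.ofFn x.q)
  ground x := x.n
  Feasible x S := ∀ v, x.d v ≤ x.conn S v
  cost x S := ∑ u ∈ S, x.c u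

/-!
# Greedy approximation for star survivable network augmentation and source location

All three problems are instances of submodular covering. Split every node `u` into an entry
`2 * u` and an exit `2 * u + 1` that are joined by as many arcs as its capacity allows, cut off at a
number that no flow exceeds. Then the `q`-connectivity from `s` to `t` is the capacity of a
minimum cut between the exit of `s` and the entry of `t` (`qConn_eq_min_cut`). As all edges that
can be added leave the same node, uncrossing two minimum cuts shows that the connectivity is a
submodular function of the added edges (`maxFlow_submodular`), and so is the sum over all demands
of the minimum of connectivity and requirement (`coverage`). Solutions are the sets at which this
function attains the total requirement. Wolsey's theorem (`greedy_spec`) says that the greedy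
algorithm, which always adds the candidate with the smallest cost per unit of gain, is within the
factor `harmonic (f {j} - f ∅)` in its payment for each element `j` of an optimal solution.

The candidates are the edges in `F` for edge costs, each of gain at most `1` per demand. For node
costs they are the nodes, where a node brings along all edges in `F` that enter it; the center is
paid for once by every solution that is not empty. In SSL they are the possible sources, and the
center is the new node. There the multiplicities `p u` are written in binary, so that the arcs
cannot be listed. They matter in full only for the arcs that lead straight into the sink, and
those add a constant to the connectivity; all others are cut off at the number of edges
(`SSLInstance.conn_eq_toDemand`).

The connectivity is computed by augmenting paths in the split graph, where the residual graph is a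
list of arcs in which the arcs of a path are reversed (`augment`): this lowers the value of each cut
and of each flow by one (`augment_spec`). That everything runs in polynomial time is proved by
closure properties of the class `PolyTime` of functions computed by programs in polynomial time,
above all closure under folds over lists whose intermediate states stay small (`PolyTime.foldl`).
-/

/-! ### Polynomial bounds -/

/-- Every operation is charged the size of its output. -/
theorem Prog.Runs.size_le {a b : Ty} {P : Prog a b} {x : a.Val} {y : b.Val} {t : ℕ}
    (h : P.Runs x y t) : b.size y ≤ t := by
  induction h with
  | pair hf hg ih1 ih2 => simp only [Ty.size]; omega
  | _ => omega

theorem Polynomial.eval_mono_nat (T : Polynomial ℕ) {m n : ℕ} (h : m ≤ n) :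
    T.eval m ≤ T.eval n := by
  rw [Polynomial.eval_eq_sum, Polynomial.eval_eq_sum]
  exact Finset.sum_le_sum fun i _ => Nat.mul_le_mul_left _ (Nat.pow_le_pow_left h i)

/-- `g` is bounded by a polynomial in the size of its argument. -/
def PolyBdd (a : Ty) (g : a.Val → ℕ) : Prop :=
  ∃ T : Polynomial ℕ, ∀ x, g x ≤ T.eval (a.size x)

namespace PolyBdd

variable {a b : Ty} {f g : a.Val → ℕ}

theorem mono (hg : PolyBdd a g) (h : ∀ x, f x ≤ g x) : PolyBdd a f :=
  hg.imp fun _ hT x => (h x).trans (hT x)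

theorem size : PolyBdd a a.size := ⟨Polynomial.X, fun x => by simp⟩

theorem const (n : ℕ) : PolyBdd a fun _ => n := ⟨Polynomial.C n, fun x => by simp⟩

theorem add (hf : PolyBdd a f) (hg : PolyBdd a g) : PolyBdd a fun x => f x + g x := by
  obtain ⟨T, hT⟩ := hf
  obtain ⟨U, hU⟩ := hg
  exact ⟨T + U, fun x => by rw [Polynomial.eval_add]; exact Nat.add_le_add (hT x) (hU x)⟩

theorem mul (hf : PolyBdd a f) (hg : PolyBdd a g) : PolyBdd a fun x => f x * g x := by
  obtain ⟨T, hT⟩ := hf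
  obtain ⟨U, hU⟩ := hg
  exact ⟨T * U, fun x => by rw [Polynomial.eval_mul]; exact Nat.mul_le_mul (hT x) (hU x)⟩

theorem eval (T : Polynomial ℕ) (hf : PolyBdd a f) : PolyBdd a fun x => T.eval (f x) := by
  obtain ⟨U, hU⟩ := hf
  exact ⟨T.comp U, fun x => by
    rw [Polynomial.eval_comp]; exact T.eval_mono_nat (hU x)⟩

end PolyBdd

/-! ### Functions computable in polynomial time -/

/-- Some program computes `f` in time polynomial in the size of the input. -/
def PolyTime (a b : Ty) (f : a.Val → b.Val) : Prop :=
  ∃ (P : Prog a b) (g : a.Val → ℕ), PolyBdd a g ∧ ∀ x, ∃ t, P.Runs x (f x) t ∧ t ≤ g x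

namespace PolyTime

variable {a b c d e σ : Ty}

theorem polyBdd_size {f : a.Val → b.Val} (h : PolyTime a b f) :
    PolyBdd a fun x => b.size (f x) := by
  obtain ⟨P, g, hg, hP⟩ := h
  refine hg.mono fun x => ?_
  obtain ⟨t, ht, hle⟩ := hP x
  exact ht.size_le.trans hle

theorem of_eq {f g : a.Val → b.Val} (h : PolyTime a b f) (H : ∀ x, f x = g x) :
    PolyTime a b g := funext H ▸ h

theorem comp {g : b.Val → c.Val} {f : a.Val → b.Val} (hg : PolyTime b c g)
    (hf : PolyTime a b f) : PolyTime a c fun x => g (f x) := by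
  have hs := hf.polyBdd_size
  obtain ⟨P, u, hu, hP⟩ := hf
  obtain ⟨Q, v, ⟨T, hT⟩, hQ⟩ := hg
  refine ⟨.comp P Q, fun x => u x + T.eval (b.size (f x)) + 1,
    (hu.add (hs.eval T)).add (.const 1), fun x => ?_⟩
  obtain ⟨t, ht, hle⟩ := hP x
  obtain ⟨t', ht', hle'⟩ := hQ (f x)
  exact ⟨_, .comp ht ht', by have := hT (f x); beta_reduce; omega⟩

theorem pair {f : a.Val → b.Val} {g : a.Val → c.Val} (hf : PolyTime a b f)
    (hg : PolyTime a c g) : PolyTime a (.prod b c) fun x => (f x, g x) := by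
  obtain ⟨P, u, hu, hP⟩ := hf
  obtain ⟨Q, v, hv, hQ⟩ := hg
  refine ⟨.pair P Q, fun x => a.size x + u x + v x + 1,
    ((PolyBdd.size.add hu).add hv).add (.const 1), fun x => ?_⟩
  obtain ⟨t, ht, hle⟩ := hP x
  obtain ⟨t', ht', hle'⟩ := hQ x
  exact ⟨_, .pair ht ht', by beta_reduce; omega⟩

theorem ite_ne_zero {k : a.Val → ℕ} {f g : a.Val → b.Val} (hk : PolyTime a .nat k)
    (hf : PolyTime a b f) (hg : PolyTime a b g) :
    PolyTime a b fun x => if k x ≠ 0 then f x else g x := by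
  obtain ⟨C, w, hw, hC⟩ := hk
  obtain ⟨P, u, hu, hP⟩ := hf
  obtain ⟨Q, v, hv, hQ⟩ := hg
  refine ⟨.ite C P Q, fun x => a.size x + w x + (u x + v x) + 1,
    ((PolyBdd.size.add hw).add (hu.add hv)).add (.const 1), fun x => ?_⟩
  obtain ⟨r, hr, hler⟩ := hC x
  obtain ⟨t, ht, hle⟩ := hP x
  obtain ⟨t', ht', hle'⟩ := hQ x
  by_cases h : k x = 0
  · beta_reduce
    rw [if_neg (not_not.2 h)]
    rw [h] at hr
    exact ⟨_, .ite_false hr ht', by omega⟩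
  · beta_reduce
    rw [if_pos h]
    exact ⟨_, .ite_true hr h ht, by omega⟩

theorem caseList {f : a.Val → c.Val} {g : a.Val × (b.Val × List b.Val) → c.Val}
    (hf : PolyTime a c f) (hg : PolyTime (.prod a (.prod b (.list b))) c g) :
    PolyTime (.prod a (.list b)) c fun y : a.Val × List b.Val =>
      match y.2 with
      | [] => f y.1
      | h :: l => g (y.1, (h, l)) := by
  obtain ⟨P, u, ⟨T, hT⟩, hP⟩ := hf
  obtain ⟨Q, v, ⟨U, hU⟩, hQ⟩ := hg
  refine ⟨.caseList P Q, fun y => 3 * Ty.size (.prod a (.list b)) y +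
      T.eval (Ty.size (.prod a (.list b)) y) + U.eval (Ty.size (.prod a (.list b)) y + 1) + 1,
    ((((PolyBdd.const 3).mul .size).add (.eval T .size)).add
      (.eval U (.add .size (.const 1)))).add (.const 1), ?_⟩
  rintro ⟨x, l⟩
  cases l with
  | nil =>
    obtain ⟨t, ht, hle⟩ := hP x
    refine ⟨_, .case_nil ht, ?_⟩
    have h1 : a.size x ≤ Ty.size (.prod a (.list b)) (x, []) := by simp only [Ty.size]; omega
    have h2 := T.eval_mono_nat h1
    have h3 := hT x
    beta_reduce
    omega
  | cons h l =>
    obtain ⟨t, ht, hle⟩ := hQ (x, (h, l))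
    refine ⟨_, .case_cons ht, ?_⟩
    have h1 : Ty.size (.prod a (.list b)) (x, h :: l) =
        a.size x + b.size h + (Ty.list b).size l + 2 := by
      simp only [Ty.size, List.map_cons, List.sum_cons]; omega
    have h2 : Ty.size (.prod a (.prod b (.list b))) (x, (h, l)) =
        a.size x + b.size h + (Ty.list b).size l + 2 := by
      simp only [Ty.size]; omega
    have h3 := hU (x, (h, l))
    rw [h2] at h3
    have h4 := U.eval_mono_nat
      (Nat.le_add_right (a.size x + b.size h + (Ty.list b).size l + 2) 1)
    beta_reduce
    rw [h1]
    omega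

theorem prim (o : Prim a b) (h : PolyBdd a fun x => b.size (o.eval x)) :
    PolyTime a b o.eval :=
  ⟨.prim o, _, PolyBdd.size.add h, fun x => ⟨_, .prim o x, le_rfl⟩⟩

protected theorem id : PolyTime a a fun x => x := prim (.id a) .size

theorem fst {f : a.Val → b.Val × c.Val} (h : PolyTime a (.prod b c) f) :
    PolyTime a b fun x => (f x).1 :=
  comp (g := fun x : b.Val × c.Val => x.1)
    (prim (.fst b c) (PolyBdd.size.mono fun x => by simp only [Ty.size, Prim.eval]; omega)) h

theorem snd {f : a.Val → b.Val × c.Val} (h : PolyTime a (.prod b c) f) :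
    PolyTime a c fun x => (f x).2 :=
  comp (g := fun x : b.Val × c.Val => x.2)
    (prim (.snd b c) (PolyBdd.size.mono fun x => by simp only [Ty.size, Prim.eval]; omega)) h

theorem const (n : ℕ) : PolyTime a .nat fun _ => n := prim (.const a n) (PolyBdd.const (n.size + 1))

theorem nil : PolyTime a (.list b) fun _ => [] := prim (.nil a b) (.const 1)

theorem cons {f : a.Val → b.Val} {g : a.Val → List b.Val} (hf : PolyTime a b f)
    (hg : PolyTime a (.list b) g) : PolyTime a (.list b) fun x => f x :: g x :=
  comp (b := .prod b (.list b)) (c := .list b) (g := fun y : b.Val × List b.Val => y.1 :: y.2)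
    (prim (.cons b) ((PolyBdd.size.add (.const 1)).mono fun x => by
      simp only [Ty.size, Prim.eval, List.map_cons, List.sum_cons]; omega)) (hf.pair hg)

theorem _root_.Nat.size_add_le (m n : ℕ) : (m + n).size ≤ m.size + n.size + 1 := by
  rw [Nat.size_le]
  have h1 := Nat.lt_size_self m
  have h2 := Nat.lt_size_self n
  have h3 : 2 ^ m.size ≤ 2 ^ (m.size + n.size) := Nat.pow_le_pow_right (by norm_num) (by omega)
  have h4 : 2 ^ n.size ≤ 2 ^ (m.size + n.size) := Nat.pow_le_pow_right (by norm_num) (by omega)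
  rw [pow_succ]; omega

theorem _root_.Nat.size_mul_le (m n : ℕ) : (m * n).size ≤ m.size + n.size := by
  rw [Nat.size_le, pow_add]
  exact Nat.mul_lt_mul'' (Nat.lt_size_self m) (Nat.lt_size_self n)

theorem add {f g : a.Val → ℕ} (hf : PolyTime a .nat f) (hg : PolyTime a .nat g) :
    PolyTime a .nat fun x => f x + g x :=
  comp (b := .prod .nat .nat) (c := .nat) (g := fun y : ℕ × ℕ => y.1 + y.2)
    (prim .add ((PolyBdd.size.add (.const 1)).mono fun x => by
      have := Nat.size_add_le x.1 x.2
      simp only [Ty.size, Prim.eval, Nat.add_eq]; omega)) (hf.pair hg)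

theorem sub {f g : a.Val → ℕ} (hf : PolyTime a .nat f) (hg : PolyTime a .nat g) :
    PolyTime a .nat fun x => f x - g x :=
  comp (b := .prod .nat .nat) (c := .nat) (g := fun y : ℕ × ℕ => y.1 - y.2)
    (prim .sub (PolyBdd.size.mono fun x => by
      have := Nat.size_le_size (Nat.sub_le x.1 x.2)
      simp only [Ty.size, Prim.eval, Nat.sub_eq]; omega)) (hf.pair hg)

theorem mul {f g : a.Val → ℕ} (hf : PolyTime a .nat f) (hg : PolyTime a .nat g) :
    PolyTime a .nat fun x => f x * g x :=
  comp (b := .prod .nat .nat) (c := .nat) (g := fun y : ℕ × ℕ => y.1 * y.2)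
    (prim .mul (PolyBdd.size.mono fun x => by
      have := Nat.size_mul_le x.1 x.2
      simp only [Ty.size, Prim.eval, Nat.mul_eq]; omega)) (hf.pair hg)

end PolyTime

/-- Some program decides `p` in polynomial time, answering `1` for yes and `0` for no. -/
def PolyTimePred (a : Ty) (p : a.Val → Prop) [DecidablePred p] : Prop :=
  PolyTime a .nat fun x => if p x then (1 : ℕ) else (0 : ℕ)

namespace PolyTime

variable {a b c d e σ : Ty}

theorem ite {p : a.Val → Prop} [DecidablePred p] {f g : a.Val → b.Val} (hp : PolyTimePred a p)
    (hf : PolyTime a b f) (hg : PolyTime a b g) :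
    PolyTime a b fun x => if p x then f x else g x :=
  (ite_ne_zero hp hf hg).of_eq fun x => by by_cases h : p x <;> simp [h]

theorem le {f g : a.Val → ℕ} (hf : PolyTime a .nat f) (hg : PolyTime a .nat g) :
    PolyTimePred a fun x => f x ≤ g x :=
  of_eq (comp (b := .prod .nat .nat) (c := .nat)
    (g := fun y : ℕ × ℕ => if Nat.ble y.1 y.2 then (1 : ℕ) else (0 : ℕ))
    (prim .le ((PolyBdd.const 2).mono fun x => by
      simp only [Ty.size, Prim.eval]
      split_ifs <;> simp)) (hf.pair hg)) fun x => by simp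

theorem not {p : a.Val → Prop} [DecidablePred p] (hp : PolyTimePred a p) :
    PolyTimePred a fun x => ¬ p x :=
  (ite hp (const 0) (const 1)).of_eq fun x => by by_cases h : p x <;> simp [h]

theorem and {p q : a.Val → Prop} [DecidablePred p] [DecidablePred q] (hp : PolyTimePred a p)
    (hq : PolyTimePred a q) : PolyTimePred a fun x => p x ∧ q x :=
  (ite hp hq (const 0)).of_eq fun x => by by_cases h : p x <;> simp [h]

theorem or {p q : a.Val → Prop} [DecidablePred p] [DecidablePred q] (hp : PolyTimePred a p)
    (hq : PolyTimePred a q) : PolyTimePred a fun x => p x ∨ q x :=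
  (ite hp (const 1) hq).of_eq fun x => by by_cases h : p x <;> simp [h]

theorem lt {f g : a.Val → ℕ} (hf : PolyTime a .nat f) (hg : PolyTime a .nat g) :
    PolyTimePred a fun x => f x < g x :=
  (le (hf.add (const 1)) hg).of_eq fun x => by rfl

theorem eq {f g : a.Val → ℕ} (hf : PolyTime a .nat f) (hg : PolyTime a .nat g) :
    PolyTimePred a fun x => f x = g x :=
  (and (le hf hg) (le hg hf)).of_eq fun x => by
    by_cases h : f x = g x
    · simp [h]
    · rw [if_neg h, if_neg fun h' => h (le_antisymm h'.1 h'.2)]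

theorem min {f g : a.Val → ℕ} (hf : PolyTime a .nat f) (hg : PolyTime a .nat g) :
    PolyTime a .nat fun x => Min.min (f x) (g x) :=
  (ite (le hf hg) hf hg).of_eq fun x => by rw [min_def]

/-- The run of a loop that takes `n` rounds, where `M` bounds the sizes of the states and the cost
of each execution of the condition and of the body. -/
theorem runs_loop {C : Prog a .nat} {P : Prog a a} {k : a.Val → ℕ} {f : a.Val → a.Val} {M : ℕ}
    (n : ℕ) (s : a.Val) (hk : ∀ i < n, k (f^[i] s) ≠ 0) (hk0 : k (f^[n] s) = 0)
    (hC : ∀ i ≤ n, ∃ t, C.Runs (f^[i] s) (k (f^[i] s)) t ∧ t ≤ M)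
    (hP : ∀ i ≤ n, ∃ t, P.Runs (f^[i] s) (f (f^[i] s)) t ∧ t ≤ M)
    (hs : ∀ i ≤ n, a.size (f^[i] s) ≤ M) :
    ∃ t, (Prog.loop C P).Runs s (f^[n] s) t ∧ t ≤ (n + 1) * (3 * M + 1) := by
  induction n generalizing s with
  | zero =>
    obtain ⟨t, ht, hle⟩ := hC 0 le_rfl
    have h1 := hs 0 le_rfl
    simp only [Function.iterate_zero, id] at ht hk0 h1
    rw [hk0] at ht
    exact ⟨_, .loop_done ht, by omega⟩
  | succ n ih =>
    obtain ⟨v, hv, hlev⟩ := ih (f s) (fun i hi => hk (i + 1) (by omega)) hk0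
      (fun i hi => hC (i + 1) (by omega)) (fun i hi => hP (i + 1) (by omega))
      (fun i hi => hs (i + 1) (by omega))
    obtain ⟨t, ht, hle⟩ := hC 0 (by omega)
    obtain ⟨u, hu, hleu⟩ := hP 0 (by omega)
    have h1 := hs 0 (by omega)
    have h2 := hk 0 (by omega)
    simp only [Function.iterate_zero, id] at ht hu h1 h2
    refine ⟨_, .loop_step ht h2 hu hv, ?_⟩
    rw [Nat.add_mul (n + 1) 1]
    omega

/-- A loop runs in polynomial time if its condition and its body do, and if the number of rounds and
the sizes of the states that actually occur are polynomially bounded. -/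
theorem loop {k : σ.Val → ℕ} {f : σ.Val → σ.Val} {init : a.Val → σ.Val} {n B : a.Val → ℕ}
    (hk : PolyTime σ .nat k) (hf : PolyTime σ σ f) (hi : PolyTime a σ init)
    (hn : PolyBdd a n) (hB : PolyBdd a B)
    (h1 : ∀ x, ∀ i < n x, k (f^[i] (init x)) ≠ 0) (h0 : ∀ x, k (f^[n x] (init x)) = 0)
    (hs : ∀ x, ∀ i ≤ n x, σ.size (f^[i] (init x)) ≤ B x) :
    PolyTime a σ fun x => f^[n x] (init x) := by
  obtain ⟨C, u, ⟨T, hT⟩, hC⟩ := hk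
  obtain ⟨P, v, ⟨U, hU⟩, hP⟩ := hf
  obtain ⟨I, w, hw, hI⟩ := hi
  refine ⟨.comp I (.loop C P), fun x => w x +
      (n x + 1) * (3 * (T.eval (B x) + U.eval (B x) + B x) + 1) + 1,
    (hw.add ((hn.add (.const 1)).mul (((PolyBdd.const 3).mul
      (((hB.eval T).add (hB.eval U)).add hB)).add (.const 1)))).add (.const 1), fun x => ?_⟩
  obtain ⟨t, ht, hle⟩ := hI x
  obtain ⟨t', ht', hle'⟩ := runs_loop (M := T.eval (B x) + U.eval (B x) + B x) (n x) (init x)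
    (h1 x) (h0 x)
    (fun i hi => by
      obtain ⟨r, hr, hl⟩ := hC (f^[i] (init x))
      have := hT (f^[i] (init x))
      have := T.eval_mono_nat (hs x i hi)
      exact ⟨r, hr, by omega⟩)
    (fun i hi => by
      obtain ⟨r, hr, hl⟩ := hP (f^[i] (init x))
      have := hU (f^[i] (init x))
      have := U.eval_mono_nat (hs x i hi)
      exact ⟨r, hr, by omega⟩)
    (fun i hi => (hs x i hi).trans (by omega))
  exact ⟨_, .comp ht ht', by beta_reduce; omega⟩

end PolyTime

/-! ### Folds and lists in polynomial time -/

theorem Ty.length_le_size {b : Ty} (l : List b.Val) : l.length ≤ (Ty.list b).size l := by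
  simp only [Ty.size]
  have := List.length_le_sum_of_one_le (l.map fun x => b.size x + 1) (by simp)
  rw [List.length_map] at this
  omega

theorem Ty.size_lt_of_mem {b : Ty} {l : List b.Val} {x : b.Val} (h : x ∈ l) :
    b.size x < (Ty.list b).size l := by
  simp only [Ty.size]
  have := List.single_le_sum (l := l.map fun x => b.size x + 1) (by simp) _
    (List.mem_map_of_mem h)
  omega

theorem Ty.size_append {b : Ty} (l l' : List b.Val) :
    (Ty.list b).size (l ++ l') + 1 = (Ty.list b).size l + (Ty.list b).size l' := by
  simp only [Ty.size, List.map_append, List.sum_append]; omega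

theorem Ty.size_cons {b : Ty} (x : b.Val) (l : List b.Val) :
    (Ty.list b).size (x :: l) = b.size x + 1 + (Ty.list b).size l := by
  simp only [Ty.size, List.map_cons, List.sum_cons]; omega

theorem Ty.size_drop_le {b : Ty} (l : List b.Val) (i : ℕ) :
    (Ty.list b).size (l.drop i) ≤ (Ty.list b).size l := by
  have := Ty.size_append (l.take i) (l.drop i)
  rw [List.take_append_drop] at this
  have h : 1 ≤ (Ty.list b).size (l.take i) := by simp only [Ty.size]; omega
  omega

namespace PolyTime

variable {a b c d e σ : Ty}

/-- A fold runs in polynomial time if its step does and if the intermediate states have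
polynomially bounded size. -/
theorem foldl {step : a.Val → σ.Val → e.Val → σ.Val} {init : a.Val → σ.Val}
    {l : a.Val → List e.Val} {B : a.Val → ℕ}
    (hs : PolyTime (.prod (.prod a σ) e) σ
      fun y : (a.Val × σ.Val) × e.Val => step y.1.1 y.1.2 y.2)
    (hi : PolyTime a σ init) (hl : PolyTime a (.list e) l) (hB : PolyBdd a B)
    (h : ∀ x i, σ.size (((l x).take i).foldl (step x) (init x)) ≤ B x) :
    PolyTime a σ fun x => (l x).foldl (step x) (init x) := by
  -- the state of the loop holds the input, the state of the fold, and the rest of the list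
  let body : (a.Val × σ.Val) × List e.Val → (a.Val × σ.Val) × List e.Val := fun y =>
    match y.2 with
    | [] => (y.1, [])
    | h :: t => ((y.1.1, step y.1.1 y.1.2 h), t)
  have hbody : PolyTime (.prod (.prod a σ) (.list e)) (.prod (.prod a σ) (.list e)) body :=
    of_eq (caseList (f := fun z : a.Val × σ.Val => (z, ([] : List e.Val)))
      (g := fun z : (a.Val × σ.Val) × (e.Val × List e.Val) =>
        ((z.1.1, step z.1.1 z.1.2 z.2.1), z.2.2))
      (c := .prod (.prod a σ) (.list e))
      (PolyTime.id.pair nil)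
      (pair (pair PolyTime.id.fst.fst (comp hs (pair PolyTime.id.fst PolyTime.id.snd.fst)))
        PolyTime.id.snd.snd)) fun y => by
      rcases y with ⟨y, _ | ⟨h, t⟩⟩ <;> rfl
  let k : (a.Val × σ.Val) × List e.Val → ℕ := fun y => match y.2 with
    | [] => 0
    | _ :: _ => 1
  have hk : PolyTime (.prod (.prod a σ) (.list e)) .nat k :=
    of_eq (caseList (f := fun _ => (0 : ℕ)) (g := fun _ => (1 : ℕ)) (c := .nat) (const 0)
      (const 1)) fun y => by
      rcases y with ⟨y, _ | ⟨h, t⟩⟩ <;> rfl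
  have key : ∀ x, ∀ i ≤ (l x).length, body^[i] ((x, init x), l x) =
      ((x, ((l x).take i).foldl (step x) (init x)), (l x).drop i) := by
    intro x i
    induction i with
    | zero => intro _; simp
    | succ i ih =>
      intro hi
      rw [Function.iterate_succ_apply', ih (by omega), List.drop_eq_getElem_cons (by omega),
        List.take_succ_eq_append_getElem (by omega), List.foldl_append]
      rfl
  have hn : PolyBdd a fun x => (l x).length :=
    hl.polyBdd_size.mono fun x => Ty.length_le_size (l x)
  have hloop := loop (init := fun x => ((x, init x), l x)) (n := fun x => (l x).length)
    (B := fun x => a.size x + B x + (Ty.list e).size (l x) + 2) hk hbody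
    ((PolyTime.id.pair hi).pair hl) hn (((PolyBdd.size.add hB).add hl.polyBdd_size).add (.const 2))
    (fun x i hi => by
      rw [key x i hi.le, List.drop_eq_getElem_cons hi]
      exact one_ne_zero)
    (fun x => by rw [key x _ le_rfl, List.drop_length])
    (fun x i hi => by
      rw [key x i hi]
      have h1 := h x i
      have h2 := Ty.size_drop_le (l x) i
      simp only [Ty.size] at h1 h2 ⊢
      omega)
  exact of_eq hloop.fst.snd fun x => by rw [key x _ le_rfl, List.take_length]

/-- A fold runs in polynomial time if its step does and if no step enlarges the state by more
than a polynomial in the size of the input. -/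
theorem foldl_of_size_le {step : a.Val → σ.Val → e.Val → σ.Val} {init : a.Val → σ.Val}
    {l : a.Val → List e.Val} {B : a.Val → ℕ}
    (hs : PolyTime (.prod (.prod a σ) e) σ
      fun y : (a.Val × σ.Val) × e.Val => step y.1.1 y.1.2 y.2)
    (hi : PolyTime a σ init) (hl : PolyTime a (.list e) l) (hB : PolyBdd a B)
    (h : ∀ x s, ∀ y ∈ l x, σ.size (step x s y) ≤ σ.size s + B x) :
    PolyTime a σ fun x => (l x).foldl (step x) (init x) := by
  refine foldl (B := fun x => σ.size (init x) + (Ty.list e).size (l x) * B x) hs hi hl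
    (hi.polyBdd_size.add (hl.polyBdd_size.mul hB)) fun x i => ?_
  have key : ∀ (l' : List e.Val) (s : σ.Val), (∀ y ∈ l', y ∈ l x) →
      σ.size (l'.foldl (step x) s) ≤ σ.size s + l'.length * B x := by
    intro l'
    induction l' with
    | nil => intro s _; simp
    | cons y l' ih =>
      intro s hl'
      have h1 := ih (step x s y) fun z hz => hl' z (List.mem_cons_of_mem _ hz)
      have h2 := h x s y (hl' y List.mem_cons_self)
      rw [List.foldl_cons, List.length_cons, Nat.add_mul, Nat.one_mul]
      omega
  refine (key _ _ fun y hy => List.mem_of_mem_take hy).trans ?_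
  have := Ty.length_le_size (l x)
  gcongr
  exact (List.length_take_le' _ _).trans this

end PolyTime

theorem Ty.size_list_le {b : Ty} {l : List b.Val} {M : ℕ} (h : ∀ x ∈ l, b.size x ≤ M) :
    (Ty.list b).size l ≤ l.length * (M + 1) + 1 := by
  have := List.sum_le_card_nsmul (l.map fun x => b.size x + 1) (M + 1) (by
    intro n hn
    obtain ⟨x, hx, rfl⟩ := List.mem_map.1 hn
    have := h x hx
    omega)
  rw [List.length_map, smul_eq_mul] at this
  simp only [Ty.size]
  omega

namespace PolyTime

variable {a b c e σ : Ty}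

/-- A fold runs in polynomial time if its step does and if some invariant bounds the size of the
state by a polynomial. -/
theorem foldl_of_inv {step : a.Val → σ.Val → e.Val → σ.Val} {init : a.Val → σ.Val}
    {l : a.Val → List e.Val} {B : a.Val → ℕ} (Inv : a.Val → σ.Val → Prop)
    (hs : PolyTime (.prod (.prod a σ) e) σ
      fun y : (a.Val × σ.Val) × e.Val => step y.1.1 y.1.2 y.2)
    (hi : PolyTime a σ init) (hl : PolyTime a (.list e) l) (hB : PolyBdd a B)
    (h0 : ∀ x, Inv x (init x)) (h1 : ∀ x s, ∀ y ∈ l x, Inv x s → Inv x (step x s y))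
    (h2 : ∀ x s, Inv x s → σ.size s ≤ B x) :
    PolyTime a σ fun x => (l x).foldl (step x) (init x) := by
  refine foldl hs hi hl hB fun x i => h2 x _ ?_
  have key : ∀ (l' : List e.Val) (s : σ.Val), (∀ y ∈ l', y ∈ l x) → Inv x s →
      Inv x (l'.foldl (step x) s) := by
    intro l'
    induction l' with
    | nil => intro s _ h; exact h
    | cons y l' ih =>
      intro s hl' h
      exact ih _ (fun z hz => hl' z (List.mem_cons_of_mem _ hz))
        (h1 x s y (hl' y List.mem_cons_self) h)
  exact key _ _ (fun y hy => List.mem_of_mem_take hy) (h0 x)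

theorem comp_pred {p : b.Val → Prop} [DecidablePred p] {f : a.Val → b.Val}
    (hp : PolyTimePred b p) (hf : PolyTime a b f) : PolyTimePred a fun x => p (f x) :=
  comp hp hf

theorem reverse {l : a.Val → List b.Val} (hl : PolyTime a (.list b) l) :
    PolyTime a (.list b) fun x => (l x).reverse :=
  of_eq (foldl_of_size_le (step := fun _ s y => y :: s) (init := fun _ => [])
    (B := fun x => (Ty.list b).size (l x))
    (cons PolyTime.id.snd PolyTime.id.fst.snd) nil hl hl.polyBdd_size
    fun x s y hy => by
      have := Ty.size_lt_of_mem hy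
      rw [Ty.size_cons]
      omega) fun x => by simp

theorem append {l l' : a.Val → List b.Val} (hl : PolyTime a (.list b) l)
    (hl' : PolyTime a (.list b) l') : PolyTime a (.list b) fun x => l x ++ l' x :=
  of_eq (foldl_of_size_le (step := fun _ s y => y :: s) (init := l')
    (B := fun x => (Ty.list b).size (l x).reverse)
    (cons PolyTime.id.snd PolyTime.id.fst.snd) hl' hl.reverse hl.reverse.polyBdd_size
    fun x s y hy => by
      have := Ty.size_lt_of_mem hy
      rw [Ty.size_cons]
      omega) fun x => by simp

theorem map {g : a.Val → b.Val → c.Val} {l : a.Val → List b.Val}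
    (hg : PolyTime (.prod a b) c fun y : a.Val × b.Val => g y.1 y.2)
    (hl : PolyTime a (.list b) l) : PolyTime a (.list c) fun x => (l x).map (g x) := by
  obtain ⟨T, hT⟩ := hg.polyBdd_size
  refine of_eq (reverse (foldl_of_size_le (step := fun x s y => g x y :: s) (init := fun _ => [])
    (B := fun x => T.eval (a.size x + (Ty.list b).size (l x)) + 1)
    (cons (comp hg (pair PolyTime.id.fst.fst PolyTime.id.snd)) PolyTime.id.fst.snd) nil hl
    (((PolyBdd.size.add hl.polyBdd_size).eval T).add (.const 1))
    fun x s y hy => ?_)) fun x => ?_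
  · have h1 := Ty.size_lt_of_mem hy
    have h2 := hT (x, y)
    have h3 : Ty.size (.prod a b) (x, y) ≤ a.size x + (Ty.list b).size (l x) := by
      simp only [Ty.size] at h1 ⊢; omega
    have h4 := T.eval_mono_nat h3
    dsimp only at h2
    rw [Ty.size_cons]
    omega
  · have : ∀ (l' : List b.Val) s, l'.foldl (fun s y => g x y :: s) s =
        (l'.map (g x)).reverse ++ s := by
      intro l'
      induction l' with
      | nil => intro s; rfl
      | cons y l' ih => intro s; simp [ih]
    rw [this]
    simp

theorem filter {p : a.Val → b.Val → Prop} [∀ x, DecidablePred (p x)] {l : a.Val → List b.Val}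
    (hp : PolyTimePred (.prod a b) fun y : a.Val × b.Val => p y.1 y.2)
    (hl : PolyTime a (.list b) l) :
    PolyTime a (.list b) fun x => (l x).filter fun y => p x y := by
  refine of_eq (reverse (foldl_of_size_le (step := fun x s y => if p x y then y :: s else s)
    (init := fun _ => []) (B := fun x => (Ty.list b).size (l x))
    (ite (p := fun y : (a.Val × List b.Val) × b.Val => p y.1.1 y.2)
      (comp_pred hp (pair PolyTime.id.fst.fst PolyTime.id.snd))
      (cons PolyTime.id.snd PolyTime.id.fst.snd) PolyTime.id.fst.snd) nil hl hl.polyBdd_size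
    fun x s y hy => ?_)) fun x => ?_
  · have := Ty.size_lt_of_mem hy
    split_ifs
    · rw [Ty.size_cons]; omega
    · omega
  · have : ∀ (l' : List b.Val) s, l'.foldl (fun s y => if p x y then y :: s else s) s =
        (l'.filter fun y => p x y).reverse ++ s := by
      intro l'
      induction l' with
      | nil => intro s; rfl
      | cons y l' ih => intro s; by_cases h : p x y <;> simp [ih, h]
    rw [this]
    simp

theorem flatten {l : a.Val → List (List b.Val)} (hl : PolyTime a (.list (.list b)) l) :
    PolyTime a (.list b) fun x => (l x).flatten := by
  refine of_eq (foldl_of_size_le (step := fun _ s y => s ++ y) (init := fun _ => [])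
    (B := fun x => (Ty.list (.list b)).size (l x))
    (append PolyTime.id.fst.snd PolyTime.id.snd) nil hl hl.polyBdd_size
    fun x s y hy => ?_) fun x => ?_
  · have h1 := Ty.size_append s y
    have h2 := Ty.size_lt_of_mem hy
    omega
  · have : ∀ (l' : List (List b.Val)) s, l'.foldl (fun s y => s ++ y) s = s ++ l'.flatten := by
      intro l'
      induction l' with
      | nil => intro s; simp
      | cons y l' ih => intro s; simp [ih]
    rw [this]
    simp

theorem mem {f : a.Val → ℕ} {l : a.Val → List ℕ} (hf : PolyTime a .nat f)
    (hl : PolyTime a (.list .nat) l) : PolyTimePred a fun x => f x ∈ l x := by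
  have hs : PolyTime (.prod (.prod a .nat) .nat) .nat
      fun y : (a.Val × ℕ) × ℕ => if f y.1.1 = y.2 then (1 : ℕ) else y.1.2 :=
    ite (b := .nat) (eq (comp hf PolyTime.id.fst.fst) PolyTime.id.snd) (const 1)
      PolyTime.id.fst.snd
  refine of_eq (foldl_of_size_le (σ := .nat) (e := .nat)
    (step := fun x s y => if f x = y then (1 : ℕ) else s) (init := fun _ => (0 : ℕ))
    (B := fun _ => 2)
    hs
    (const 0) hl (.const 2) fun x s y _ => ?_) fun x => ?_
  · split_ifs
    · simp [Ty.size]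
    · omega
  · have : ∀ (l' : List ℕ) s, l'.foldl (fun s y => if f x = y then (1 : ℕ) else s) s =
        if f x ∈ l' then 1 else s := by
      intro l'
      induction l' with
      | nil => intro s; simp
      | cons y l' ih =>
        intro s
        rw [List.foldl_cons, ih]
        by_cases h : f x = y <;> simp [h]
    exact this (l x) 0

theorem sum {l : a.Val → List ℕ} (hl : PolyTime a (.list .nat) l) :
    PolyTime a .nat fun x => (l x).sum := by
  refine of_eq (foldl_of_size_le (σ := .nat) (e := .nat)
    (step := fun _ s y => s + y) (init := fun _ => (0 : ℕ))
    (B := fun x => (Ty.list .nat).size (l x))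
    (add PolyTime.id.fst.snd PolyTime.id.snd)
    (const 0) hl hl.polyBdd_size fun x s y hy => ?_) fun x => ?_
  · have h1 := Ty.size_lt_of_mem (b := .nat) hy
    have h2 := Nat.size_add_le s y
    simp only [Ty.size] at h1 ⊢
    omega
  · exact (List.sum_eq_foldl (xs := l x)).symm

theorem zipIdx {l : a.Val → List b.Val} (hl : PolyTime a (.list b) l) :
    PolyTime a (.list (.prod b .nat)) fun x => (l x).zipIdx := by
  have key : ∀ (l' : List b.Val) (s : List (b.Val × ℕ)) (n : ℕ),
      l'.foldl (fun s y => ((y, s.2) :: s.1, s.2 + 1)) (s, n) =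
        ((l'.zipIdx n).reverse ++ s, n + l'.length) := by
    intro l'
    induction l' with
    | nil => intro s n; simp
    | cons y l' ih => intro s n; simp [ih]; omega
  refine of_eq (reverse (fst (foldl (σ := .prod (.list (.prod b .nat)) .nat) (e := b)
    (step := fun _ s y => ((y, s.2) :: s.1, s.2 + 1)) (init := fun _ => ([], (0 : ℕ)))
    (B := fun x => (Ty.list b).size (l x) * ((Ty.list b).size (l x) +
      ((Ty.list b).size (l x) + 1) + 1 + 1) + 1 + ((Ty.list b).size (l x) + 1) + 1)
    (pair (cons (pair PolyTime.id.snd PolyTime.id.fst.snd.snd) PolyTime.id.fst.snd.fst)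
      (add PolyTime.id.fst.snd.snd (const 1)))
    (pair nil (const 0)) hl
    ((((hl.polyBdd_size.mul (((hl.polyBdd_size.add (hl.polyBdd_size.add (.const 1))).add
      (.const 1)).add (.const 1))).add (.const 1)).add
      (hl.polyBdd_size.add (.const 1))).add (.const 1))
    fun x i => ?_))) fun x => ?_
  · rw [key, Nat.zero_add, List.append_nil]
    have hlen : ((l x).take i).length ≤ (Ty.list b).size (l x) :=
      (List.length_take_le' _ _).trans (Ty.length_le_size _)
    have h1 : ∀ n : ℕ, n ≤ (Ty.list b).size (l x) → Ty.nat.size n ≤ (Ty.list b).size (l x) + 1 :=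
      fun n hn => by
        have : n.size ≤ n := Nat.size_le.2 Nat.lt_two_pow_self
        simp only [Ty.size] at hn ⊢
        omega
    have h2 : (Ty.list (.prod b .nat)).size (((l x).take i).zipIdx).reverse ≤ _ :=
      Ty.size_list_le (b := .prod b .nat) (M := (Ty.list b).size (l x) +
        ((Ty.list b).size (l x) + 1) + 1) (by
      rintro ⟨y, n⟩ hy
      obtain ⟨-, hn, h⟩ := List.mem_zipIdx (List.mem_reverse.1 hy)
      have h3 := h1 n (by omega)
      rw [h]
      have h4 : b.size ((l x).take i)[n - 0] < (Ty.list b).size (l x) :=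
        Ty.size_lt_of_mem (List.mem_of_mem_take (List.getElem_mem _))
      simp only [Ty.size] at h3 h4 ⊢
      omega)
    rw [List.length_reverse, List.length_zipIdx] at h2
    have h5 := h1 _ hlen
    have h6 := Nat.mul_le_mul_right ((Ty.list b).size (l x) +
      ((Ty.list b).size (l x) + 1) + 1 + 1) hlen
    have h7 := h2.trans (Nat.add_le_add_right h6 1)
    exact Nat.add_le_add_right (Nat.add_le_add h7 h5) 1
  · rw [key]
    simp

/-- The numbers less than the length of a list can be listed in polynomial time. -/
theorem range_length {l : a.Val → List b.Val} (hl : PolyTime a (.list b) l) :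
    PolyTime a (.list .nat) fun x => List.range (l x).length :=
  of_eq (map (g := fun _ (y : b.Val × ℕ) => y.2) PolyTime.id.snd.snd hl.zipIdx) fun x => by
    simp [List.range_eq_range']

end PolyTime

/-! ### Maximum flows with unit capacities -/

/-- One step of the growth of a search tree: the state holds the nodes of the tree, its arcs, and
the arcs that are left; the arc `e` joins the tree if it leads out of it. -/
def growStep (st : List ℕ × (List (ℕ × ℕ) × List (ℕ × ℕ))) (e : ℕ × ℕ) :
    List ℕ × (List (ℕ × ℕ) × List (ℕ × ℕ)) :=
  if e.1 ∈ st.1 ∧ ¬ e.2 ∈ st.1 then (e.2 :: st.1, (e :: st.2.1, st.2.2))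
  else (st.1, (st.2.1, e :: st.2.2))

/-- Offer each of the arcs that are left to the tree once. -/
def growRound (st : List ℕ × (List (ℕ × ℕ) × List (ℕ × ℕ))) :
    List ℕ × (List (ℕ × ℕ) × List (ℕ × ℕ)) :=
  st.2.2.foldl growStep (st.1, (st.2.1, []))

/-- A maximal search tree with root `s`: its nodes, its arcs (the latest first), and the other
arcs. -/
def grow (L : List (ℕ × ℕ)) (s : ℕ) : List ℕ × (List (ℕ × ℕ) × List (ℕ × ℕ)) :=
  L.foldl (fun st _ => growRound st) ([s], ([], L))

/-- One step of the way back to the root: the state holds the current node and the arcs handled so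
far, where those of the path are reversed. -/
def backStep (st : ℕ × List (ℕ × ℕ)) (e : ℕ × ℕ) : ℕ × List (ℕ × ℕ) :=
  if e.2 = st.1 then (e.1, (e.2, e.1) :: st.2) else (st.1, e :: st.2)

/-- Reverse a path from `s` to `t`, if there is one, and count it. -/
def augment (s t : ℕ) (st : List (ℕ × ℕ) × ℕ) : List (ℕ × ℕ) × ℕ :=
  if t ∈ (grow st.1 s).1 then
    (((grow st.1 s).2.1.foldl backStep (t, (grow st.1 s).2.2)).2, st.2 + 1)
  else st

/-- The maximum number of arc-disjoint paths from `s` to `t` in the digraph with arc list `L`,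
computed by augmenting paths; the residual graph is the only record of the flow. -/
def maxFlow (L : List (ℕ × ℕ)) (s t : ℕ) : ℕ :=
  (L.foldl (fun st _ => augment s t st) (L, 0)).2

/-- The number of arcs in `L` that leave the node set `X`. -/
def cutVal (L : List (ℕ × ℕ)) (X : ℕ → Bool) : ℕ :=
  L.countP fun e => X e.1 && !X e.2

/-- The arcs in `K` form a flow of value `k` from `s` to `t`. Conservation is expressed by testing
against all potentials, which makes flows additive and is stable under reversal. -/
def IsArcFlow (K : Multiset (ℕ × ℕ)) (s t : ℕ) (k : ℤ) : Prop :=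
  ∀ φ : ℕ → ℤ, (K.map fun e => φ e.1 - φ e.2).sum = k * (φ s - φ t)

/-- `vis` are the nodes and `T` the arcs (the latest first) of a tree grown from the root `s`. -/
inductive IsSearchTree (s : ℕ) : List ℕ → List (ℕ × ℕ) → Prop
  | root : IsSearchTree s [s] []
  | grow {vis : List ℕ} {T : List (ℕ × ℕ)} {e : ℕ × ℕ} (h : IsSearchTree s vis T)
      (h1 : e.1 ∈ vis) (h2 : e.2 ∉ vis) : IsSearchTree s (e.2 :: vis) (e :: T)

theorem IsSearchTree.head_mem {s : ℕ} {vis : List ℕ} {T : List (ℕ × ℕ)}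
    (h : IsSearchTree s vis T) : s ∈ vis ∧ (∀ e ∈ T, e.2 ∈ vis) ∧
      edgesTy.size T + (s.size + 2) ≥ (Ty.list .nat).size vis := by
  induction h with
  | root => simp [Ty.size]
  | grow h h1 h2 ih =>
    refine ⟨List.mem_cons_of_mem _ ih.1, ?_, ?_⟩
    · intro e he
      rcases List.mem_cons.1 he with rfl | he
      · exact List.mem_cons_self
      · exact List.mem_cons_of_mem _ (ih.2.1 e he)
    · have := ih.2.2
      simp only [Ty.size, List.map_cons, List.sum_cons] at this ⊢
      omega

/-- Walking back from `x` to the root reverses the arcs of a path. -/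
theorem IsSearchTree.exists_path {s : ℕ} {vis : List ℕ} {T : List (ℕ × ℕ)}
    (h : IsSearchTree s vis T) : ∀ x ∈ vis, ∀ acc, ∃ P N : List (ℕ × ℕ), T.Perm (P ++ N) ∧
      (T.foldl backStep (x, acc)).2.Perm (P.map Prod.swap ++ (N ++ acc)) ∧
      IsArcFlow P s x 1 := by
  induction h with
  | root =>
    intro x hx acc
    obtain rfl := List.mem_singleton.1 hx
    exact ⟨[], [], by simp, by simp, fun φ => by simp⟩
  | @grow vis T e h h1 h2 ih =>
    intro x hx acc
    by_cases hex : e.2 = x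
    · obtain ⟨P, N, hT, hf, hP⟩ := ih e.1 h1 ((e.2, e.1) :: acc)
      refine ⟨e :: P, N, hT.cons e, ?_, fun φ => ?_⟩
      · rw [List.foldl_cons, backStep, if_pos hex]
        refine hf.trans ?_
        rw [List.map_cons, List.cons_append, ← List.append_assoc, ← List.append_assoc]
        exact List.perm_middle
      · have := hP φ
        simp only [Multiset.map_coe, Multiset.sum_coe, List.map_cons, List.sum_cons] at this ⊢
        rw [this, hex]; ring
    · have hx' : x ∈ vis := (List.mem_cons.1 hx).resolve_left (Ne.symm hex)
      obtain ⟨P, N, hT, hf, hP⟩ := ih x hx' (e :: acc)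
      refine ⟨P, e :: N, (hT.cons e).trans List.perm_middle.symm, ?_, hP⟩
      rw [List.foldl_cons, backStep, if_neg hex]
      refine hf.trans (List.Perm.append_left _ ?_)
      exact List.perm_middle

/-- Offering the arcs in `l` to a tree keeps it a tree and loses no arc. If some arc leads out of
the tree, then fewer arcs are left; otherwise the tree does not change. -/
theorem growStep_foldl {s : ℕ} (l : List (ℕ × ℕ)) :
    ∀ (vis : List ℕ) (T acc : List (ℕ × ℕ)), IsSearchTree s vis T →
      ∃ vis' T' N', l.foldl growStep (vis, (T, acc)) = (vis', (T', N')) ∧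
        IsSearchTree s vis' T' ∧ (T' ++ N').Perm (T ++ (acc ++ l)) ∧
        N'.length ≤ acc.length + l.length ∧
        ((∃ e ∈ l, e.1 ∈ vis ∧ e.2 ∉ vis) → N'.length < acc.length + l.length) ∧
        ((∀ e ∈ l, ¬ (e.1 ∈ vis ∧ e.2 ∉ vis)) → vis' = vis ∧ N' = l.reverse ++ acc) := by
  induction l with
  | nil => intro vis T acc h; exact ⟨vis, T, acc, rfl, h, by simp, by simp, by simp, by simp⟩
  | cons e l ih =>
    intro vis T acc h
    by_cases he : e.1 ∈ vis ∧ e.2 ∉ vis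
    · obtain ⟨vis', T', N', h1, h2, h3, h4, h5, h6⟩ :=
        ih (e.2 :: vis) (e :: T) acc (h.grow he.1 he.2)
      refine ⟨vis', T', N', ?_, h2, h3.trans ?_, ?_, ?_, ?_⟩
      · rw [List.foldl_cons, growStep, if_pos he, h1]
      · rw [← List.append_assoc, ← List.append_assoc]
        exact List.perm_middle.symm
      · rw [List.length_cons]; omega
      · rw [List.length_cons]; omega
      · intro h; exact absurd he (h e List.mem_cons_self)
    · obtain ⟨vis', T', N', h1, h2, h3, h4, h5, h6⟩ := ih vis T (e :: acc) h
      rw [List.length_cons] at h4 h5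
      refine ⟨vis', T', N', ?_, h2, h3.trans ?_, ?_, ?_, ?_⟩
      · rw [List.foldl_cons, growStep, if_neg he, h1]
      · exact List.Perm.append_left _ List.perm_middle.symm
      · rw [List.length_cons]; omega
      · rintro ⟨e', he', hc⟩
        rcases List.mem_cons.1 he' with rfl | he'
        · exact absurd hc he
        · have := h5 ⟨e', he', hc⟩
          rw [List.length_cons]; omega
      · intro h
        obtain ⟨h7, h8⟩ := h6 fun e' he' => h e' (List.mem_cons_of_mem _ he')
        exact ⟨h7, by simp [h8]⟩

theorem growRound_spec {s : ℕ} {vis : List ℕ} {T N : List (ℕ × ℕ)} (h : IsSearchTree s vis T) :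
    ∃ vis' T' N', growRound (vis, (T, N)) = (vis', (T', N')) ∧
      IsSearchTree s vis' T' ∧ (T' ++ N').Perm (T ++ N) ∧
      ((∀ e ∈ N, ¬ (e.1 ∈ vis ∧ e.2 ∉ vis)) → ∀ e ∈ N', ¬ (e.1 ∈ vis' ∧ e.2 ∉ vis')) ∧
      (N'.length < N.length ∨ ∀ e ∈ N', ¬ (e.1 ∈ vis' ∧ e.2 ∉ vis')) := by
  obtain ⟨vis', T', N', h1, h2, h3, -, h5, h6⟩ := growStep_foldl N vis T [] h
  have h7 : (∀ e ∈ N, ¬ (e.1 ∈ vis ∧ e.2 ∉ vis)) → ∀ e ∈ N', ¬ (e.1 ∈ vis' ∧ e.2 ∉ vis') := by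
    intro hN
    obtain ⟨rfl, rfl⟩ := h6 hN
    simpa using hN
  refine ⟨vis', T', N', h1, h2, by simpa using h3, h7, ?_⟩
  by_cases hN : ∃ e ∈ N, e.1 ∈ vis ∧ e.2 ∉ vis
  · exact .inl (by simpa using h5 hN)
  · exact .inr (h7 fun e he hc => hN ⟨e, he, hc⟩)

/-- Each round shortens the list of the remaining arcs unless the tree is already maximal, hence
as many rounds as there are arcs suffice. -/
theorem grow_spec (L : List (ℕ × ℕ)) (s : ℕ) :
    ∃ vis T N, grow L s = (vis, (T, N)) ∧ IsSearchTree s vis T ∧ (T ++ N).Perm L ∧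
      ∀ e ∈ N, ¬ (e.1 ∈ vis ∧ e.2 ∉ vis) := by
  have key : ∀ (l : List (ℕ × ℕ)) (vis : List ℕ) (T N : List (ℕ × ℕ)), IsSearchTree s vis T →
      (N.length ≤ l.length ∨ ∀ e ∈ N, ¬ (e.1 ∈ vis ∧ e.2 ∉ vis)) →
      ∃ vis' T' N', l.foldl (fun st _ => growRound st) (vis, (T, N)) = (vis', (T', N')) ∧
        IsSearchTree s vis' T' ∧ (T' ++ N').Perm (T ++ N) ∧
        ∀ e ∈ N', ¬ (e.1 ∈ vis' ∧ e.2 ∉ vis') := by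
    intro l
    induction l with
    | nil =>
      intro vis T N h hN
      refine ⟨vis, T, N, rfl, h, .refl _, ?_⟩
      rcases hN with hN | hN
      · rw [List.length_nil, Nat.le_zero, List.length_eq_zero_iff] at hN
        subst hN
        simp
      · exact hN
    | cons a l ih =>
      intro vis T N h hN
      obtain ⟨vis', T', N', h1, h2, h3, h4, h5⟩ := growRound_spec (N := N) h
      rw [List.length_cons] at hN
      obtain ⟨vis'', T'', N'', g1, g2, g3, g4⟩ := ih vis' T' N' h2 (by
        rcases hN with hN | hN
        · rcases h5 with h5 | h5
          · exact .inl (by omega)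
          · exact .inr h5
        · exact .inr (h4 hN))
      exact ⟨vis'', T'', N'', by rw [List.foldl_cons, h1, g1], g2, g3.trans h3, g4⟩
  obtain ⟨vis, T, N, h1, h2, h3, h4⟩ := key L [s] [] L .root (.inl le_rfl)
  exact ⟨vis, T, N, h1, h2, h3, h4⟩

theorem cutVal_append (L L' : List (ℕ × ℕ)) (X : ℕ → Bool) :
    cutVal (L ++ L') X = cutVal L X + cutVal L' X := List.countP_append

theorem cutVal_perm {L L' : List (ℕ × ℕ)} (h : L.Perm L') (X : ℕ → Bool) :
    cutVal L X = cutVal L' X := h.countP_eq _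

theorem cutVal_eq_zero {L : List (ℕ × ℕ)} {X : ℕ → Bool}
    (h : ∀ e ∈ L, X e.1 = true → X e.2 = true) : cutVal L X = 0 :=
  List.countP_eq_zero.2 fun e he => by
    have := h e he
    cases h1 : X e.1 <;> simp_all

/-- Reversing arcs lowers the value of a cut by their net flow across it. -/
theorem cutVal_sub_swap (P : List (ℕ × ℕ)) (X : ℕ → Bool) :
    (cutVal P X : ℤ) - cutVal (P.map Prod.swap) X =
      (P.map fun e => (X e.1).toInt - (X e.2).toInt).sum := by
  induction P with
  | nil => rfl
  | cons e P ih =>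
    rw [List.map_cons, List.map_cons, List.sum_cons, ← ih]
    unfold cutVal
    rw [List.countP_cons, List.countP_cons]
    cases h1 : X e.1 <;> cases h2 : X e.2 <;> simp [h1, h2] <;> ring

/-- A flow in the graph with a path reversed, together with the path, is a flow in the graph. -/
theorem IsArcFlow.of_swap {P N : Multiset (ℕ × ℕ)} {s t : ℕ} {k : ℤ} (hP : IsArcFlow P s t 1)
    {K : Multiset (ℕ × ℕ)} (hK : IsArcFlow K s t k) (hle : K ≤ P.map Prod.swap + N) :
    ∃ K' ≤ P + N, IsArcFlow K' s t (k + 1) := by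
  -- the flow cancels the path along the reversed arcs that it uses
  set A := P.map Prod.swap with hA
  have hsw : (K ∩ A).map Prod.swap ≤ P := by
    have := Multiset.map_le_map (f := Prod.swap) (Multiset.inter_le_right : K ∩ A ≤ A)
    simpa [hA] using this
  have hN : K - A ≤ N := by rw [tsub_le_iff_left]; exact hle
  obtain ⟨Q, hQ⟩ := Multiset.le_iff_exists_add.1 hsw
  refine ⟨Q + (K - A), add_le_add (hQ ▸ Multiset.le_add_left _ _) hN, fun φ => ?_⟩
  have h1 := hP φ
  have h2 := hK φ
  rw [hQ, Multiset.map_add, Multiset.sum_add, Multiset.map_map] at h1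
  rw [← Multiset.sub_add_inter K A, Multiset.map_add, Multiset.sum_add] at h2
  have h3 : ((K ∩ A).map ((fun e => φ e.1 - φ e.2) ∘ Prod.swap)).sum =
      - ((K ∩ A).map fun e => φ e.1 - φ e.2).sum := by
    rw [← Multiset.sum_map_neg]
    congr 1
    exact Multiset.map_congr rfl fun e _ => by simp
  rw [h3] at h1
  rw [Multiset.map_add, Multiset.sum_add]
  linear_combination h1 + h2

/-- Reversing a path from `s` to `t` lowers the value of every cut, and of every flow, by one. -/
theorem augment_spec {s t : ℕ} (L : List (ℕ × ℕ)) (n : ℕ) :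
    (augment s t (L, n)).2 ≤ n + 1 ∧
    edgesTy.size (augment s t (L, n)).1 = edgesTy.size L ∧
    (∀ X : ℕ → Bool, X s = true → X t = false →
      cutVal L X + n = cutVal (augment s t (L, n)).1 X + (augment s t (L, n)).2) ∧
    (∀ K : Multiset (ℕ × ℕ), ∀ k : ℤ, K ≤ (augment s t (L, n)).1 → IsArcFlow K s t k →
      ∃ K' : Multiset (ℕ × ℕ), K' ≤ L ∧
        IsArcFlow K' s t (k + ((augment s t (L, n)).2 - n))) ∧
    ((augment s t (L, n)).2 = n + 1 ∨
      ∃ X : ℕ → Bool, X s = true ∧ X t = false ∧ cutVal (augment s t (L, n)).1 X = 0) := by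
  obtain ⟨vis, T, N, h1, h2, h3, h4⟩ := grow_spec L s
  by_cases ht : t ∈ vis
  · obtain ⟨P, M, hT, hf, hP⟩ := h2.exists_path t ht N
    have ha : augment s t (L, n) = ((T.foldl backStep (t, N)).2, n + 1) := by
      unfold augment
      rw [h1, if_pos ht]
    rw [ha]
    have hL : L.Perm (P ++ (M ++ N)) := by
      rw [← List.append_assoc]
      exact h3.symm.trans (hT.append_right N)
    refine ⟨le_rfl, ?_, fun X hs hX => ?_, fun K k hK hk => ?_, .inl rfl⟩
    · have hp : ∀ {l l' : List (ℕ × ℕ)}, l.Perm l' → edgesTy.size l = edgesTy.size l' := by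
        intro l l' h
        simp only [Ty.size]
        rw [(h.map _).sum_eq]
      rw [hp hf, hp hL]
      simp only [Ty.size, List.map_append, List.map_map, List.sum_append]
      congr 3
      refine List.map_congr_left fun e _ => ?_
      simp only [Function.comp, Prod.swap]
      omega
    · have h5 := cutVal_sub_swap P X
      have h6 := hP fun u => (X u).toInt
      simp only [Multiset.map_coe, Multiset.sum_coe] at h6
      rw [h6, hs, hX] at h5
      simp at h5
      rw [cutVal_perm hL, cutVal_perm hf]
      simp only [cutVal_append]
      omega
    · have hK' : K ≤ (P : Multiset (ℕ × ℕ)).map Prod.swap + ((M ++ N : List _) : Multiset _) := by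
        refine hK.trans (le_of_eq ?_)
        rw [Multiset.map_coe, Multiset.coe_add]
        exact Multiset.coe_eq_coe.2 hf
      obtain ⟨K', h7, h8⟩ := hP.of_swap hk hK'
      refine ⟨K', h7.trans (le_of_eq ?_), by simpa using h8⟩
      rw [Multiset.coe_add]
      exact Multiset.coe_eq_coe.2 hL.symm
  · have ha : augment s t (L, n) = (L, n) := by
      unfold augment
      rw [h1, if_neg ht]
    rw [ha]
    refine ⟨Nat.le_succ n, rfl, fun X _ _ => rfl, fun K k hK hk => ⟨K, hK, by simpa using hk⟩,
      .inr ⟨fun u => decide (u ∈ vis), by simpa using h2.head_mem.1, by simpa using ht, ?_⟩⟩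
    show cutVal L _ = 0
    refine cutVal_eq_zero fun e he h5 => ?_
    simp only [decide_eq_true_eq] at h5 ⊢
    rcases List.mem_append.1 (h3.mem_iff.2 he) with he | he
    · exact h2.head_mem.2.1 e he
    · by_contra h6
      exact h4 e he ⟨h5, h6⟩

/-- The computed number is the value of a flow, and it is the capacity of a minimum cut. -/
theorem maxFlow_spec (L : List (ℕ × ℕ)) {s t : ℕ} (hst : s ≠ t) :
    (∃ K : Multiset (ℕ × ℕ), K ≤ L ∧ IsArcFlow K s t (maxFlow L s t)) ∧
    (∃ X : ℕ → Bool, X s = true ∧ X t = false ∧ cutVal L X = maxFlow L s t) ∧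
    (∀ X : ℕ → Bool, X s = true → X t = false → maxFlow L s t ≤ cutVal L X) := by
  have key : ∀ (l L : List (ℕ × ℕ)) (n : ℕ),
      ∃ L' n', l.foldl (fun st _ => augment s t st) (L, n) = (L', n') ∧
        (∀ X : ℕ → Bool, X s = true → X t = false → cutVal L X + n = cutVal L' X + n') ∧
        (∀ K : Multiset (ℕ × ℕ), ∀ k : ℤ, K ≤ L' → IsArcFlow K s t k →
          ∃ K' : Multiset (ℕ × ℕ), K' ≤ L ∧ IsArcFlow K' s t (k + (n' - n))) ∧
        (n' = n + l.length ∨ ∃ X : ℕ → Bool, X s = true ∧ X t = false ∧ cutVal L' X = 0) := by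
    intro l
    induction l with
    | nil =>
      intro L n
      exact ⟨L, n, rfl, fun _ _ _ => rfl, fun K k hK hk => ⟨K, hK, by simpa using hk⟩, .inl rfl⟩
    | cons a l ih =>
      intro L n
      obtain ⟨h1, -, h2, h3, h4⟩ := augment_spec (s := s) (t := t) L n
      obtain ⟨L', n', g1, g2, g3, g4⟩ := ih (augment s t (L, n)).1 (augment s t (L, n)).2
      refine ⟨L', n', by rw [List.foldl_cons, ← g1], fun X hs ht => (h2 X hs ht).trans (g2 X hs ht),
        fun K k hK hk => ?_, ?_⟩
      · obtain ⟨K', hK', hk'⟩ := g3 K k hK hk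
        obtain ⟨K'', hK'', hk''⟩ := h3 K' _ hK' hk'
        refine ⟨K'', hK'', ?_⟩
        convert hk'' using 1
        ring
      · rcases g4 with g4 | g4
        · rcases h4 with h4 | ⟨X, hs, ht, hX⟩
          · left; rw [List.length_cons]; omega
          · right
            refine ⟨X, hs, ht, ?_⟩
            have h5 := g2 X hs ht
            omega
        · exact .inr g4
  obtain ⟨L', n', h1, h2, h3, h4⟩ := key L L 0
  have hn : maxFlow L s t = n' := by unfold maxFlow; rw [h1]
  rw [hn]
  -- if each of the `L.length` rounds found a path, then all arcs that leave `s` are used up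
  have h5 : ∃ X : ℕ → Bool, X s = true ∧ X t = false ∧ cutVal L' X = 0 := by
    rcases h4 with h4 | h4
    · refine ⟨fun u => decide (u = s), by simp, by simpa using hst.symm, ?_⟩
      have h6 := h2 (fun u => decide (u = s)) (by simp) (by simpa using hst.symm)
      have h7 : cutVal L (fun u => decide (u = s)) ≤ L.length := List.countP_le_length
      omega
    · exact h4
  refine ⟨?_, ?_, fun X hs ht => by have := h2 X hs ht; omega⟩
  · obtain ⟨K, hK, hk⟩ := h3 0 0 (Multiset.zero_le _) fun φ => by simp
    exact ⟨K, hK, by simpa using hk⟩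
  · obtain ⟨X, hs, ht, hX⟩ := h5
    exact ⟨X, hs, ht, by have := h2 X hs ht; omega⟩

/-! ### Maximum flows in polynomial time -/

namespace PolyTime

variable {a : Ty}

/-- The data type of the states of the growth of a search tree. -/
abbrev treeTy : Ty := .prod (.list .nat) (.prod edgesTy edgesTy)

theorem growStep : PolyTime (.prod treeTy (.prod .nat .nat)) treeTy
    fun y : (List ℕ × (List (ℕ × ℕ) × List (ℕ × ℕ))) × (ℕ × ℕ) => _root_.growStep y.1 y.2 :=
  ite (b := treeTy) (and (mem PolyTime.id.snd.fst PolyTime.id.fst.fst)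
      (not (mem PolyTime.id.snd.snd PolyTime.id.fst.fst)))
    (pair (b := .list .nat) (cons (b := .nat) PolyTime.id.snd.snd PolyTime.id.fst.fst)
      (pair (b := edgesTy) (cons (b := .prod .nat .nat) PolyTime.id.snd PolyTime.id.fst.snd.fst)
        PolyTime.id.fst.snd.snd))
    (pair (b := .list .nat) PolyTime.id.fst.fst
      (pair (b := edgesTy) PolyTime.id.fst.snd.fst
        (cons (b := .prod .nat .nat) PolyTime.id.snd PolyTime.id.fst.snd.snd)))

theorem growRound : PolyTime treeTy treeTy _root_.growRound :=
  foldl_of_size_le (a := treeTy) (σ := treeTy) (e := .prod .nat .nat)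
    (step := fun _ st e => _root_.growStep st e) (init := fun st => (st.1, (st.2.1, [])))
    (l := fun st => st.2.2) (B := fun st => 2 * edgesTy.size st.2.2)
    (comp growStep (pair PolyTime.id.fst.snd PolyTime.id.snd))
    (pair PolyTime.id.fst (pair PolyTime.id.snd.fst nil)) PolyTime.id.snd.snd
    ((PolyBdd.const 2).mul (polyBdd_size PolyTime.id.snd.snd))
    fun x st e he => by
      have h1 := Ty.size_lt_of_mem (b := .prod .nat .nat) he
      unfold _root_.growStep
      split_ifs <;> simp only [Ty.size, List.map_cons, List.sum_cons] at h1 ⊢ <;> omega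

theorem grow {f : a.Val → List (ℕ × ℕ)} {g : a.Val → ℕ} (hf : PolyTime a edgesTy f)
    (hg : PolyTime a .nat g) : PolyTime a treeTy fun x => _root_.grow (f x) (g x) :=
  foldl_of_inv (a := a) (σ := treeTy) (e := .prod .nat .nat)
    (step := fun _ st _ => _root_.growRound st) (init := fun x => ([g x], ([], f x)))
    (l := f) (B := fun x => 3 * (edgesTy.size (f x) + Ty.nat.size (g x)) + 3)
    (fun x st => ∃ vis T N, st = (vis, (T, N)) ∧ IsSearchTree (g x) vis T ∧ (T ++ N).Perm (f x))
    (comp growRound PolyTime.id.fst.snd) (pair (cons hg nil) (pair nil hf)) hf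
    (((PolyBdd.const 3).mul (hf.polyBdd_size.add hg.polyBdd_size)).add (.const 3))
    (fun x => ⟨_, _, _, rfl, .root, .refl _⟩)
    (fun x st e _ h => by
      obtain ⟨vis, T, N, rfl, h1, h2⟩ := h
      obtain ⟨vis', T', N', h3, h4, h5, -⟩ := growRound_spec (N := N) h1
      exact ⟨vis', T', N', h3, h4, h5.trans h2⟩)
    (fun x st h => by
      obtain ⟨vis, T, N, rfl, h1, h2⟩ := h
      have h3 := h1.head_mem.2.2
      have h4 : edgesTy.size (T ++ N) = edgesTy.size (f x) := by
        simp only [Ty.size]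
        rw [(h2.map _).sum_eq]
      have h5 := Ty.size_append (b := .prod .nat .nat) T N
      simp only [Ty.size] at h3 h4 h5 ⊢
      omega)

theorem back {f : a.Val → ℕ} {g h : a.Val → List (ℕ × ℕ)} (hf : PolyTime a .nat f)
    (hg : PolyTime a edgesTy g) (hh : PolyTime a edgesTy h) :
    PolyTime a edgesTy fun x => ((g x).foldl backStep (f x, h x)).2 :=
  snd (b := .nat) <| foldl_of_size_le (a := a) (σ := .prod .nat edgesTy) (e := .prod .nat .nat)
    (step := fun _ st e => backStep st e) (init := fun x => (f x, h x)) (l := g)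
    (B := fun x => 2 * edgesTy.size (g x))
    (ite (b := .prod .nat edgesTy) (eq PolyTime.id.snd.snd PolyTime.id.fst.snd.fst)
      (pair (b := .nat) (c := edgesTy) PolyTime.id.snd.fst
        (cons (b := .prod .nat .nat) (pair (b := .nat) (c := .nat) PolyTime.id.snd.snd
          PolyTime.id.snd.fst) PolyTime.id.fst.snd.snd))
      (pair (b := .nat) (c := edgesTy) PolyTime.id.fst.snd.fst
        (cons (b := .prod .nat .nat) PolyTime.id.snd PolyTime.id.fst.snd.snd)))
    (pair hf hh) hg ((PolyBdd.const 2).mul hg.polyBdd_size)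
    fun x st e he => by
      have h1 := Ty.size_lt_of_mem (b := .prod .nat .nat) he
      unfold backStep
      split_ifs <;> simp only [Ty.size, List.map_cons, List.sum_cons] at h1 ⊢ <;> omega

theorem augment : PolyTime (.prod (.prod .nat .nat) (.prod edgesTy .nat)) (.prod edgesTy .nat)
    fun y : (ℕ × ℕ) × (List (ℕ × ℕ) × ℕ) => _root_.augment y.1.1 y.1.2 y.2 :=
  have hg : PolyTime (.prod (.prod .nat .nat) (.prod edgesTy .nat)) treeTy
      fun y : (ℕ × ℕ) × (List (ℕ × ℕ) × ℕ) => _root_.grow y.2.1 y.1.1 :=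
    grow PolyTime.id.snd.fst PolyTime.id.fst.fst
  ite (b := .prod edgesTy .nat) (mem PolyTime.id.fst.snd hg.fst)
    (pair (b := edgesTy) (c := .nat) (back PolyTime.id.fst.snd hg.snd.fst hg.snd.snd)
      (add PolyTime.id.snd.snd (const 1))) PolyTime.id.snd

theorem maxFlow {f : a.Val → List (ℕ × ℕ)} {g h : a.Val → ℕ} (hf : PolyTime a edgesTy f)
    (hg : PolyTime a .nat g) (hh : PolyTime a .nat h) :
    PolyTime a .nat fun x => _root_.maxFlow (f x) (g x) (h x) :=
  snd (b := edgesTy) (c := .nat) <| foldl_of_size_le (a := a) (σ := .prod edgesTy .nat)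
    (e := .prod .nat .nat)
    (step := fun x st _ => _root_.augment (g x) (h x) st) (init := fun x => (f x, (0 : ℕ)))
    (l := f) (B := fun _ => 2)
    (comp augment (pair (b := .prod .nat .nat) (c := .prod edgesTy .nat)
      (pair (b := .nat) (c := .nat) (comp hg PolyTime.id.fst.fst) (comp hh PolyTime.id.fst.fst))
      PolyTime.id.fst.snd))
    (pair hf (const 0)) hf (.const 2) fun x st e _ => by
      obtain ⟨L, n⟩ := st
      obtain ⟨h1, h2, -⟩ := augment_spec (s := g x) (t := h x) L n
      have h3 := Nat.size_le_size h1
      have h4 := Nat.size_add_le n 1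
      have h5 : Nat.size 1 = 1 := Nat.size_one
      simp only [Ty.size] at h2 ⊢
      omega

end PolyTime

/-! ### The greedy algorithm for submodular covering -/

theorem harmonic_mono : Monotone harmonic := monotone_nat_of_le_succ fun n => by
  rw [harmonic_succ]
  have : (0 : ℚ) ≤ ((n + 1 : ℕ) : ℚ)⁻¹ := by positivity
  linarith

theorem harmonic_sub_ge {m n : ℕ} (h : m ≤ n) :
    ((n : ℚ) - m) ≤ n * (harmonic n - harmonic m) := by
  induction n, h using Nat.le_induction with
  | base => simp
  | succ n hmn ih =>
    rw [harmonic_succ]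
    have h1 : (0 : ℚ) ≤ harmonic n - harmonic m := sub_nonneg.2 (harmonic_mono hmn)
    have h2 : ((n + 1 : ℕ) : ℚ) * ((n + 1 : ℕ) : ℚ)⁻¹ = 1 := mul_inv_cancel₀ (by positivity)
    push_cast at h2 ⊢
    linarith

/-- Lowering a gain from `g` to `g'` at price `θ` per unit is paid for by the decrease of
`c * harmonic`, if `θ` is at most the price of `g` units for `c`. -/
theorem price_mul_le {θ : ℚ} {c g g' : ℕ} (h : g' ≤ g) (hθ : θ * g ≤ c) :
    θ * g - θ * g' ≤ c * harmonic g - c * harmonic g' := by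
  have h1 := harmonic_sub_ge h
  have h2 : 0 ≤ harmonic g - harmonic g' := sub_nonneg.2 (harmonic_mono h)
  rcases Nat.eq_zero_or_pos g with rfl | hg
  · obtain rfl : g' = 0 := by omega
    simp
  · have hg' : (0 : ℚ) < g := by exact_mod_cast hg
    have hθ' : θ ≤ c / g := by rwa [le_div_iff₀ hg']
    have h3 : (0 : ℚ) ≤ (g : ℚ) - g' := by
      have : (g' : ℚ) ≤ g := by exact_mod_cast h
      linarith
    calc θ * g - θ * g' = θ * ((g : ℚ) - g') := by ring
      _ ≤ c / g * ((g : ℚ) - g') := by gcongr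
      _ ≤ c / g * (g * (harmonic g - harmonic g')) := by gcongr
      _ = c * harmonic g - c * harmonic g' := by field_simp

/-- The gain of adding `j` to `I`. -/
def gain (val : List ℕ → ℕ) (I : List ℕ) (j : ℕ) : ℕ := val (j :: I) - val I

/-- Replace the best candidate so far, given by its gain, cost and name, by `e`, given by its cost
and name, if `e` has a smaller cost per unit of gain. -/
def bestStep (val : List ℕ → ℕ) (I : List ℕ) (b : ℕ × (ℕ × ℕ)) (e : ℕ × ℕ) : ℕ × (ℕ × ℕ) :=
  if e.1 * b.1 < b.2.1 * gain val I e.2 then (gain val I e.2, e) else b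

/-- The candidate with the smallest cost per unit of gain. The start value has gain `0` and cost
`1`, so that every candidate with a positive gain beats it, and none with gain `0` does. -/
def best (val : List ℕ → ℕ) (costs : List ℕ) (I : List ℕ) : ℕ × (ℕ × ℕ) :=
  costs.zipIdx.foldl (bestStep val I) (0, (1, 0))

/-- Add the best candidate, unless no candidate has a positive gain. -/
def greedyStep (val : List ℕ → ℕ) (costs : List ℕ) (I : List ℕ) : List ℕ :=
  if (best val costs I).1 = 0 then I else (best val costs I).2.2 :: I

/-- The greedy algorithm: the candidates are the positions in the list of their costs. -/
def greedy (val : List ℕ → ℕ) (costs : List ℕ) : List ℕ :=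
  costs.foldl (fun I _ => greedyStep val costs I) []

/-- Either no candidate has a positive gain, or `best` is a candidate with a positive gain and the
smallest cost per unit of gain. -/
theorem best_spec (val : List ℕ → ℕ) (costs : List ℕ) (I : List ℕ) :
    ((best val costs I).1 = 0 ∧ ∀ j < costs.length, gain val I j = 0) ∨
    (∃ j < costs.length, best val costs I = (gain val I j, (costs.getD j 0, j)) ∧
      0 < gain val I j ∧ ∀ i < costs.length,
        costs.getD j 0 * gain val I i ≤ costs.getD i 0 * gain val I j) := by
  have key : ∀ (l : List (ℕ × ℕ)) (b : ℕ × (ℕ × ℕ)), (0 < b.1 ∨ b = (0, (1, 0))) →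
      ∃ b', l.foldl (bestStep val I) b = b' ∧
        (b' = b ∨ ∃ e ∈ l, b' = (gain val I e.2, e) ∧ 0 < gain val I e.2) ∧
        b'.2.1 * b.1 ≤ b.2.1 * b'.1 ∧ ∀ e ∈ l, b'.2.1 * gain val I e.2 ≤ e.1 * b'.1 := by
    intro l
    induction l with
    | nil => intro b _; exact ⟨b, rfl, .inl rfl, le_rfl, by simp⟩
    | cons e l ih =>
      intro b hb
      by_cases h : e.1 * b.1 < b.2.1 * gain val I e.2
      · have hg : 0 < gain val I e.2 := by
          by_contra hg
          rw [Nat.eq_zero_of_not_pos hg] at h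
          omega
        obtain ⟨b', h1, h2, h3, h4⟩ := ih (gain val I e.2, e) (.inl hg)
        refine ⟨b', by rw [List.foldl_cons, bestStep, if_pos h, h1], .inr ?_, ?_, ?_⟩
        · rcases h2 with rfl | ⟨e', he', h2⟩
          · exact ⟨e, List.mem_cons_self, rfl, hg⟩
          · exact ⟨e', List.mem_cons_of_mem _ he', h2⟩
        · refine Nat.le_of_mul_le_mul_right ?_ hg
          simp only at h3
          calc b'.2.1 * b.1 * gain val I e.2 = b.1 * (b'.2.1 * gain val I e.2) := by ring
            _ ≤ b.1 * (e.1 * b'.1) := by gcongr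
            _ = (e.1 * b.1) * b'.1 := by ring
            _ ≤ (b.2.1 * gain val I e.2) * b'.1 := by gcongr
            _ = b.2.1 * b'.1 * gain val I e.2 := by ring
        · intro e' he'
          rcases List.mem_cons.1 he' with rfl | he'
          · exact h3
          · exact h4 e' he'
      · obtain ⟨b', h1, h2, h3, h4⟩ := ih b hb
        refine ⟨b', by rw [List.foldl_cons, bestStep, if_neg h, h1], ?_, h3, ?_⟩
        · rcases h2 with h2 | ⟨e', he', h2⟩
          · exact .inl h2
          · exact .inr ⟨e', List.mem_cons_of_mem _ he', h2⟩
        · intro e' he'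
          rcases List.mem_cons.1 he' with rfl | he'
          · rcases hb with hb | rfl
            · refine Nat.le_of_mul_le_mul_right ?_ hb
              calc b'.2.1 * gain val I e'.2 * b.1 = gain val I e'.2 * (b'.2.1 * b.1) := by ring
                _ ≤ gain val I e'.2 * (b.2.1 * b'.1) := by gcongr
                _ = (b.2.1 * gain val I e'.2) * b'.1 := by ring
                _ ≤ (e'.1 * b.1) * b'.1 := Nat.mul_le_mul_right _ (not_lt.1 h)
                _ = e'.1 * b'.1 * b.1 := by ring
            · have : gain val I e'.2 = 0 := by simpa using h
              rw [this]
              simp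
          · exact h4 e' he'
  have hmem : ∀ j < costs.length, (costs.getD j 0, j) ∈ costs.zipIdx := fun j hj => by
    rw [List.mk_mem_zipIdx_iff_getElem?]
    simp [hj]
  obtain ⟨b, h1, h2, -, h4⟩ := key costs.zipIdx (0, (1, 0)) (.inr rfl)
  change best val costs I = b at h1
  rw [h1]
  rcases h2 with rfl | ⟨⟨c, j⟩, he, rfl, hg⟩
  · exact .inl ⟨rfl, fun j hj => by simpa using h4 _ (hmem j hj)⟩
  · rw [List.mk_mem_zipIdx_iff_getElem?, List.getElem?_eq_some_iff] at he
    obtain ⟨hj, rfl⟩ := he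
    have hc : costs.getD j 0 = costs[j] := by simp [hj]
    refine .inr ⟨j, hj, by rw [hc], hg, fun i hi => ?_⟩
    rw [hc]
    exact h4 _ (hmem i hi)

/-- Wolsey's analysis of the greedy algorithm for a monotone submodular function `f`. Prices per
unit of gain rise in the course of the algorithm. A payment is split into the successive increments
of the price, each paid for all gain that is still missing at that time. The gains of the elements
of the set `O` sum up to at least the missing gain, and `price_mul_le` bounds what each of them has
to contribute altogether. -/
theorem greedy_spec {val : List ℕ → ℕ} {f : Finset ℕ → ℕ} (hval : ∀ I, val I = f I.toFinset)
    (hmono : Monotone f) (hsub : ∀ A B, f (A ∪ B) + f (A ∩ B) ≤ f A + f B) (costs : List ℕ) :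
    (∀ j ∈ greedy val costs, j < costs.length) ∧
    f (greedy val costs).toFinset = f (Finset.range costs.length) ∧
    ∀ O ⊆ Finset.range costs.length, f O = f (Finset.range costs.length) →
      ((∑ j ∈ (greedy val costs).toFinset, costs.getD j 0 : ℕ) : ℚ) ≤
        ∑ j ∈ O, (costs.getD j 0 : ℚ) * harmonic (f {j} - f ∅) := by
  have hgain : ∀ I j, gain val I j = f (insert j I.toFinset) - f I.toFinset := fun I j => by
    rw [gain, hval, hval, List.toFinset_cons]
  -- the gains of single candidates bound the gain of a set
  have hunion : ∀ (I : List ℕ) (O : Finset ℕ),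
      f (I.toFinset ∪ O) ≤ f I.toFinset + ∑ j ∈ O, gain val I j := by
    intro I O
    induction O using Finset.induction_on with
    | empty => simp
    | insert j O hj ih =>
      rw [Finset.sum_insert hj, hgain]
      have h1 := hsub (insert j I.toFinset) (I.toFinset ∪ O)
      have h2 : insert j I.toFinset ∪ (I.toFinset ∪ O) = I.toFinset ∪ insert j O := by
        ext x; simp only [Finset.mem_union, Finset.mem_insert]; tauto
      rw [h2] at h1
      have h3 : f I.toFinset ≤ f (insert j I.toFinset ∩ (I.toFinset ∪ O)) :=
        hmono (Finset.subset_inter (Finset.subset_insert _ _) Finset.subset_union_left)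
      have h4 : f I.toFinset ≤ f (insert j I.toFinset) := hmono (Finset.subset_insert _ _)
      omega
  have hdim : ∀ I j b, gain val (b :: I) j ≤ gain val I j := by
    intro I j b
    rw [hgain, hgain, List.toFinset_cons]
    have h1 := hsub (insert b I.toFinset) (insert j I.toFinset)
    have h2 : insert b I.toFinset ∪ insert j I.toFinset = insert j (insert b I.toFinset) := by
      ext x; simp only [Finset.mem_union, Finset.mem_insert]; tauto
    rw [h2] at h1
    have h3 : f I.toFinset ≤ f (insert b I.toFinset ∩ insert j I.toFinset) :=
      hmono (Finset.subset_inter (Finset.subset_insert _ _) (Finset.subset_insert _ _))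
    omega
  have hfull : ∀ I : List ℕ, (∀ j ∈ I, j < costs.length) →
      (∀ j < costs.length, gain val I j = 0) → f I.toFinset = f (Finset.range costs.length) := by
    intro I hI h
    refine le_antisymm (hmono fun j hj => by simpa using hI j (by simpa using hj)) ?_
    refine (hmono Finset.subset_union_right).trans ((hunion I _).trans ?_)
    rw [Finset.sum_eq_zero fun j hj => h j (Finset.mem_range.1 hj)]
    simp
  -- `θ` is a lower bound for the current price per unit of gain; the bound is for the cost after
  -- the remaining rounds, and keeping `θ` arbitrary is what makes the induction work
  have key : ∀ (l I : List ℕ), (∀ j ∈ I, j < costs.length) →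
      (costs.length ≤ l.length + I.toFinset.card ∨ ∀ j < costs.length, gain val I j = 0) →
      ∃ I', l.foldl (fun I _ => greedyStep val costs I) I = I' ∧
        (∀ j ∈ I', j < costs.length) ∧ f I'.toFinset = f (Finset.range costs.length) ∧
        ∀ O ⊆ Finset.range costs.length, f O = f (Finset.range costs.length) →
          ∀ θ : ℚ, (∀ j < costs.length, θ * gain val I j ≤ (costs.getD j 0 : ℕ)) →
            ((I'.map (costs.getD · 0)).sum : ℚ) ≤ (I.map (costs.getD · 0)).sum +
              θ * (f (Finset.range costs.length) - f I.toFinset) +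
              ∑ j ∈ O, ((costs.getD j 0 : ℚ) * harmonic (gain val I j) - θ * gain val I j) := by
    intro l
    induction l with
    | nil =>
      intro I hI hl
      have h0 : ∀ j < costs.length, gain val I j = 0 := by
        rcases hl with hl | hl
        · intro j hj
          have h1 : I.toFinset ⊆ Finset.range costs.length := fun j hj => by
            simpa using hI j (by simpa using hj)
          have h2 := Finset.eq_of_subset_of_card_le h1 (by simpa using hl)
          rw [hgain, h2, Finset.insert_eq_of_mem (Finset.mem_range.2 hj)]
          omega
        · exact hl
      refine ⟨I, rfl, hI, hfull I hI h0, fun O hO _ θ _ => ?_⟩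
      rw [hfull I hI h0, Finset.sum_eq_zero fun j hj => by
        rw [h0 j (Finset.mem_range.1 (hO hj))]; simp]
      simp
    | cons a l ih =>
      intro I hI hl
      rcases best_spec val costs I with ⟨hb, h0⟩ | ⟨j, hj, hb, hg, hmin⟩
      · obtain ⟨I', h1, h2⟩ := ih I hI (.inr h0)
        exact ⟨I', by rw [List.foldl_cons, greedyStep, if_pos hb, h1], h2⟩
      · have hjI : j ∉ I.toFinset := fun hjI => by
          rw [hgain, Finset.insert_eq_of_mem hjI] at hg
          omega
        obtain ⟨I', h1, h2, h3, h4⟩ := ih (j :: I) (by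
          intro i hi
          rcases List.mem_cons.1 hi with rfl | hi
          · exact hj
          · exact hI i hi) (by
          rcases hl with hl | hl
          · left
            rw [List.toFinset_cons, Finset.card_insert_of_notMem hjI]
            rw [List.length_cons] at hl
            omega
          · right
            intro i hi
            have := hdim I i j
            have := hl i hi
            omega)
        refine ⟨I', ?_, h2, h3, fun O hO hfO θ hθ => ?_⟩
        · rw [List.foldl_cons, greedyStep, if_neg (by rw [hb]; exact hg.ne'), hb, h1]
        have hg' : (0 : ℚ) < gain val I j := by exact_mod_cast hg
        set θ' : ℚ := (costs.getD j 0 : ℕ) / gain val I j with hθ'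
        have hθ'j : θ' * gain val I j = (costs.getD j 0 : ℕ) := by
          rw [hθ']; field_simp
        have hle : θ ≤ θ' := by rw [hθ', le_div_iff₀ hg']; exact hθ j hj
        have hθ0 : 0 ≤ θ' := by rw [hθ']; positivity
        have hall : ∀ i < costs.length, θ' * gain val I i ≤ (costs.getD i 0 : ℕ) := by
          intro i hi
          rw [hθ', div_mul_eq_mul_div, div_le_iff₀ hg']
          exact_mod_cast hmin i hi
        have h5 := h4 O hO hfO θ' fun i hi => le_trans (by
          have : (gain val (j :: I) i : ℚ) ≤ gain val I i := by exact_mod_cast hdim I i j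
          gcongr) (hall i hi)
        refine h5.trans ?_
        have h6 : (f (j :: I).toFinset : ℚ) = f I.toFinset + gain val I j := by
          have h7 : f I.toFinset ≤ f (insert j I.toFinset) := hmono (Finset.subset_insert _ _)
          rw [hgain, List.toFinset_cons, Nat.cast_sub h7]
          ring
        have h8 : (f (Finset.range costs.length) : ℚ) ≤
            f I.toFinset + ∑ i ∈ O, (gain val I i : ℚ) := by
          have := (hmono Finset.subset_union_right).trans (hunion I O)
          rw [hfO] at this
          exact_mod_cast this
        have h9 : ∑ i ∈ O, ((costs.getD i 0 : ℚ) * harmonic (gain val (j :: I) i) -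
            θ' * gain val (j :: I) i) ≤
            ∑ i ∈ O, ((costs.getD i 0 : ℚ) * harmonic (gain val I i) - θ' * gain val I i) := by
          refine Finset.sum_le_sum fun i hi => ?_
          have := price_mul_le (hdim I i j) (hall i (Finset.mem_range.1 (hO hi)))
          linarith
        have h10 : ∑ i ∈ O, ((costs.getD i 0 : ℚ) * harmonic (gain val I i) -
              θ' * gain val I i) =
            ∑ i ∈ O, ((costs.getD i 0 : ℚ) * harmonic (gain val I i) - θ * gain val I i) -
              (θ' - θ) * ∑ i ∈ O, (gain val I i : ℚ) := by
          rw [Finset.mul_sum, ← Finset.sum_sub_distrib]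
          exact Finset.sum_congr rfl fun i _ => by ring
        have h11 := mul_le_mul_of_nonneg_left h8 (sub_nonneg.2 hle)
        rw [h6, List.map_cons, List.sum_cons, Nat.cast_add, ← hθ'j]
        linarith
  obtain ⟨I, h1, h2, h3, h4⟩ := key costs [] (by simp) (.inl (by simp))
  change greedy val costs = I at h1
  rw [h1]
  refine ⟨h2, h3, fun O hO hfO => ?_⟩
  have h5 := h4 O hO hfO 0 fun j _ => by simp
  have h6 : ∑ j ∈ I.toFinset, costs.getD j 0 ≤ (I.map (costs.getD · 0)).sum := by
    rw [Finset.sum_list_map_count]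
    refine Finset.sum_le_sum fun j hj => ?_
    rw [smul_eq_mul]
    exact Nat.le_mul_of_pos_left _ (List.count_pos_iff.2 (List.mem_toFinset.1 hj))
  refine le_trans (by exact_mod_cast h6) (h5.trans (le_of_eq ?_))
  simp only [List.map_nil, List.sum_nil, Nat.cast_zero, zero_mul, zero_add, sub_zero]
  exact Finset.sum_congr rfl fun j _ => by rw [hgain]; simp

/-! ### Demands with star-shaped augmentations -/

/-- A demand in the form in which the greedy algorithm sees it:
`((r, (s, t)), ((j, p), (L, items)))` asks for connectivity `r` from `s` to `t`. A candidate `i`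
adds the arcs that are listed with key `i` in `items` to the arcs in `L`, and the candidate `j`
adds `p` to the connectivity besides. -/
abbrev Demand : Type := (ℕ × (ℕ × ℕ)) × ((ℕ × ℕ) × (List (ℕ × ℕ) × List (ℕ × (ℕ × ℕ))))

/-- The data type of demands. -/
abbrev demandTy : Ty :=
  .prod (.prod .nat (.prod .nat .nat))
    (.prod (.prod .nat .nat) (.prod edgesTy (.list (.prod .nat (.prod .nat .nat)))))

/-- The arcs whose key is in `I`. -/
def selArcs (items : List (ℕ × (ℕ × ℕ))) (I : List ℕ) : List (ℕ × ℕ) :=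
  (items.filter fun p => p.1 ∈ I).map fun p => p.2

namespace Demand

/-- The connectivity when the candidates in `I` are chosen. -/
def conn (d : Demand) (I : List ℕ) : ℕ :=
  (if d.2.1.1 ∈ I then d.2.1.2 else 0) +
    maxFlow (d.2.2.1 ++ selArcs d.2.2.2 I) d.1.2.1 d.1.2.2

/-- The ends of the demand differ, and all arcs that can be added have the same tail. -/
def IsStar (d : Demand) : Prop :=
  d.1.2.1 ≠ d.1.2.2 ∧ ∃ α, ∀ p ∈ d.2.2.2, p.2.1 = α

end Demand

/-- How far the demands are satisfied. -/
def coverage (D : List Demand) (I : List ℕ) : ℕ :=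
  (D.map fun d => min d.1.1 (d.conn I)).sum

theorem selArcs_congr (items : List (ℕ × (ℕ × ℕ))) {I I' : List ℕ} (h : ∀ i, i ∈ I ↔ i ∈ I') :
    selArcs items I = selArcs items I' := by
  unfold selArcs
  simp only [h]

theorem cutVal_selArcs (items : List (ℕ × (ℕ × ℕ))) (I : List ℕ) (X : ℕ → Bool) :
    cutVal (selArcs items I) X =
      items.countP fun p => decide (p.1 ∈ I) && (X p.2.1 && !X p.2.2) := by
  unfold cutVal selArcs
  rw [List.countP_map, List.countP_filter]
  exact List.countP_congr fun p _ => by simp [and_comm]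

theorem countP_add_le {β : Type*} {l : List β} {p₁ p₂ p₃ p₄ : β → Bool}
    (h : ∀ e ∈ l, (p₁ e).toNat + (p₂ e).toNat ≤ (p₃ e).toNat + (p₄ e).toNat) :
    l.countP p₁ + l.countP p₂ ≤ l.countP p₃ + l.countP p₄ := by
  induction l with
  | nil => simp
  | cons e l ih =>
    have h1 := ih fun e' he' => h e' (List.mem_cons_of_mem _ he')
    have h2 := h e List.mem_cons_self
    have h3 : ∀ p : β → Bool, (e :: l).countP p = l.countP p + (p e).toNat := fun p => by
      rw [List.countP_cons]
      cases p e <;> rfl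
    rw [h3, h3, h3, h3]
    omega

/-- The connectivity is submodular as a function of the added arcs if all of these have the same
tail `α`. For minimum cuts `X` and `Y`, the smaller set of arcs is compared with `X ∩ Y` and the
larger with `X ∪ Y` if `α` is on the same side of both, and the other way round otherwise. -/
theorem maxFlow_submodular {L : List (ℕ × ℕ)} {items : List (ℕ × (ℕ × ℕ))} {s t α : ℕ}
    (hst : s ≠ t) (hα : ∀ p ∈ items, p.2.1 = α) {A B U N : List ℕ}
    (hU : ∀ i, i ∈ U ↔ i ∈ A ∨ i ∈ B) (hN : ∀ i, i ∈ N ↔ i ∈ A ∧ i ∈ B) :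
    maxFlow (L ++ selArcs items U) s t + maxFlow (L ++ selArcs items N) s t ≤
      maxFlow (L ++ selArcs items A) s t + maxFlow (L ++ selArcs items B) s t := by
  obtain ⟨-, ⟨X, hXs, hXt, hX⟩, -⟩ := maxFlow_spec (L ++ selArcs items A) hst
  obtain ⟨-, ⟨Y, hYs, hYt, hY⟩, -⟩ := maxFlow_spec (L ++ selArcs items B) hst
  have hU' := (maxFlow_spec (L ++ selArcs items U) hst).2.2
  have hN' := (maxFlow_spec (L ++ selArcs items N) hst).2.2
  have hL : cutVal L (fun u => X u || Y u) + cutVal L (fun u => X u && Y u) ≤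
      cutVal L X + cutVal L Y := countP_add_le fun e _ => by
    beta_reduce
    cases X e.1 <;> cases X e.2 <;> cases Y e.1 <;> cases Y e.2 <;> simp
  have ho₁ := hU' (fun u => X u || Y u) (by simp [hXs]) (by simp [hXt, hYt])
  have ho₂ := hN' (fun u => X u || Y u) (by simp [hXs]) (by simp [hXt, hYt])
  have ha₁ := hU' (fun u => X u && Y u) (by simp [hXs, hYs]) (by simp [hXt])
  have ha₂ := hN' (fun u => X u && Y u) (by simp [hXs, hYs]) (by simp [hXt])
  rw [cutVal_append] at hX hY ho₁ ho₂ ha₁ ha₂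
  by_cases h : X α = Y α
  · have : cutVal (selArcs items U) (fun u => X u || Y u) +
        cutVal (selArcs items N) (fun u => X u && Y u) ≤
        cutVal (selArcs items A) X + cutVal (selArcs items B) Y := by
      simp only [cutVal_selArcs]
      refine countP_add_le fun p hp => ?_
      rw [hα p hp, h]
      simp only [hU, hN]
      by_cases h1 : p.1 ∈ A <;> by_cases h2 : p.1 ∈ B <;> simp only [h1, h2] <;>
        cases Y α <;> cases X p.2.2 <;> cases Y p.2.2 <;> simp
    omega
  · have : cutVal (selArcs items U) (fun u => X u && Y u) +
        cutVal (selArcs items N) (fun u => X u || Y u) ≤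
        cutVal (selArcs items A) X + cutVal (selArcs items B) Y := by
      simp only [cutVal_selArcs]
      refine countP_add_le fun p hp => ?_
      rw [hα p hp]
      simp only [hU, hN]
      by_cases h1 : p.1 ∈ A <;> by_cases h2 : p.1 ∈ B <;> simp only [h1, h2] <;>
        revert h <;> cases X α <;> cases Y α <;> cases X p.2.2 <;> cases Y p.2.2 <;> simp
    omega

theorem maxFlow_selArcs_mono {L : List (ℕ × ℕ)} {items : List (ℕ × (ℕ × ℕ))} {s t : ℕ}
    (hst : s ≠ t) {I I' : List ℕ} (h : ∀ i ∈ I, i ∈ I') :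
    maxFlow (L ++ selArcs items I) s t ≤ maxFlow (L ++ selArcs items I') s t := by
  obtain ⟨-, ⟨X, hXs, hXt, hX⟩, -⟩ := maxFlow_spec (L ++ selArcs items I') hst
  have h1 := (maxFlow_spec (L ++ selArcs items I) hst).2.2 X hXs hXt
  rw [cutVal_append, cutVal_selArcs] at hX h1
  have h2 : items.countP (fun p => decide (p.1 ∈ I) && (X p.2.1 && !X p.2.2)) ≤
      items.countP fun p => decide (p.1 ∈ I') && (X p.2.1 && !X p.2.2) :=
    List.countP_mono_left fun p _ => by
      simp only [Bool.and_eq_true, decide_eq_true_eq]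
      exact fun hp => ⟨h _ hp.1, hp.2⟩
  omega

theorem maxFlow_selArcs_singleton_le {L : List (ℕ × ℕ)} {items : List (ℕ × (ℕ × ℕ))} {s t : ℕ}
    (hst : s ≠ t) (j : ℕ) : maxFlow (L ++ selArcs items [j]) s t ≤
      maxFlow (L ++ selArcs items []) s t + items.countP fun p => p.1 = j := by
  obtain ⟨-, ⟨X, hXs, hXt, hX⟩, -⟩ := maxFlow_spec (L ++ selArcs items []) hst
  have h1 := (maxFlow_spec (L ++ selArcs items [j]) hst).2.2 X hXs hXt
  rw [cutVal_append, cutVal_selArcs] at hX h1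
  have h2 : items.countP (fun p => decide (p.1 ∈ [j]) && (X p.2.1 && !X p.2.2)) ≤
      items.countP fun p => p.1 = j :=
    List.countP_mono_left fun p _ => by
      simp only [Bool.and_eq_true, decide_eq_true_eq, List.mem_singleton]
      exact fun hp => hp.1
  omega

namespace Demand

theorem conn_congr (d : Demand) {I I' : List ℕ} (h : ∀ i, i ∈ I ↔ i ∈ I') :
    d.conn I = d.conn I' := by
  unfold conn
  rw [selArcs_congr _ h]
  simp only [h]

theorem IsStar.conn_mono {d : Demand} (hd : d.IsStar) {I I' : List ℕ} (h : ∀ i ∈ I, i ∈ I') :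
    d.conn I ≤ d.conn I' := by
  refine Nat.add_le_add ?_ (maxFlow_selArcs_mono hd.1 h)
  have := h d.2.1.1
  split_ifs <;> first | omega | tauto

theorem IsStar.conn_submodular {d : Demand} (hd : d.IsStar) {A B U N : List ℕ}
    (hU : ∀ i, i ∈ U ↔ i ∈ A ∨ i ∈ B) (hN : ∀ i, i ∈ N ↔ i ∈ A ∧ i ∈ B) :
    d.conn U + d.conn N ≤ d.conn A + d.conn B := by
  obtain ⟨hst, α, hα⟩ := hd
  have h1 := maxFlow_submodular (L := d.2.2.1) hst hα hU hN
  have h2 := hU d.2.1.1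
  have h3 := hN d.2.1.1
  unfold conn
  by_cases hA : d.2.1.1 ∈ A <;> by_cases hB : d.2.1.1 ∈ B <;>
    simp only [hA, hB, or_true, or_false, and_true, and_false,
      iff_true, iff_false] at h2 h3 <;>
    simp only [hA, hB, h2, h3, if_true, if_false] <;> omega

end Demand

theorem coverage_congr (D : List Demand) {I I' : List ℕ} (h : ∀ i, i ∈ I ↔ i ∈ I') :
    coverage D I = coverage D I' := by
  unfold coverage
  simp only [Demand.conn_congr _ h]

theorem coverage_le (D : List Demand) (I : List ℕ) : coverage D I ≤ (D.map fun d => d.1.1).sum :=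
  List.sum_le_sum fun _ _ => min_le_left _ _

theorem coverage_eq_iff (D : List Demand) (I : List ℕ) :
    coverage D I = (D.map fun d => d.1.1).sum ↔ ∀ d ∈ D, d.1.1 ≤ d.conn I := by
  induction D with
  | nil => simp [coverage]
  | cons d D ih =>
    have h := coverage_le D I
    rw [List.forall_mem_cons, ← ih]
    unfold coverage at h ⊢
    simp only [List.map_cons, List.sum_cons]
    omega

theorem coverage_mono {D : List Demand} (hD : ∀ d ∈ D, d.IsStar) {I I' : List ℕ}
    (h : ∀ i ∈ I, i ∈ I') : coverage D I ≤ coverage D I' :=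
  List.sum_le_sum fun d hd => min_le_min_left _ ((hD d hd).conn_mono h)

theorem coverage_submodular {D : List Demand} (hD : ∀ d ∈ D, d.IsStar) {A B U N : List ℕ}
    (hU : ∀ i, i ∈ U ↔ i ∈ A ∨ i ∈ B) (hN : ∀ i, i ∈ N ↔ i ∈ A ∧ i ∈ B) :
    coverage D U + coverage D N ≤ coverage D A + coverage D B := by
  unfold coverage
  rw [← List.sum_map_add, ← List.sum_map_add]
  refine List.sum_le_sum fun d hd => ?_
  have h1 := (hD d hd).conn_submodular hU hN
  have h2 : d.conn A ≤ d.conn U := (hD d hd).conn_mono fun i hi => (hU i).2 (.inl hi)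
  have h3 : d.conn B ≤ d.conn U := (hD d hd).conn_mono fun i hi => (hU i).2 (.inr hi)
  have h4 : d.conn N ≤ d.conn A := (hD d hd).conn_mono fun i hi => ((hN i).1 hi).1
  have h5 : d.conn N ≤ d.conn B := (hD d hd).conn_mono fun i hi => ((hN i).1 hi).2
  omega

theorem coverage_singleton_le {D : List Demand} (hD : ∀ d ∈ D, d.IsStar) {j M : ℕ}
    (hM : ∀ d ∈ D, (d.2.2.2.countP fun p => p.1 = j) + (if d.2.1.1 = j then d.2.1.2 else 0) ≤ M) :
    coverage D [j] ≤ coverage D [] + D.length * M := by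
  induction D with
  | nil => simp [coverage]
  | cons d D ih =>
    have h1 := ih (fun d hd => hD d (List.mem_cons_of_mem _ hd))
      fun d hd => hM d (List.mem_cons_of_mem _ hd)
    have h2 := hM d List.mem_cons_self
    have h3 := maxFlow_selArcs_singleton_le (L := d.2.2.1) (items := d.2.2.2)
      (hD d List.mem_cons_self).1 j
    have h4 : d.conn [j] ≤ d.conn [] + M := by
      unfold Demand.conn
      simp only [List.mem_singleton, List.not_mem_nil, if_false]
      omega
    unfold coverage at h1 ⊢
    simp only [List.map_cons, List.sum_cons, List.length_cons, Nat.add_mul, Nat.one_mul]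
    omega

/-- The approximation ratio of the greedy algorithm, where the choice of a single candidate raises
the connectivity of each demand by at most `M`. -/
theorem greedy_coverage {D : List Demand} (hD : ∀ d ∈ D, d.IsStar) (costs : List ℕ) {M : ℕ}
    (hM : ∀ j, ∀ d ∈ D,
      (d.2.2.2.countP fun p => p.1 = j) + (if d.2.1.1 = j then d.2.1.2 else 0) ≤ M)
    {O : Finset ℕ} (hO : O ⊆ Finset.range costs.length)
    (hmet : ∀ d ∈ D, d.1.1 ≤ d.conn O.toList) :
    (∀ d ∈ D, d.1.1 ≤ d.conn (greedy (coverage D) costs)) ∧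
    ((∑ j ∈ (greedy (coverage D) costs).toFinset, costs.getD j 0 : ℕ) : ℚ) ≤
      harmonic (min (D.map fun d => d.1.1).sum (D.length * M)) *
        (∑ j ∈ O, costs.getD j 0 : ℕ) := by
  obtain ⟨-, h2, h3⟩ := greedy_spec (val := coverage D) (f := fun C => coverage D C.toList)
    (fun I => coverage_congr D fun i => by simp)
    (fun A B h => coverage_mono hD fun i hi => by simpa using h (by simpa using hi))
    (fun A B => coverage_submodular hD (by simp) (by simp)) costs
  have hOr := (coverage_eq_iff D O.toList).2 hmet
  have hr : coverage D (Finset.range costs.length).toList = (D.map fun d => d.1.1).sum :=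
    le_antisymm (coverage_le _ _) (hOr ▸ coverage_mono hD fun i hi => by
      simpa using hO (by simpa using hi))
  constructor
  · rw [← coverage_eq_iff, ← hr, ← h2]
    exact coverage_congr D fun i => by simp
  · refine (h3 O hO (hOr.trans hr.symm)).trans ?_
    rw [Nat.cast_sum, Finset.mul_sum]
    refine Finset.sum_le_sum fun j _ => ?_
    rw [mul_comm]
    gcongr
    refine harmonic_mono ?_
    have h4 : coverage D ({j} : Finset ℕ).toList = coverage D [j] := by simp
    have h5 : coverage D (∅ : Finset ℕ).toList = coverage D [] := by simp
    have h6 := coverage_singleton_le hD (hM j)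
    have h7 := coverage_le D [j]
    rw [h4, h5]
    omega

/-- Only candidates are chosen. -/
theorem greedy_lt {D : List Demand} (costs : List ℕ) :
    ∀ j ∈ greedy (coverage D) costs, j < costs.length := by
  have key : ∀ (l : List ℕ) (I : List ℕ), (∀ j ∈ I, j < costs.length) →
      ∀ j ∈ l.foldl (fun I _ => greedyStep (coverage D) costs I) I, j < costs.length := by
    intro l
    induction l with
    | nil => intro I hI; exact hI
    | cons a l ih =>
      intro I hI
      refine ih _ ?_
      change ∀ j ∈ greedyStep (coverage D) costs I, j < costs.length
      rcases best_spec (coverage D) costs I with ⟨hb, -⟩ | ⟨j, hj, hb, hg, -⟩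
      · rw [greedyStep, if_pos hb]
        exact hI
      · rw [greedyStep, if_neg (by rw [hb]; exact hg.ne'), hb]
        exact List.forall_mem_cons.2 ⟨hj, hI⟩
  exact key costs [] (by simp)

/-- Nothing is chosen if nothing is missing. -/
theorem greedy_eq_nil {D : List Demand} (costs : List ℕ) (h : ∀ d ∈ D, d.1.1 ≤ d.conn []) :
    greedy (coverage D) costs = [] := by
  have h1 : greedyStep (coverage D) costs [] = [] := by
    rcases best_spec (coverage D) costs [] with ⟨hb, -⟩ | ⟨j, -, -, hg, -⟩
    · rw [greedyStep, if_pos hb]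
    · have h2 := (coverage_eq_iff D []).2 h
      have h3 := coverage_le D [j]
      unfold gain at hg
      omega
  unfold greedy
  generalize costs = l at h1 ⊢
  have key : ∀ l' : List ℕ, l'.foldl (fun I _ => greedyStep (coverage D) l I) [] = [] := by
    intro l'
    induction l' with
    | nil => rfl
    | cons a l' ih => rw [List.foldl_cons, h1, ih]
  exact key l

/-! ### The greedy algorithm in polynomial time -/

namespace PolyTime

variable {a : Ty}

theorem selArcs {f : a.Val → List (ℕ × (ℕ × ℕ))} {g : a.Val → List ℕ}
    (hf : PolyTime a (.list (.prod .nat (.prod .nat .nat))) f) (hg : PolyTime a (.list .nat) g) :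
    PolyTime a edgesTy fun x => _root_.selArcs (f x) (g x) :=
  map (b := .prod .nat (.prod .nat .nat)) (c := .prod .nat .nat) (g := fun _ p => p.2)
    PolyTime.id.snd.snd
    (filter (b := .prod .nat (.prod .nat .nat)) (p := fun x p => p.1 ∈ g x)
      (mem PolyTime.id.snd.fst (comp hg PolyTime.id.fst)) hf)

theorem conn {f : a.Val → Demand} {g : a.Val → List ℕ} (hf : PolyTime a demandTy f)
    (hg : PolyTime a (.list .nat) g) : PolyTime a .nat fun x => (f x).conn (g x) :=
  add (ite (b := .nat) (mem (fst (b := .nat) (c := .nat) hf.snd.fst) hg)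
      (snd (b := .nat) (c := .nat) hf.snd.fst) (const 0))
    (maxFlow (append (b := .prod .nat .nat) hf.snd.snd.fst (selArcs hf.snd.snd.snd hg))
      hf.fst.snd.fst hf.fst.snd.snd)

theorem coverage {f : a.Val → List Demand} {g : a.Val → List ℕ}
    (hf : PolyTime a (.list demandTy) f) (hg : PolyTime a (.list .nat) g) :
    PolyTime a .nat fun x => _root_.coverage (f x) (g x) :=
  sum (map (b := demandTy) (c := .nat)
    (g := fun x (d : Demand) => Min.min d.1.1 (d.conn (g x)))
    (min PolyTime.id.snd.fst.fst (conn PolyTime.id.snd (comp hg PolyTime.id.fst))) hf)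

theorem best {f : a.Val → List Demand} {c g : a.Val → List ℕ}
    (hf : PolyTime a (.list demandTy) f) (hc : PolyTime a (.list .nat) c)
    (hg : PolyTime a (.list .nat) g) :
    PolyTime a (.prod .nat (.prod .nat .nat))
      fun x => _root_.best (_root_.coverage (f x)) (c x) (g x) := by
  have hgain : PolyTime (.prod a .nat) .nat
      fun y : a.Val × ℕ => gain (_root_.coverage (f y.1)) (g y.1) y.2 :=
    sub (coverage (comp hf PolyTime.id.fst) (cons (b := .nat) PolyTime.id.snd
      (comp hg PolyTime.id.fst))) (coverage (comp hf PolyTime.id.fst) (comp hg PolyTime.id.fst))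
  obtain ⟨T, hT⟩ := hgain.polyBdd_size
  have hg' : PolyTime (.prod (.prod a (.prod .nat (.prod .nat .nat))) (.prod .nat .nat)) .nat
      fun y : (a.Val × (ℕ × (ℕ × ℕ))) × (ℕ × ℕ) =>
        gain (_root_.coverage (f y.1.1)) (g y.1.1) y.2.2 :=
    comp hgain (pair (b := a) (c := .nat) PolyTime.id.fst.fst PolyTime.id.snd.snd)
  have hz := zipIdx hc
  refine foldl_of_size_le (a := a) (σ := .prod .nat (.prod .nat .nat)) (e := .prod .nat .nat)
    (step := fun x b e => bestStep (_root_.coverage (f x)) (g x) b e)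
    (init := fun _ => ((0 : ℕ), ((1 : ℕ), (0 : ℕ)))) (l := fun x => (c x).zipIdx)
    (B := fun x => T.eval (a.size x + edgesTy.size (c x).zipIdx) + edgesTy.size (c x).zipIdx)
    (ite (b := .prod .nat (.prod .nat .nat))
      (lt (mul PolyTime.id.snd.fst (fst (b := .nat) PolyTime.id.fst.snd))
        (mul PolyTime.id.fst.snd.snd.fst hg'))
      (pair (b := .nat) (c := .prod .nat .nat) hg' PolyTime.id.snd) PolyTime.id.fst.snd)
    (pair (const 0) (pair (const 1) (const 0))) hz
    (((PolyBdd.size.add hz.polyBdd_size).eval T).add hz.polyBdd_size) fun x b e he => ?_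
  have h1 := Ty.size_lt_of_mem (b := .prod .nat .nat) he
  have h2 := hT (x, e.2)
  have h3 : Ty.size (.prod a .nat) (x, e.2) ≤ a.size x + edgesTy.size (c x).zipIdx := by
    simp only [Ty.size] at h1 ⊢; omega
  have h4 := T.eval_mono_nat h3
  unfold bestStep
  split_ifs
  · simp only [Ty.size] at h1 h2 h3 h4 ⊢
    omega
  · omega

theorem greedy {f : a.Val → List Demand} {c : a.Val → List ℕ}
    (hf : PolyTime a (.list demandTy) f) (hc : PolyTime a (.list .nat) c) :
    PolyTime a (.list .nat) fun x => _root_.greedy (_root_.coverage (f x)) (c x) := by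
  have hb : PolyTime (.prod (.prod a (.list .nat)) .nat) (.prod .nat (.prod .nat .nat))
      fun y : (a.Val × List ℕ) × ℕ => _root_.best (_root_.coverage (f y.1.1)) (c y.1.1) y.1.2 :=
    best (comp hf PolyTime.id.fst.fst) (comp hc PolyTime.id.fst.fst) PolyTime.id.fst.snd
  refine foldl_of_size_le (a := a) (σ := .list .nat) (e := .nat)
    (step := fun x I _ => greedyStep (_root_.coverage (f x)) (c x) I)
    (init := fun _ => []) (B := fun x => (Ty.list .nat).size (c x) + 2)
    (ite (b := .list .nat) (eq hb.fst (const 0)) PolyTime.id.fst.snd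
      (cons (b := .nat) hb.snd.snd PolyTime.id.fst.snd))
    nil hc (hc.polyBdd_size.add (.const 2)) fun x I _ _ => ?_
  rcases best_spec (_root_.coverage (f x)) (c x) I with ⟨h, -⟩ | ⟨j, hj, h, hg, -⟩
  · rw [greedyStep, if_pos h]
    omega
  · rw [greedyStep, if_neg (by rw [h]; exact hg.ne'), h, Ty.size_cons (b := .nat)]
    have h1 := Ty.length_le_size (b := .nat) (c x)
    have h2 : j.size ≤ j := Nat.size_le.2 Nat.lt_two_pow_self
    simp only [Ty.size] at h1 h2 ⊢
    omega

end PolyTime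

/-! ### The split graph -/

/-- A flow does not exceed the capacity of a cut of the split graph, given by the set `A` of the
nodes whose entry, and the set `B` of the nodes whose exit is on the side of the source. No node
except possibly the source has more than `m` outgoing edges, so that node capacities may be cut off
at `m`. -/
theorem IsFlow.le_cut {V ι : Type} [Fintype V] [Fintype ι] [DecidableEq V] {tail head : ι → V}
    {q : V → ℕ∞} {s t : V} {f : ι → ℕ} {k : ℕ} (hf : IsFlow tail head q s t f k) (hst : s ≠ t)
    {m : ℕ} (hm : ∀ u ≠ s, (Finset.univ.filter fun i => tail i = u).card ≤ m) {cap : V → ℕ}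
    (hcap : ∀ u, (cap u : ℕ∞) = min (q u) m) {A B : V → Bool} (hs : B s = true)
    (ht : A t = false) :
    k ≤ ∑ i, (B (tail i) && !A (head i)).toNat + ∑ u, (A u && !B u).toNat * cap u := by
  obtain ⟨h1, h2, h3⟩ := hf
  have hB : ∑ i, f i * (B (tail i)).toNat =
      ∑ u, (∑ i with tail i = u, f i) * (B u).toNat := by
    rw [← Finset.sum_fiberwise Finset.univ tail]
    refine Finset.sum_congr rfl fun u _ => ?_
    rw [Finset.sum_mul]
    exact Finset.sum_congr rfl fun i hi => by rw [(Finset.mem_filter.1 hi).2]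
  have hA : ∑ i, f i * (A (head i)).toNat =
      ∑ u, (∑ i with head i = u, f i) * (A u).toNat := by
    rw [← Finset.sum_fiberwise Finset.univ head]
    refine Finset.sum_congr rfl fun u _ => ?_
    rw [Finset.sum_mul]
    exact Finset.sum_congr rfl fun i hi => by rw [(Finset.mem_filter.1 hi).2]
  have h4 : ∑ i, f i * (B (tail i)).toNat ≤
      ∑ i, f i * (A (head i)).toNat + ∑ i, (B (tail i) && !A (head i)).toNat := by
    rw [← Finset.sum_add_distrib]
    refine Finset.sum_le_sum fun i _ => ?_
    have := h1 i
    cases B (tail i) <;> cases A (head i) <;> simp [this]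
  have h5 : ∑ u, ((∑ i with head i = u, f i) * (A u).toNat + if u = s then k else 0) ≤
      ∑ u, ((∑ i with tail i = u, f i) * (B u).toNat + (A u && !B u).toNat * cap u) := by
    refine Finset.sum_le_sum fun u _ => ?_
    by_cases hus : u = s
    · subst hus
      rw [if_pos rfl, hs, h3]
      cases A u <;> simp
    rw [if_neg hus]
    by_cases hut : u = t
    · subst hut
      simp [ht]
    obtain ⟨h6, h7⟩ := h2 u hus hut
    have h8 : ∑ i with tail i = u, f i ≤ m := by
      refine le_trans ?_ (hm u hus)
      rw [Finset.card_eq_sum_ones]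
      exact Finset.sum_le_sum fun i _ => h1 i
    have h9 : ∑ i with head i = u, f i ≤ cap u := by
      have : ((∑ i with head i = u, f i : ℕ) : ℕ∞) ≤ cap u := by
        rw [hcap]
        exact le_min h7 (by rw [h6]; exact_mod_cast h8)
      exact_mod_cast this
    rw [← h6]
    cases A u <;> cases B u <;> simp [h9]
  rw [Finset.sum_add_distrib, Finset.sum_add_distrib, ← hA, ← hB] at h5
  simp only [Finset.sum_ite_eq', Finset.mem_univ, if_true] at h5
  omega

/-- The split graph: the node `u` is replaced by an arc of multiplicity `cap u` from its entry
`2 * code u` to its exit `2 * code u + 1`. -/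
noncomputable def splitGraph {V ι : Type} [Fintype V] [Fintype ι] (tail head : ι → V)
    (cap : V → ℕ) (code : V → ℕ) : List (ℕ × ℕ) :=
  (Finset.univ : Finset ι).toList.map (fun i => (2 * code (tail i) + 1, 2 * code (head i))) ++
    ((Finset.univ : Finset V).toList.map fun u =>
      List.replicate (cap u) (2 * code u, 2 * code u + 1)).flatten

theorem countP_eq_sum_toNat {β : Type*} (l : List β) (p : β → Bool) :
    l.countP p = (l.map fun e => (p e).toNat).sum := by
  induction l with
  | nil => rfl
  | cons e l ih =>
    rw [List.countP_cons, ih, List.map_cons, List.sum_cons]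
    cases p e <;> simp [add_comm]

theorem cutVal_splitGraph {V ι : Type} [Fintype V] [Fintype ι] (tail head : ι → V)
    (cap : V → ℕ) (code : V → ℕ) (X : ℕ → Bool) :
    cutVal (splitGraph tail head cap code) X =
      ∑ i, (X (2 * code (tail i) + 1) && !X (2 * code (head i))).toNat +
        ∑ u, (X (2 * code u) && !X (2 * code u + 1)).toNat * cap u := by
  unfold splitGraph
  rw [cutVal_append]
  congr 1
  · rw [cutVal, countP_eq_sum_toNat, List.map_map, ← Finset.sum_map_toList]
    rfl
  · rw [cutVal, List.countP_flatten, List.map_map, ← Finset.sum_map_toList]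
    congr 1
    refine List.map_congr_left fun u _ => ?_
    simp only [Function.comp, List.countP_replicate]
    cases X (2 * code u) <;> cases X (2 * code u + 1) <;> simp

/-- A flow in the split graph gives a flow in the graph. -/
theorem exists_isFlow {V ι : Type} [Fintype V] [Fintype ι] [DecidableEq V] {tail head : ι → V}
    {q : V → ℕ∞} {s t : V} (hst : s ≠ t) {cap : V → ℕ} (hcap : ∀ u, (cap u : ℕ∞) ≤ q u)
    {code : V → ℕ} (hcode : Function.Injective code) {k : ℕ} {K : Multiset (ℕ × ℕ)}
    (hK : K ≤ splitGraph tail head cap code)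
    (hflow : IsArcFlow K (2 * code s + 1) (2 * code t) k) :
    ∃ f, IsFlow tail head q s t f k := by
  classical
  set arc : ι → ℕ × ℕ := fun i => (2 * code (tail i) + 1, 2 * code (head i)) with harc
  set N : Multiset (ℕ × ℕ) := Multiset.ofList ((Finset.univ : Finset V).toList.map fun u =>
      List.replicate (cap u) (2 * code u, 2 * code u + 1)).flatten with hN
  have hL : ((splitGraph tail head cap code : List _) : Multiset _) =
      (Finset.univ : Finset ι).val.map arc + N := by
    rw [splitGraph, ← Multiset.coe_add, ← Multiset.map_coe, Finset.coe_toList]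
  rw [hL] at hK
  -- separate the edges from the arcs that stand for nodes
  obtain ⟨S, hS⟩ : ∃ S : Finset ι, S.val.map arc = K ∩ (Finset.univ : Finset ι).val.map arc := by
    have h1 : K ∩ (Finset.univ : Finset ι).val.map arc ≤
        (Finset.univ : Finset ι).val.map arc := Multiset.inter_le_right
    rw [← Finset.coe_toList, Multiset.map_coe] at h1
    obtain ⟨l, hl1, hl2⟩ : ∃ l : List (ℕ × ℕ), (l : Multiset _) =
        K ∩ (Finset.univ : Finset ι).val.map arc ∧
        l.Sublist ((Finset.univ : Finset ι).toList.map arc) := by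
      rw [← Finset.coe_toList, Multiset.map_coe]
      revert h1
      generalize K ∩ ((List.map arc Finset.univ.toList : List _) : Multiset _) = M
      induction M using Quotient.inductionOn with
      | h l =>
        intro h1
        obtain ⟨l', h2, h3⟩ := Multiset.coe_le.1 h1
        exact ⟨l', Multiset.coe_eq_coe.2 h2, h3⟩
    obtain ⟨l', hl', rfl⟩ := List.sublist_map_iff.1 hl2
    have hnd : l'.Nodup := hl'.nodup (Finset.nodup_toList _)
    refine ⟨⟨l', Multiset.coe_nodup.2 hnd⟩, ?_⟩
    rw [← hl1]
    rfl
  set K₂ := K - (Finset.univ : Finset ι).val.map arc with hK₂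
  have hK₂N : K₂ ≤ N := by rw [hK₂, tsub_le_iff_left]; exact hK
  have hsum : ∀ φ : ℕ → ℤ, ∑ i ∈ S, (φ (2 * code (tail i) + 1) - φ (2 * code (head i))) +
      (K₂.map fun e => φ e.1 - φ e.2).sum = k * (φ (2 * code s + 1) - φ (2 * code t)) := by
    intro φ
    rw [← hflow φ]
    conv_rhs => rw [← Multiset.sub_add_inter K ((Finset.univ : Finset ι).val.map arc)]
    rw [← hS, Multiset.map_add, Multiset.sum_add, Multiset.map_map, add_comm]
    rfl
  have hmem : ∀ e ∈ K₂, ∃ u, e = (2 * code u, 2 * code u + 1) := by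
    intro e he
    have := Multiset.mem_of_le hK₂N he
    rw [hN, Multiset.mem_coe, List.mem_flatten] at this
    obtain ⟨l, hl, hel⟩ := this
    obtain ⟨u, -, rfl⟩ := List.mem_map.1 hl
    exact ⟨u, List.eq_of_mem_replicate hel⟩
  have hcount : ∀ u, K₂.count (2 * code u, 2 * code u + 1) ≤ cap u := by
    intro u
    refine (Multiset.count_le_of_le _ hK₂N).trans (le_of_eq ?_)
    rw [hN, Multiset.coe_count, @List.count_flatten _ instBEqOfDecidableEq, List.map_map,
      Finset.sum_map_toList, Finset.sum_eq_single u]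
    · simp
    · intro v _ hv
      have : code v ≠ code u := fun h => hv (hcode h)
      simp [Function.comp, List.count_replicate, this]
    · simp
  have hcnt : ∀ u, (K₂.map fun e => if e = (2 * code u, 2 * code u + 1) then (1 : ℤ) else 0).sum =
      K₂.count (2 * code u, 2 * code u + 1) := by
    intro u
    generalize (2 * code u, 2 * code u + 1) = e'
    induction K₂ using Multiset.induction_on with
    | empty => simp
    | cons e M ih =>
      rw [Multiset.map_cons, Multiset.sum_cons, ih, Multiset.count_cons]
      by_cases h : e = e'
      · simp [h, add_comm]
      · simp [h, Ne.symm h]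
  -- test with the indicator functions of the entry and of the exit of a node
  have hin : ∀ u, ((S.filter fun i => head i = u).card : ℤ) =
      K₂.count (2 * code u, 2 * code u + 1) + k * (if t = u then 1 else 0) := by
    intro u
    have h1 := hsum fun x => if x = 2 * code u then 1 else 0
    have h2 : (K₂.map fun e => (if e.1 = 2 * code u then (1 : ℤ) else 0) -
        (if e.2 = 2 * code u then 1 else 0)).sum = K₂.count (2 * code u, 2 * code u + 1) := by
      rw [← hcnt]
      congr 1
      refine Multiset.map_congr rfl fun e he => ?_
      obtain ⟨v, rfl⟩ := hmem e he
      have h3 : ¬ 2 * code v + 1 = 2 * code u := by omega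
      simp [h3]
    rw [h2] at h1
    have h3 : ∀ i, ¬ 2 * code (tail i) + 1 = 2 * code u := fun i => by omega
    have h4 : ¬ 2 * code s + 1 = 2 * code u := by omega
    simp only [h3, h4, if_false, zero_sub, Finset.sum_neg_distrib, Nat.mul_left_cancel_iff
      (Nat.succ_pos 1), hcode.eq_iff, Finset.sum_boole] at h1
    linarith
  have hout : ∀ u, ((S.filter fun i => tail i = u).card : ℤ) =
      K₂.count (2 * code u, 2 * code u + 1) + k * (if s = u then 1 else 0) := by
    intro u
    have h1 := hsum fun x => if x = 2 * code u + 1 then 1 else 0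
    have h2 : (K₂.map fun e => (if e.1 = 2 * code u + 1 then (1 : ℤ) else 0) -
        (if e.2 = 2 * code u + 1 then 1 else 0)).sum =
        - K₂.count (2 * code u, 2 * code u + 1) := by
      rw [← hcnt, ← Multiset.sum_map_neg]
      congr 1
      refine Multiset.map_congr rfl fun e he => ?_
      obtain ⟨v, rfl⟩ := hmem e he
      have h3 : ¬ 2 * code v = 2 * code u + 1 := by omega
      simp [h3]
    rw [h2] at h1
    have h3 : ∀ i, ¬ 2 * code (head i) = 2 * code u + 1 := fun i => by omega
    have h4 : ¬ 2 * code t = 2 * code u + 1 := by omega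
    simp only [h3, h4, if_false, sub_zero, Nat.add_right_cancel_iff, Nat.mul_left_cancel_iff
      (Nat.succ_pos 1), hcode.eq_iff, Finset.sum_boole] at h1
    linarith
  have hfs : ∀ g : ι → V, ∀ u, (∑ i with g i = u, if i ∈ S then 1 else 0) =
      (S.filter fun i => g i = u).card := by
    intro g u
    rw [Finset.sum_boole, Finset.filter_filter, Nat.cast_id]
    congr 1
    ext i
    simp [and_comm]
  refine ⟨fun i => if i ∈ S then 1 else 0, fun i => by beta_reduce; split_ifs <;> omega, ?_, ?_⟩
  · intro u hus hut
    rw [hfs, hfs]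
    have h1 := hin u
    have h2 := hout u
    rw [if_neg (Ne.symm hut)] at h1
    rw [if_neg (Ne.symm hus)] at h2
    refine ⟨by omega, le_trans ?_ (hcap u)⟩
    have h3 := hcount u
    exact_mod_cast (by omega : (S.filter fun i => head i = u).card ≤ cap u)
  · rw [hfs, hfs]
    have h1 := hin s
    have h2 := hout s
    rw [if_neg (Ne.symm hst)] at h1
    rw [if_pos rfl] at h2
    omega

/-- The `q`-connectivity is the capacity of a minimum cut of the split graph. -/
theorem qConn_eq_min_cut {V ι : Type} [Fintype V] [Fintype ι] [DecidableEq V] (tail head : ι → V)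
    (q : V → ℕ∞) {s t : V} (hst : s ≠ t) {m : ℕ}
    (hm : ∀ u ≠ s, (Finset.univ.filter fun i => tail i = u).card ≤ m) {cap : V → ℕ}
    (hcap : ∀ u, (cap u : ℕ∞) = min (q u) m) {code : V → ℕ} (hcode : Function.Injective code) :
    (∃ X : ℕ → Bool, X (2 * code s + 1) = true ∧ X (2 * code t) = false ∧
      ∑ i, (X (2 * code (tail i) + 1) && !X (2 * code (head i))).toNat +
        ∑ u, (X (2 * code u) && !X (2 * code u + 1)).toNat * cap u = qConn tail head q s t) ∧
    ∀ X : ℕ → Bool, X (2 * code s + 1) = true → X (2 * code t) = false →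
      qConn tail head q s t ≤
        ∑ i, (X (2 * code (tail i) + 1) && !X (2 * code (head i))).toNat +
          ∑ u, (X (2 * code u) && !X (2 * code u + 1)).toNat * cap u := by
  obtain ⟨⟨K, hK, hflow⟩, ⟨X, hs, ht, hX⟩, h⟩ := maxFlow_spec
    (splitGraph tail head cap code) (s := 2 * code s + 1) (t := 2 * code t) (by omega)
  obtain ⟨f, hf⟩ := exists_isFlow hst (fun u => hcap u ▸ min_le_left _ _) hcode hK hflow
  have hq : qConn tail head q s t =
      maxFlow (splitGraph tail head cap code) (2 * code s + 1) (2 * code t) := by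
    refine IsGreatest.csSup_eq ⟨⟨f, hf⟩, ?_⟩
    rintro k ⟨g, hg⟩
    rw [← hX, cutVal_splitGraph]
    exact hg.le_cut hst hm hcap (A := fun u => X (2 * code u)) (B := fun u => X (2 * code u + 1))
      hs ht
  rw [hq]
  exact ⟨⟨X, hs, ht, by rw [← hX, cutVal_splitGraph]⟩,
    fun X hs ht => by rw [← cutVal_splitGraph]; exact h X hs ht⟩

/-! ### Star augmentation as a covering problem -/

/-- A polynomial-time function that finds good solutions gives an approximation ratio. -/
theorem MinProblem.AdmitsRatio.of_polyTime {P : MinProblem} {ρ : P.Inst → ℚ}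
    {f : P.inTy.Val → List ℕ} (hf : PolyTime P.inTy (.list .nat) f)
    (h : ∀ x, ∀ S₀, P.Feasible x S₀ → ∃ S, ListsSubset (f (P.encode x)) S ∧ P.Feasible x S ∧
      ∀ S', P.Feasible x S' → (P.cost x S : ℚ) ≤ ρ x * (P.cost x S' : ℚ)) :
    P.AdmitsRatio ρ := by
  obtain ⟨A, g, ⟨T, hT⟩, hA⟩ := hf
  refine ⟨A, T, fun x => ?_⟩
  obtain ⟨t, ht, hle⟩ := hA (P.encode x)
  exact ⟨_, t, ht, hle.trans (hT _), fun ⟨S₀, hS₀⟩ => h x S₀ hS₀⟩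

/-- The edges of a graph as arcs of the split graph. -/
def splitArcs (E : List (ℕ × ℕ)) : List (ℕ × ℕ) := E.map fun e => (2 * e.1 + 1, 2 * e.2)

/-- The arcs of the split graph that stand for nodes, where the capacities are given as by
`encodeCap`; multiplicities are cut off at the length of `M`. -/
def capArcs (M : List (ℕ × ℕ)) (caps : List ℕ) : List (ℕ × ℕ) :=
  (caps.zipIdx.map fun p =>
    ((List.range M.length).filter fun i => p.1 = 0 ∨ i + 1 < p.1).map
      fun _ => (2 * p.2, 2 * p.2 + 1)).flatten

theorem countP_ofFn {β : Type*} {n : ℕ} (g : Fin n → β) (p : β → Bool) :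
    (List.ofFn g).countP p = ∑ i, (p (g i)).toNat := by
  rw [countP_eq_sum_toNat, List.map_ofFn, List.sum_ofFn]
  rfl

theorem zipIdx_ofFn {β : Type*} {n : ℕ} (g : Fin n → β) :
    (List.ofFn g).zipIdx = List.ofFn fun i => (g i, (i : ℕ)) :=
  List.ext_getElem (by simp) fun i h1 h2 => by simp

theorem encodeEdges_eq_ofFn {n : ℕ} (l : List (Fin n × Fin n)) :
    encodeEdges l = List.ofFn fun i : Fin l.length =>
      (((l.get i).1 : ℕ), ((l.get i).2 : ℕ)) := by
  conv_lhs => rw [← List.ofFn_get l]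
  rw [encodeEdges, List.map_ofFn]
  rfl

theorem countP_range_lt (m k : ℕ) : (List.range m).countP (fun i => i < k) = min k m := by
  induction m with
  | zero => simp
  | succ m ih =>
    rw [List.range_succ, List.countP_append, ih, List.countP_singleton]
    by_cases h : m < k <;> simp [h] <;> omega

/-- The capacity `q`, cut off at `m`. -/
def truncCap (q : ℕ∞) (m : ℕ) : ℕ :=
  (List.range m).countP fun i => encodeCap q = 0 ∨ i + 1 < encodeCap q

theorem coe_truncCap (q : ℕ∞) (m : ℕ) : (truncCap q m : ℕ∞) = min q m := by
  cases q using ENat.recTopCoe with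
  | top =>
    have : encodeCap ⊤ = 0 := rfl
    simp [truncCap, this]
  | coe k =>
    have : encodeCap k = k + 1 := rfl
    simp only [truncCap, this, Nat.add_lt_add_iff_right, Nat.succ_ne_zero, false_or,
      countP_range_lt]
    rcases le_total k m with h | h
    · rw [min_eq_left h, min_eq_left (by exact_mod_cast h)]
    · rw [min_eq_right h, min_eq_right (by exact_mod_cast h)]

theorem countP_map_const {α β : Type*} (l : List α) (e : β) (p : β → Bool) :
    (l.map fun _ => e).countP p = (p e).toNat * l.length := by
  rw [List.countP_map]
  cases h : p e <;> simp [Function.comp_def, h]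

theorem countP_flatten_zipIdx {β : Type*} {n : ℕ} (g : Fin n → ℕ) (h : ℕ × ℕ → List β)
    (p : β → Bool) :
    ((List.ofFn g).zipIdx.map h).flatten.countP p = ∑ u, (h (g u, u)).countP p := by
  rw [zipIdx_ofFn, List.map_ofFn, List.countP_flatten, List.map_ofFn, List.sum_ofFn]
  rfl

theorem cutVal_capArcs {n : ℕ} (M : List (ℕ × ℕ)) (q : Fin n → ℕ∞) (X : ℕ → Bool) :
    cutVal (capArcs M (List.ofFn fun u => encodeCap (q u))) X =
      ∑ u : Fin n, (X (2 * u) && !X (2 * u + 1)).toNat * truncCap (q u) M.length := by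
  rw [capArcs, cutVal, countP_flatten_zipIdx]
  refine Finset.sum_congr rfl fun u _ => ?_
  rw [countP_map_const, ← List.countP_eq_length_filter]
  rfl

theorem cutVal_splitArcs {n : ℕ} (E : List (Fin n × Fin n)) (X : ℕ → Bool) :
    cutVal (splitArcs (encodeEdges E)) X = ∑ i : Fin E.length,
      (X (2 * (E.get i).1 + 1) && !X (2 * (E.get i).2)).toNat := by
  rw [encodeEdges_eq_ofFn, splitArcs, List.map_ofFn, cutVal, countP_ofFn]
  rfl

/-- The demands of an instance of `a`-Based SNA; the edge `p.1` with position `p.2` in `F` belongs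
to the candidate `key p`. -/
def snaDemands (key : (ℕ × ℕ) × ℕ → ℕ) (x : snaTy.Val) : List Demand :=
  x.2.2.2.1.map fun d => ((d.2, (2 * d.1.1 + 1, 2 * d.1.2)), ((0, 0),
    (splitArcs x.2.1 ++ capArcs (x.2.1 ++ x.2.2.1) x.1,
      x.2.2.1.zipIdx.map fun p => (key p, (2 * p.1.1 + 1, 2 * p.1.2)))))

/-- The positions of the edges in `F` that belong to the candidates chosen by the greedy
algorithm. -/
def snaGreedy (key : (ℕ × ℕ) × ℕ → ℕ) (y : snaTy.Val × List ℕ) : List ℕ :=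
  (y.1.2.2.1.zipIdx.filter fun p => key p ∈ greedy (coverage (snaDemands key y.1)) y.2).map
    fun p => p.2

/-! ### Star augmentation in polynomial time -/

namespace PolyTime

variable {a : Ty}

theorem splitArcs {f : a.Val → List (ℕ × ℕ)} (hf : PolyTime a edgesTy f) :
    PolyTime a edgesTy fun x => _root_.splitArcs (f x) :=
  map (b := .prod .nat .nat) (c := .prod .nat .nat) (g := fun _ e => (2 * e.1 + 1, 2 * e.2))
    (pair (b := .nat) (c := .nat) (add (mul (const 2) PolyTime.id.snd.fst) (const 1))
      (mul (const 2) PolyTime.id.snd.snd)) hf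

theorem capArcs {f : a.Val → List (ℕ × ℕ)} {g : a.Val → List ℕ} (hf : PolyTime a edgesTy f)
    (hg : PolyTime a (.list .nat) g) :
    PolyTime a edgesTy fun x => _root_.capArcs (f x) (g x) :=
  flatten (b := .prod .nat .nat) <| map (b := .prod .nat .nat) (c := edgesTy)
    (g := fun x p => ((List.range (f x).length).filter fun i => p.1 = 0 ∨ i + 1 < p.1).map
      fun _ => (2 * p.2, 2 * p.2 + 1))
    (map (a := .prod a (.prod .nat .nat)) (b := .nat) (c := .prod .nat .nat)
      (g := fun y _ => (2 * y.2.2, 2 * y.2.2 + 1))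
      (pair (b := .nat) (c := .nat) (mul (const 2) PolyTime.id.fst.snd.snd)
        (add (mul (const 2) PolyTime.id.fst.snd.snd) (const 1)))
      (filter (a := .prod a (.prod .nat .nat)) (b := .nat)
        (p := fun (y : a.Val × (ℕ × ℕ)) i => y.2.1 = 0 ∨ i + 1 < y.2.1)
        (or (eq PolyTime.id.fst.snd.fst (const 0))
          (lt (add PolyTime.id.snd (const 1)) PolyTime.id.fst.snd.fst))
        (range_length (b := .prod .nat .nat) (comp hf PolyTime.id.fst))))
    (zipIdx hg)

theorem snaDemands {key : (ℕ × ℕ) × ℕ → ℕ}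
    (hkey : PolyTime (.prod (.prod .nat .nat) .nat) .nat key) :
    PolyTime snaTy (.list demandTy) (_root_.snaDemands key) := by
  have hE : PolyTime snaTy edgesTy fun x : snaTy.Val => x.2.1 := PolyTime.id.snd.fst
  have hF : PolyTime snaTy edgesTy fun x : snaTy.Val => x.2.2.1 := PolyTime.id.snd.snd.fst
  have hbase : PolyTime snaTy edgesTy fun x : snaTy.Val =>
      _root_.splitArcs x.2.1 ++ _root_.capArcs (x.2.1 ++ x.2.2.1) x.1 :=
    append (splitArcs hE) (capArcs (append (b := .prod .nat .nat) hE hF) PolyTime.id.fst)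
  have hitems : PolyTime snaTy (.list (.prod .nat (.prod .nat .nat))) fun x : snaTy.Val =>
      x.2.2.1.zipIdx.map fun p => (key p, (2 * p.1.1 + 1, 2 * p.1.2)) :=
    map (b := .prod (.prod .nat .nat) .nat) (c := .prod .nat (.prod .nat .nat))
      (g := fun _ p => (key p, (2 * p.1.1 + 1, 2 * p.1.2)))
      (pair (b := .nat) (c := .prod .nat .nat) (comp hkey PolyTime.id.snd)
        (pair (b := .nat) (c := .nat) (add (mul (const 2) PolyTime.id.snd.fst.fst) (const 1))
          (mul (const 2) PolyTime.id.snd.fst.snd))) (zipIdx (b := .prod .nat .nat) hF)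
  exact map (a := snaTy) (b := .prod (.prod .nat .nat) .nat) (c := demandTy)
    (g := fun x d => ((d.2, (2 * d.1.1 + 1, 2 * d.1.2)), ((0, 0),
      (_root_.splitArcs x.2.1 ++ _root_.capArcs (x.2.1 ++ x.2.2.1) x.1,
        x.2.2.1.zipIdx.map fun p => (key p, (2 * p.1.1 + 1, 2 * p.1.2))))))
    (pair (b := .prod .nat (.prod .nat .nat))
      (c := .prod (.prod .nat .nat) (.prod edgesTy (.list (.prod .nat (.prod .nat .nat)))))
      (pair (b := .nat) (c := .prod .nat .nat) PolyTime.id.snd.snd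
        (pair (b := .nat) (c := .nat) (add (mul (const 2) PolyTime.id.snd.fst.fst) (const 1))
          (mul (const 2) PolyTime.id.snd.fst.snd)))
      (pair (b := .prod .nat .nat) (c := .prod edgesTy (.list (.prod .nat (.prod .nat .nat))))
        (pair (b := .nat) (c := .nat) (const 0) (const 0))
        (pair (comp hbase PolyTime.id.fst) (comp hitems PolyTime.id.fst))))
    PolyTime.id.snd.snd.snd.fst

theorem snaGreedy {key : (ℕ × ℕ) × ℕ → ℕ}
    (hkey : PolyTime (.prod (.prod .nat .nat) .nat) .nat key) :
    PolyTime (.prod snaTy (.list .nat)) (.list .nat) (_root_.snaGreedy key) := by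
  have hg : PolyTime (.prod snaTy (.list .nat)) (.list .nat) fun y : snaTy.Val × List ℕ =>
      _root_.greedy (_root_.coverage (_root_.snaDemands key y.1)) y.2 :=
    greedy (comp (snaDemands hkey) PolyTime.id.fst) PolyTime.id.snd
  exact map (a := .prod snaTy (.list .nat)) (b := .prod (.prod .nat .nat) .nat) (c := .nat)
    (g := fun _ p => p.2) PolyTime.id.snd.snd
    (filter (a := .prod snaTy (.list .nat)) (b := .prod (.prod .nat .nat) .nat)
      (p := fun (y : snaTy.Val × List ℕ) p => key p ∈ _root_.greedy
        (_root_.coverage (_root_.snaDemands key y.1)) y.2)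
      (mem (comp hkey PolyTime.id.snd) (comp hg PolyTime.id.fst))
      (zipIdx (b := .prod .nat .nat) PolyTime.id.fst.snd.snd.fst))

end PolyTime

/-! ### Approximation of star augmentation -/

namespace ABasedSNA

variable (x : ABasedSNA) (key : (ℕ × ℕ) × ℕ → ℕ)

/-- The candidate to which an edge in `F` belongs. -/
def keyOf (i : Fin x.F.length) : ℕ := key ((((x.F.get i).1 : ℕ), ((x.F.get i).2 : ℕ)), (i : ℕ))

/-- The demand that the greedy algorithm makes of a demand edge. -/
def toDemand (d : (Fin x.n × Fin x.n) × ℕ) : Demand :=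
  ((d.2, (2 * d.1.1 + 1, 2 * d.1.2)), ((0, 0),
    (splitArcs (encodeEdges x.E) ++ capArcs (encodeEdges x.E ++ encodeEdges x.F)
        (List.ofFn fun u => encodeCap (x.q u)),
      List.ofFn fun i => (x.keyOf key i, (2 * (x.F.get i).1 + 1, 2 * (x.F.get i).2)))))

theorem snaDemands_encode : snaDemands key x.encode = x.D.map (x.toDemand key) := by
  unfold snaDemands encode
  rw [List.map_map]
  refine List.map_congr_left fun d _ => ?_
  simp only [Function.comp, toDemand]
  congr 3
  rw [encodeEdges_eq_ofFn x.F, zipIdx_ofFn, List.map_ofFn]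
  rfl

theorem isStar_toDemand (d : (Fin x.n × Fin x.n) × ℕ) : (x.toDemand key d).IsStar := by
  refine ⟨?_, 2 * x.a + 1, fun p hp => ?_⟩
  · simp only [toDemand]
    omega
  · simp only [toDemand, List.mem_ofFn] at hp
    obtain ⟨i, rfl⟩ := hp
    simp only
    rw [(x.star _ (List.get_mem x.F i)).1]

/-- The part of the capacity of a cut of the split graph that is due to `G`. -/
def baseCut (X : ℕ → Bool) : ℕ :=
  ∑ i : Fin x.E.length, (X (2 * (x.E.get i).1 + 1) && !X (2 * (x.E.get i).2)).toNat +
    ∑ u : Fin x.n, (X (2 * u) && !X (2 * u + 1)).toNat *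
      truncCap (x.q u) (x.E.length + x.F.length)

theorem cutVal_toDemand (d : (Fin x.n × Fin x.n) × ℕ) (J : List ℕ) (X : ℕ → Bool) :
    cutVal ((x.toDemand key d).2.2.1 ++ selArcs (x.toDemand key d).2.2.2 J) X =
      x.baseCut X + ∑ i, if x.keyOf key i ∈ J then
        (X (2 * (x.F.get i).1 + 1) && !X (2 * (x.F.get i).2)).toNat else 0 := by
  rw [cutVal_append, cutVal_selArcs]
  simp only [toDemand]
  rw [cutVal_append, cutVal_splitArcs, cutVal_capArcs, countP_ofFn, baseCut]
  congr 1
  · simp [encodeEdges]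
  · refine Finset.sum_congr rfl fun i _ => ?_
    by_cases h : x.keyOf key i ∈ J <;> simp [h]

/-- The connectivity in `G + I` is the capacity of a minimum cut of the split graph. -/
theorem conn_eq_min_cut (I : Finset (Fin x.F.length)) {s t : Fin x.n} (hst : s ≠ t) :
    (∃ X : ℕ → Bool, X (2 * s + 1) = true ∧ X (2 * t) = false ∧
      x.baseCut X + ∑ i ∈ I, (X (2 * (x.F.get i).1 + 1) && !X (2 * (x.F.get i).2)).toNat =
        x.conn I s t) ∧
    ∀ X : ℕ → Bool, X (2 * s + 1) = true → X (2 * t) = false → x.conn I s t ≤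
      x.baseCut X + ∑ i ∈ I, (X (2 * (x.F.get i).1 + 1) && !X (2 * (x.F.get i).2)).toNat := by
  have h := qConn_eq_min_cut (ι := Fin x.E.length ⊕ {i // i ∈ I})
    (Sum.elim (fun i => (x.E.get i).1) (fun i => (x.F.get i.1).1))
    (Sum.elim (fun i => (x.E.get i).2) (fun i => (x.F.get i.1).2)) x.q hst
    (m := x.E.length + x.F.length)
    (fun u _ => (Finset.card_le_univ _).trans (by
      rw [Fintype.card_sum, Fintype.card_fin, Fintype.card_coe]
      have := Finset.card_le_univ I
      rw [Fintype.card_fin] at this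
      omega))
    (cap := fun u => truncCap (x.q u) (x.E.length + x.F.length)) (fun u => coe_truncCap _ _)
    (code := Fin.val) Fin.val_injective
  have hsum : ∀ X : ℕ → Bool, ∑ i : Fin x.E.length ⊕ {i // i ∈ I},
      (X (2 * (Sum.elim (fun i => (x.E.get i).1) (fun i => (x.F.get i.1).1) i : Fin x.n) + 1) &&
        !X (2 * (Sum.elim (fun i => (x.E.get i).2)
          (fun i => (x.F.get i.1).2) i : Fin x.n))).toNat +
      ∑ u : Fin x.n, (X (2 * u) && !X (2 * u + 1)).toNat *
        truncCap (x.q u) (x.E.length + x.F.length) =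
      x.baseCut X + ∑ i ∈ I, (X (2 * (x.F.get i).1 + 1) && !X (2 * (x.F.get i).2)).toNat := by
    intro X
    rw [Fintype.sum_sum_type, ← Finset.sum_coe_sort I, baseCut]
    simp only [Sum.elim_inl, Sum.elim_inr]
    omega
  simp only [hsum] at h
  exact h

theorem conn_le_toDemand {I : Finset (Fin x.F.length)} {J : List ℕ}
    (hIJ : ∀ i ∈ I, x.keyOf key i ∈ J) {d : (Fin x.n × Fin x.n) × ℕ} (hd : d.1.1 ≠ d.1.2) :
    x.conn I d.1.1 d.1.2 ≤ (x.toDemand key d).conn J := by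
  obtain ⟨-, ⟨X, hs, ht, hX⟩, -⟩ := maxFlow_spec
    ((x.toDemand key d).2.2.1 ++ selArcs (x.toDemand key d).2.2.2 J) (x.isStar_toDemand key d).1
  have h := (x.conn_eq_min_cut I hd).2 X hs ht
  rw [cutVal_toDemand] at hX
  unfold Demand.conn
  rw [← hX, ← Finset.sum_filter]
  have : ∑ i ∈ I, (X (2 * (x.F.get i).1 + 1) && !X (2 * (x.F.get i).2)).toNat ≤
      ∑ i with x.keyOf key i ∈ J, (X (2 * (x.F.get i).1 + 1) && !X (2 * (x.F.get i).2)).toNat :=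
    Finset.sum_le_sum_of_subset fun i hi => by simpa using hIJ i hi
  omega

theorem toDemand_le_conn {I : Finset (Fin x.F.length)} {J : List ℕ}
    (hJI : ∀ i, x.keyOf key i ∈ J → i ∈ I) {d : (Fin x.n × Fin x.n) × ℕ} (hd : d.1.1 ≠ d.1.2) :
    (x.toDemand key d).conn J ≤ x.conn I d.1.1 d.1.2 := by
  obtain ⟨X, hs, ht, hX⟩ := (x.conn_eq_min_cut I hd).1
  have h := (maxFlow_spec ((x.toDemand key d).2.2.1 ++ selArcs (x.toDemand key d).2.2.2 J)
    (x.isStar_toDemand key d).1).2.2 X hs ht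
  rw [cutVal_toDemand, ← Finset.sum_filter] at h
  unfold Demand.conn
  have h1 : ∑ i with x.keyOf key i ∈ J,
      (X (2 * (x.F.get i).1 + 1) && !X (2 * (x.F.get i).2)).toNat ≤
      ∑ i ∈ I, (X (2 * (x.F.get i).1 + 1) && !X (2 * (x.F.get i).2)).toNat :=
    Finset.sum_le_sum_of_subset fun i hi => hJI i (by simpa using hi)
  have h2 : (if (x.toDemand key d).2.1.1 ∈ J then (x.toDemand key d).2.1.2 else 0) = 0 := by
    split_ifs <;> rfl
  omega

/-- The edges in `F` that belong to the candidates in `J`. -/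
def edgesOf (J : List ℕ) : Finset (Fin x.F.length) := Finset.univ.filter fun i => x.keyOf key i ∈ J

theorem listsSubset_snaGreedy (costs : List ℕ) :
    ListsSubset (snaGreedy key (x.encode, costs))
      (x.edgesOf key (greedy (coverage (x.D.map (x.toDemand key))) costs)) := by
  intro i
  have h1 : x.encode.2.2.1.zipIdx = List.ofFn fun i : Fin x.F.length =>
      ((((x.F.get i).1 : ℕ), ((x.F.get i).2 : ℕ)), (i : ℕ)) := by
    show (encodeEdges x.F).zipIdx = _
    rw [encodeEdges_eq_ofFn, zipIdx_ofFn]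
  simp only [snaGreedy, snaDemands_encode, h1, List.mem_map, List.mem_filter, List.mem_ofFn,
    decide_eq_true_eq, edgesOf, Finset.mem_filter, Finset.mem_univ, true_and]
  constructor
  · rintro ⟨p, ⟨⟨j, rfl⟩, hp⟩, rfl⟩
    exact ⟨j.2, hp⟩
  · rintro ⟨hi, h⟩
    exact ⟨_, ⟨⟨⟨i, hi⟩, rfl⟩, h⟩, rfl⟩

/-- The greedy algorithm on the candidates, in terms of the instance. -/
theorem greedy_toDemand (costs : List ℕ) {M : ℕ}
    (hM : ∀ j, (∑ i, (decide (x.keyOf key i = j)).toNat) ≤ M) {I : Finset (Fin x.F.length)}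
    (hI : x.Feasible I) {O : Finset ℕ} (hO : O ⊆ Finset.range costs.length)
    (hkeyO : ∀ i ∈ I, x.keyOf key i ∈ O) :
    x.Feasible (x.edgesOf key (greedy (coverage (x.D.map (x.toDemand key))) costs)) ∧
    ((∑ j ∈ (greedy (coverage (x.D.map (x.toDemand key))) costs).toFinset,
      costs.getD j 0 : ℕ) : ℚ) ≤ harmonic (min x.totalReq (x.numDemands * M)) *
        (∑ j ∈ O, costs.getD j 0 : ℕ) := by
  have hstar : ∀ d ∈ x.D.map (x.toDemand key), d.IsStar := by
    intro d hd
    obtain ⟨d, -, rfl⟩ := List.mem_map.1 hd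
    exact x.isStar_toDemand key d
  have h := greedy_coverage hstar costs (M := M) (by
    intro j d hd
    obtain ⟨d, -, rfl⟩ := List.mem_map.1 hd
    have h1 : (x.toDemand key d).2.2.2.countP (fun p => p.1 = j) =
        ∑ i, (decide (x.keyOf key i = j)).toNat := countP_ofFn _ _
    have h2 : (if (x.toDemand key d).2.1.1 = j then (x.toDemand key d).2.1.2 else 0) = 0 := by
      split_ifs <;> rfl
    rw [h1, h2]
    exact hM j) hO (by
    intro d hd
    obtain ⟨d, hd', rfl⟩ := List.mem_map.1 hd
    exact (hI d hd').trans (x.conn_le_toDemand key (fun i hi => by simpa using hkeyO i hi)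
      (x.D_ne d hd')))
  refine ⟨fun d hd => (h.1 _ (List.mem_map_of_mem hd)).trans
    (x.toDemand_le_conn key (fun i hi => by simpa [edgesOf] using hi) (x.D_ne d hd)), ?_⟩
  have h1 : ((x.D.map (x.toDemand key)).map fun d => d.1.1).sum = x.totalReq := by
    rw [List.map_map]; rfl
  have h2 := h.2
  rw [h1, List.length_map] at h2
  exact h2

end ABasedSNA

theorem sum_getD_ofFn {n : ℕ} (c : Fin n → ℕ) (I : Finset (Fin n)) :
    ∑ i ∈ I, c i = ∑ j ∈ I.map Fin.valEmbedding, (List.ofFn c).getD j 0 := by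
  rw [Finset.sum_map]
  exact Finset.sum_congr rfl fun i _ => by simp

theorem map_valEmbedding_subset {n : ℕ} (c : Fin n → ℕ) (I : Finset (Fin n)) :
    I.map Fin.valEmbedding ⊆ Finset.range (List.ofFn c).length := by
  intro j hj
  obtain ⟨i, -, rfl⟩ := Finset.mem_map.1 hj
  simp

theorem SNAEdgeCosts_admitsRatio :
    SNAEdgeCosts.AdmitsRatio (fun x => harmonic x.1.numDemands) := by
  refine .of_polyTime (f := snaGreedy fun p => p.2) (PolyTime.snaGreedy PolyTime.id.snd) ?_
  rintro ⟨x, c⟩ I₀ hI₀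
  have hM : ∀ j, (∑ i, (decide (x.keyOf (fun p => p.2) i = j)).toNat) ≤ 1 := by
    intro j
    have h1 : ∀ i : Fin x.F.length, (decide (x.keyOf (fun p => p.2) i = j)).toNat =
        if (i : ℕ) = j then 1 else 0 := fun i => by
      by_cases h : (i : ℕ) = j <;> simp [ABasedSNA.keyOf, h]
    simp only [h1, Finset.sum_boole, Nat.cast_id]
    rw [Finset.card_le_one]
    intro i hi i' hi'
    simp only [Finset.mem_filter, Finset.mem_univ, true_and] at hi hi'
    exact Fin.ext (hi.trans hi'.symm)
  have key := fun (I : Finset (Fin x.F.length)) (hI : x.Feasible I) =>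
    x.greedy_toDemand (fun p => p.2) (List.ofFn c) hM hI (map_valEmbedding_subset c I)
      fun i hi => Finset.mem_map_of_mem Fin.valEmbedding hi
  refine ⟨_, x.listsSubset_snaGreedy _ (List.ofFn c), (key I₀ hI₀).1, ?_⟩
  intro (I : Finset (Fin x.F.length)) (hI : x.Feasible I)
  have h := (key I hI).2
  rw [← sum_getD_ofFn, Nat.mul_one] at h
  have h1 : ∑ i ∈ x.edgesOf (fun p => p.2)
      (greedy (coverage (x.D.map (x.toDemand fun p => p.2))) (List.ofFn c)), c i ≤
      ∑ j ∈ (greedy (coverage (x.D.map (x.toDemand fun p => p.2))) (List.ofFn c)).toFinset,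
        (List.ofFn c).getD j 0 := by
    rw [sum_getD_ofFn]
    refine Finset.sum_le_sum_of_subset fun j hj => ?_
    obtain ⟨i, hi, rfl⟩ := Finset.mem_map.1 hj
    exact List.mem_toFinset.2 (Finset.mem_filter.1 hi).2
  refine le_trans (by exact_mod_cast h1) (h.trans ?_)
  exact mul_le_mul_of_nonneg_right (harmonic_mono (min_le_right _ _)) (Nat.cast_nonneg _)

theorem SNANodeCosts_admitsRatio :
    SNANodeCosts.AdmitsRatio
      (fun x => harmonic (min x.1.totalReq (x.1.numDemands * x.1.pMax))) := by
  refine .of_polyTime (f := snaGreedy fun p => p.1.2) (PolyTime.snaGreedy PolyTime.id.fst.snd) ?_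
  rintro ⟨x, c⟩ I₀ hI₀
  have hM : ∀ j, (∑ i, (decide (x.keyOf (fun p => p.1.2) i = j)).toNat) ≤ x.pMax := by
    intro j
    by_cases hj : j < x.n
    · refine le_trans (le_of_eq ?_) (Finset.le_sup (f := fun e => x.F.count e)
        (Finset.mem_univ (x.a, (⟨j, hj⟩ : Fin x.n))))
      show _ = List.count _ x.F
      conv_rhs => rw [← List.ofFn_get x.F, List.count, countP_ofFn]
      refine Finset.sum_congr rfl fun i _ => ?_
      congr 1
      have := (x.star _ (List.get_mem x.F i)).1
      rw [Bool.eq_iff_iff]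
      simp only [beq_iff_eq, Prod.ext_iff, ABasedSNA.keyOf, this, true_and, Fin.ext_iff]
      exact decide_eq_true_iff
    · rw [Finset.sum_eq_zero]
      · exact Nat.zero_le _
      · intro i _
        have : x.keyOf (fun p => p.1.2) i ≠ j := fun h => hj (h ▸ (x.F.get i).2.2)
        simp [this]
  have key := fun (I : Finset (Fin x.F.length)) (hI : x.Feasible I) =>
    x.greedy_toDemand (fun p => p.1.2) (List.ofFn c) hM hI
      (map_valEmbedding_subset c (I.image fun i => (x.F.get i).2))
      fun i hi => Finset.mem_map_of_mem Fin.valEmbedding (Finset.mem_image_of_mem _ hi)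
  refine ⟨_, x.listsSubset_snaGreedy _ (List.ofFn c), (key I₀ hI₀).1, ?_⟩
  intro (I : Finset (Fin x.F.length)) (hI : x.Feasible I)
  have h := (key I hI).2
  rw [← sum_getD_ofFn] at h
  set G := greedy (coverage (x.D.map (x.toDemand fun p => p.1.2))) (List.ofFn c) with hG
  by_cases h0 : x.Feasible ∅
  · -- nothing is missing
    have h1 : G = [] := by
      refine greedy_eq_nil _ fun d hd => ?_
      obtain ⟨d, hd', rfl⟩ := List.mem_map.1 hd
      exact (h0 d hd').trans (x.conn_le_toDemand _ (by simp) (x.D_ne d hd'))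
    have h2 : x.edgesOf (fun p => p.1.2) G = ∅ := by simp [ABasedSNA.edgesOf, h1]
    show ((∑ u ∈ x.endnodes (x.edgesOf (fun p => p.1.2) G), c u : ℕ) : ℚ) ≤ _
    rw [h2]
    simp only [ABasedSNA.endnodes, Finset.image_empty, Finset.union_idempotent,
      Finset.sum_empty, Nat.cast_zero]
    exact mul_nonneg (harmonic_mono (Nat.zero_le _)) (Nat.cast_nonneg _)
  -- otherwise every solution pays for the center
  obtain ⟨i₀, hi₀⟩ : I.Nonempty := by
    rw [Finset.nonempty_iff_ne_empty]
    rintro rfl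
    exact h0 hI
  have htail : ∀ i, (x.F.get i).1 = x.a := fun i => (x.star _ (List.get_mem x.F i)).1
  have h1 : 1 ≤ min x.totalReq (x.numDemands * x.pMax) := by
    unfold ABasedSNA.Feasible at h0
    push Not at h0
    obtain ⟨d, hd, hlt⟩ := h0
    have h2 : d.2 ≤ x.totalReq := List.single_le_sum (by simp) _ (List.mem_map_of_mem hd)
    have h3 : 0 < x.numDemands := List.length_pos_of_mem hd
    have h4 : 1 ≤ x.pMax := (List.count_pos_iff.2 (List.get_mem x.F i₀)).trans_le
      (Finset.le_sup (f := fun e => x.F.count e) (Finset.mem_univ _))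
    exact le_min (by omega) (Nat.mul_pos h3 h4)
  have h2 : (1 : ℚ) ≤ harmonic (min x.totalReq (x.numDemands * x.pMax)) := by
    have := harmonic_mono h1
    simpa using this
  have h3 : ∑ u ∈ x.endnodes (x.edgesOf (fun p => p.1.2) G), c u ≤
      c x.a + ∑ j ∈ G.toFinset, (List.ofFn c).getD j 0 := by
    have h4 : x.endnodes (x.edgesOf (fun p => p.1.2) G) ⊆
        {x.a} ∪ (x.edgesOf (fun p => p.1.2) G).image fun i => (x.F.get i).2 := by
      refine Finset.union_subset_union_left fun u hu => ?_
      obtain ⟨i, -, rfl⟩ := Finset.mem_image.1 hu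
      simpa using htail i
    have h5 : ∑ u ∈ (x.edgesOf (fun p => p.1.2) G).image (fun i => (x.F.get i).2), c u ≤
        ∑ j ∈ G.toFinset, (List.ofFn c).getD j 0 := by
      rw [sum_getD_ofFn]
      refine Finset.sum_le_sum_of_subset fun j hj => ?_
      obtain ⟨u, hu, rfl⟩ := Finset.mem_map.1 hj
      obtain ⟨i, hi, rfl⟩ := Finset.mem_image.1 hu
      exact List.mem_toFinset.2 (Finset.mem_filter.1 hi).2
    calc ∑ u ∈ x.endnodes (x.edgesOf (fun p => p.1.2) G), c u
        ≤ ∑ u ∈ {x.a} ∪ (x.edgesOf (fun p => p.1.2) G).image (fun i => (x.F.get i).2), c u :=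
          Finset.sum_le_sum_of_subset h4
      _ ≤ ∑ u ∈ {x.a}, c u +
          ∑ u ∈ (x.edgesOf (fun p => p.1.2) G).image (fun i => (x.F.get i).2), c u := by
          rw [← Finset.sum_union_inter]
          exact Nat.le_add_right _ _
      _ ≤ _ := by rw [Finset.sum_singleton]; omega
  have h4 : c x.a + ∑ u ∈ I.image (fun i => (x.F.get i).2), c u = ∑ u ∈ x.endnodes I, c u := by
    have h5 : I.image (fun i => (x.F.get i).1) = {x.a} := by
      ext u
      simp only [Finset.mem_image, Finset.mem_singleton]
      exact ⟨fun ⟨i, _, hi⟩ => hi ▸ htail i, fun hu => ⟨i₀, hi₀, hu ▸ htail i₀⟩⟩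
    rw [ABasedSNA.endnodes, h5, Finset.sum_union, Finset.sum_singleton]
    rw [Finset.disjoint_singleton_left]
    intro ha
    obtain ⟨i, -, hi⟩ := Finset.mem_image.1 ha
    exact (x.star _ (List.get_mem x.F i)).2 hi
  show ((∑ u ∈ x.endnodes (x.edgesOf (fun p => p.1.2) G), c u : ℕ) : ℚ) ≤
    _ * ((∑ u ∈ x.endnodes I, c u : ℕ) : ℚ)
  rw [← h4]
  have h5 : ((∑ u ∈ x.endnodes (x.edgesOf (fun p => p.1.2) G), c u : ℕ) : ℚ) ≤
      c x.a + ((∑ j ∈ G.toFinset, (List.ofFn c).getD j 0 : ℕ) : ℚ) := by exact_mod_cast h3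
  have h6 : (c x.a : ℚ) ≤ harmonic (min x.totalReq (x.numDemands * x.pMax)) * c x.a :=
    le_mul_of_one_le_left (Nat.cast_nonneg _) h2
  rw [Nat.cast_add, mul_add]
  linarith

/-! ### Source location in polynomial time -/

/-- The arcs from the source `2 * n + 1` to the other nodes than `v`, each with the node as its
key; multiplicities are cut off at the length of `M`. -/
def sourceArcs (M : List (ℕ × ℕ)) (n v : ℕ) (ps : List ℕ) : List (ℕ × (ℕ × ℕ)) :=
  (ps.zipIdx.map fun u =>
    ((List.range M.length).filter fun i => i < u.1 ∧ ¬ u.2 = v).map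
      fun _ => (u.2, (2 * n + 1, 2 * u.2))).flatten

/-- The entry of `l` at position `v`, as a sum with at most one term. -/
def lookup (l : List ℕ) (v : ℕ) : ℕ := ((l.zipIdx.filter fun u => u.2 = v).map fun u => u.1).sum

theorem lookup_ofFn {n : ℕ} (g : Fin n → ℕ) (v : Fin n) : lookup (List.ofFn g) v = g v := by
  have key : ∀ l : List (ℕ × ℕ), ((l.filter fun u => u.2 = (v : ℕ)).map fun u => u.1).sum =
      (l.map fun u => if u.2 = (v : ℕ) then u.1 else 0).sum := by
    intro l
    induction l with
    | nil => rfl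
    | cons e l ih => by_cases h : e.2 = v <;> simp [h, ih]
  rw [lookup, key, zipIdx_ofFn, List.map_ofFn, List.sum_ofFn, Finset.sum_eq_single v]
  · simp
  · intro u _ hu
    simp [Fin.val_inj, hu]
  · simp

/-- The demands of an instance of SSL. The arcs from the source to the sink `v` may be too many to
be listed; what they add to the connectivity is the bonus for choosing `v`. -/
def sslDemands (y : SSL.inTy.Val) : List Demand :=
  y.2.2.1.zipIdx.map fun e => ((e.1, (2 * y.2.2.1.length + 1, 2 * e.2)),
    ((e.2, lookup y.2.2.2.1 e.2),
      (splitArcs y.1 ++ capArcs y.1 (y.2.2.2.2.map fun k => k + 1),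
        sourceArcs y.1 y.2.2.1.length e.2 y.2.2.2.1)))

/-- The nodes chosen by the greedy algorithm. -/
def sslGreedy (y : SSL.inTy.Val) : List ℕ := greedy (coverage (sslDemands y)) y.2.1

namespace PolyTime

variable {a b : Ty}

theorem length {f : a.Val → List b.Val} (hf : PolyTime a (.list b) f) :
    PolyTime a .nat fun x => (f x).length :=
  of_eq (sum (map (b := b) (c := .nat) (g := fun _ _ => 1) (const 1) hf)) fun x => by simp

theorem sourceArcs {f : a.Val → List (ℕ × ℕ)} {n v : a.Val → ℕ} {g : a.Val → List ℕ}
    (hf : PolyTime a edgesTy f) (hn : PolyTime a .nat n) (hv : PolyTime a .nat v)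
    (hg : PolyTime a (.list .nat) g) : PolyTime a (.list (.prod .nat (.prod .nat .nat)))
      fun x => _root_.sourceArcs (f x) (n x) (v x) (g x) :=
  flatten (b := .prod .nat (.prod .nat .nat)) <| map (b := .prod .nat .nat)
    (c := .list (.prod .nat (.prod .nat .nat)))
    (g := fun x u => ((List.range (f x).length).filter fun i => i < u.1 ∧ ¬ u.2 = v x).map
      fun _ => (u.2, (2 * n x + 1, 2 * u.2)))
    (map (a := .prod a (.prod .nat .nat)) (b := .nat) (c := .prod .nat (.prod .nat .nat))
      (g := fun y _ => (y.2.2, (2 * n y.1 + 1, 2 * y.2.2)))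
      (pair (b := .nat) (c := .prod .nat .nat) PolyTime.id.fst.snd.snd
        (pair (b := .nat) (c := .nat) (add (mul (const 2) (comp hn PolyTime.id.fst.fst)) (const 1))
          (mul (const 2) PolyTime.id.fst.snd.snd)))
      (filter (a := .prod a (.prod .nat .nat)) (b := .nat)
        (p := fun (y : a.Val × (ℕ × ℕ)) i => i < y.2.1 ∧ ¬ y.2.2 = v y.1)
        (and (lt PolyTime.id.snd PolyTime.id.fst.snd.fst)
          (not (eq PolyTime.id.fst.snd.snd (comp hv PolyTime.id.fst.fst))))
        (range_length (b := .prod .nat .nat) (comp hf PolyTime.id.fst))))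
    (zipIdx hg)

theorem lookup {l : a.Val → List ℕ} {v : a.Val → ℕ} (hl : PolyTime a (.list .nat) l)
    (hv : PolyTime a .nat v) : PolyTime a .nat fun x => _root_.lookup (l x) (v x) :=
  sum (map (b := .prod .nat .nat) (c := .nat) (g := fun _ u => u.1) PolyTime.id.snd.fst
    (filter (a := a) (b := .prod .nat .nat) (p := fun x (u : ℕ × ℕ) => u.2 = v x)
      (eq PolyTime.id.snd.snd (comp hv PolyTime.id.fst)) (zipIdx hl)))

theorem sslDemands : PolyTime SSL.inTy (.list demandTy) _root_.sslDemands := by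
  have hE : PolyTime SSL.inTy edgesTy fun y : SSL.inTy.Val => y.1 :=
    fst (b := edgesTy) (c := .prod (.list .nat) (.prod (.list .nat)
      (.prod (.list .nat) (.list .nat)))) PolyTime.id
  have h2 : PolyTime SSL.inTy (.prod (.list .nat) (.prod (.list .nat)
      (.prod (.list .nat) (.list .nat)))) fun y : SSL.inTy.Val => y.2 :=
    snd (b := edgesTy) (c := .prod (.list .nat) (.prod (.list .nat)
      (.prod (.list .nat) (.list .nat)))) PolyTime.id
  have hd : PolyTime SSL.inTy (.list .nat) fun y : SSL.inTy.Val => y.2.2.1 := h2.snd.fst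
  have hp : PolyTime SSL.inTy (.list .nat) fun y : SSL.inTy.Val => y.2.2.2.1 := h2.snd.snd.fst
  have hq : PolyTime SSL.inTy (.list .nat) fun y : SSL.inTy.Val => y.2.2.2.2 := h2.snd.snd.snd
  have hn : PolyTime SSL.inTy .nat fun y : SSL.inTy.Val => y.2.2.1.length :=
    length (b := .nat) hd
  have hbase : PolyTime SSL.inTy edgesTy fun y : SSL.inTy.Val =>
      _root_.splitArcs y.1 ++ _root_.capArcs y.1 (y.2.2.2.2.map fun k => k + 1) :=
    append (splitArcs hE) (capArcs hE (map (b := .nat) (c := .nat) (g := fun _ k => k + 1)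
      (add PolyTime.id.snd (const 1)) hq))
  have hE' : PolyTime (.prod SSL.inTy (.prod .nat .nat)) edgesTy
      fun z : SSL.inTy.Val × (ℕ × ℕ) => z.1.1 := comp hE PolyTime.id.fst
  have hn' : PolyTime (.prod SSL.inTy (.prod .nat .nat)) .nat
      fun z : SSL.inTy.Val × (ℕ × ℕ) => z.1.2.2.1.length :=
    comp (b := SSL.inTy) (c := .nat) (g := fun y : SSL.inTy.Val => y.2.2.1.length) hn
      PolyTime.id.fst
  have hp' : PolyTime (.prod SSL.inTy (.prod .nat .nat)) (.list .nat)
      fun z : SSL.inTy.Val × (ℕ × ℕ) => z.1.2.2.2.1 :=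
    comp (b := SSL.inTy) (c := .list .nat) (g := fun y : SSL.inTy.Val => y.2.2.2.1) hp
      PolyTime.id.fst
  exact map (a := SSL.inTy) (b := .prod .nat .nat) (c := demandTy)
    (g := fun y e => ((e.1, (2 * y.2.2.1.length + 1, 2 * e.2)),
      ((e.2, _root_.lookup y.2.2.2.1 e.2),
        (_root_.splitArcs y.1 ++ _root_.capArcs y.1 (y.2.2.2.2.map fun k => k + 1),
          _root_.sourceArcs y.1 y.2.2.1.length e.2 y.2.2.2.1))))
    (pair (b := .prod .nat (.prod .nat .nat))
      (c := .prod (.prod .nat .nat) (.prod edgesTy (.list (.prod .nat (.prod .nat .nat)))))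
      (pair (b := .nat) (c := .prod .nat .nat) PolyTime.id.snd.fst
        (pair (b := .nat) (c := .nat) (add (mul (const 2) hn') (const 1))
          (mul (const 2) PolyTime.id.snd.snd)))
      (pair (b := .prod .nat .nat) (c := .prod edgesTy (.list (.prod .nat (.prod .nat .nat))))
        (pair (b := .nat) (c := .nat) PolyTime.id.snd.snd
          (lookup hp' PolyTime.id.snd.snd))
        (pair (b := edgesTy) (c := .list (.prod .nat (.prod .nat .nat)))
          (comp hbase PolyTime.id.fst)
          (sourceArcs hE' hn' PolyTime.id.snd.snd hp'))))
    (zipIdx hd)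

theorem sslGreedy : PolyTime SSL.inTy (.list .nat) _root_.sslGreedy :=
  greedy sslDemands (fst (b := .list .nat) (c := .prod (.list .nat)
    (.prod (.list .nat) (.list .nat))) (snd (b := edgesTy) (c := .prod (.list .nat)
    (.prod (.list .nat) (.prod (.list .nat) (.list .nat)))) PolyTime.id))

end PolyTime

/-! ### Approximation of source location -/

namespace SSLInstance

variable (x : SSLInstance)

/-- The demand that the greedy algorithm makes of the demand of a node. -/
def toDemand (v : Fin x.n) : Demand :=
  ((x.d v, (2 * x.n + 1, 2 * v)), ((v, x.p v),
    (splitArcs (encodeEdges x.E) ++ capArcs (encodeEdges x.E)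
        (List.ofFn fun u => encodeCap (x.q u)),
      sourceArcs (encodeEdges x.E) x.n v (List.ofFn x.p))))

theorem sslDemands_encode : sslDemands (SSL.encode x) = List.ofFn x.toDemand := by
  have h : SSL.encode x = (encodeEdges x.E, List.ofFn x.c, List.ofFn x.d, List.ofFn x.p,
    List.ofFn x.q) := rfl
  rw [sslDemands, h]
  dsimp only
  rw [zipIdx_ofFn, List.map_ofFn]
  congr 1
  funext v
  simp only [Function.comp, toDemand, lookup_ofFn, List.length_ofFn, List.map_ofFn]
  rfl

/-- The number of arcs in `sourceArcs` from the source to `u`. -/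
def sourceMult (v u : Fin x.n) : ℕ := if u = v then 0 else min (x.p u) x.E.length

theorem countP_sourceArcs (v : Fin x.n) (p : ℕ × (ℕ × ℕ) → Bool) :
    (sourceArcs (encodeEdges x.E) x.n v (List.ofFn x.p)).countP p =
      ∑ u : Fin x.n, (p (u, (2 * x.n + 1, 2 * u))).toNat * x.sourceMult v u := by
  rw [sourceArcs, countP_flatten_zipIdx]
  refine Finset.sum_congr rfl fun u _ => ?_
  rw [countP_map_const, ← List.countP_eq_length_filter]
  congr 1
  have h : (encodeEdges x.E).length = x.E.length := by simp [encodeEdges]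
  rw [sourceMult, h, ← countP_range_lt]
  by_cases huv : u = v
  · simp [huv]
  · simp [huv, Fin.val_inj]

theorem isStar_toDemand (v : Fin x.n) : (x.toDemand v).IsStar := by
  refine ⟨?_, 2 * x.n + 1, fun p hp => ?_⟩
  · simp only [toDemand]
    omega
  · simp only [toDemand, sourceArcs, List.mem_flatten, List.mem_map] at hp
    obtain ⟨l, ⟨u, -, rfl⟩, hp⟩ := hp
    obtain ⟨i, -, rfl⟩ := List.mem_map.1 hp
    rfl

/-- The part of the capacity of a cut of the split graph that is due to `G`. -/
def baseCut (X : ℕ → Bool) : ℕ :=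
  ∑ i : Fin x.E.length, (X (2 * (x.E.get i).1 + 1) && !X (2 * (x.E.get i).2)).toNat +
    ∑ u : Fin x.n, (X (2 * u) && !X (2 * u + 1)).toNat * truncCap (x.q u) x.E.length

theorem cutVal_toDemand (v : Fin x.n) (J : List ℕ) {X : ℕ → Bool}
    (hX : X (2 * x.n + 1) = true) :
    cutVal ((x.toDemand v).2.2.1 ++ selArcs (x.toDemand v).2.2.2 J) X =
      x.baseCut X + ∑ u : Fin x.n,
        (decide ((u : ℕ) ∈ J) && !X (2 * u)).toNat * x.sourceMult v u := by
  rw [cutVal_append, cutVal_selArcs]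
  simp only [toDemand]
  rw [cutVal_append, cutVal_splitArcs, cutVal_capArcs, countP_sourceArcs, baseCut]
  congr 1
  · simp [encodeEdges]
  · simp [hX]

/-- The connectivity is the capacity of a minimum cut of the split graph, where the new node has the
number `n`. -/
theorem conn_eq_min_cut (S : Finset (Fin x.n)) (v : Fin x.n) :
    (∃ X : ℕ → Bool, X (2 * x.n + 1) = true ∧ X (2 * v) = false ∧
      x.baseCut X + ∑ u ∈ S, (!X (2 * u)).toNat * x.p u = x.conn S v) ∧
    ∀ X : ℕ → Bool, X (2 * x.n + 1) = true → X (2 * v) = false →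
      x.conn S v ≤ x.baseCut X + ∑ u ∈ S, (!X (2 * u)).toNat * x.p u := by
  let code : Option (Fin x.n) → ℕ := fun w => w.elim x.n Fin.val
  have hcode : Function.Injective code := by
    rintro (_ | u) (_ | w) h
    · rfl
    · exact absurd h w.2.ne'
    · exact absurd h u.2.ne
    · exact congrArg some (Fin.ext h)
  have h := qConn_eq_min_cut (V := Option (Fin x.n))
    (ι := Fin x.E.length ⊕ ((u : {u // u ∈ S}) × Fin (x.p u)))
    (Sum.elim (fun i => some (x.E.get i).1) (fun _ => none))
    (Sum.elim (fun i => some (x.E.get i).2) (fun j => some j.1.1))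
    (fun w => w.elim ⊤ fun u => (x.q u : ℕ∞)) (s := none) (t := some v) (by simp)
    (m := x.E.length)
    (fun w hw => by
      have h1 : (Finset.univ.filter fun i : Fin x.E.length ⊕ ((u : {u // u ∈ S}) × Fin (x.p u)) =>
          Sum.elim (fun i => some (x.E.get i).1) (fun _ => none) i = w) ⊆
          Finset.univ.map Function.Embedding.inl := by
        rintro (i | j) hi
        · simp
        · exact absurd (Finset.mem_filter.1 hi).2 (Ne.symm hw)
      simpa using Finset.card_le_card h1)
    (cap := fun w => w.elim x.E.length fun u => truncCap (x.q u) x.E.length)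
    (fun w => by
      cases w with
      | none => simp
      | some u => exact coe_truncCap _ _)
    (code := code) hcode
  have hsum : ∀ X : ℕ → Bool, X (2 * x.n + 1) = true →
      ∑ i : Fin x.E.length ⊕ ((u : {u // u ∈ S}) × Fin (x.p u)),
        (X (2 * code (Sum.elim (fun i => some (x.E.get i).1) (fun _ => none) i) + 1) &&
          !X (2 * code (Sum.elim (fun i => some (x.E.get i).2)
            (fun j => some j.1.1) i))).toNat +
      ∑ w : Option (Fin x.n), (X (2 * code w) && !X (2 * code w + 1)).toNat *
        (w.elim x.E.length fun u => truncCap (x.q u) x.E.length) =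
      x.baseCut X + ∑ u ∈ S, (!X (2 * u)).toNat * x.p u := by
    intro X hX
    rw [Fintype.sum_sum_type, Fintype.sum_option, Fintype.sum_sigma, ← Finset.sum_coe_sort S,
      baseCut]
    simp only [Sum.elim_inl, Sum.elim_inr, code, Option.elim, hX, Bool.not_true, Bool.and_false,
      Bool.true_and, Bool.toNat_false, zero_mul, zero_add, Finset.sum_const, Finset.card_univ,
      Fintype.card_fin, smul_eq_mul]
    have h1 : ∀ u : {u // u ∈ S}, x.p u * (!X (2 * (u : Fin x.n))).toNat =
        (!X (2 * (u : Fin x.n))).toNat * x.p u := fun u => mul_comm _ _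
    simp only [h1]
    omega
  obtain ⟨⟨X, hs, ht, hX⟩, h2⟩ := h
  exact ⟨⟨X, hs, ht, (hsum X hs).symm.trans hX⟩,
    fun X hs ht => (h2 X hs ht).trans (hsum X hs).le⟩

/-- Cutting off the multiplicities and treating the arcs from the source to the sink apart does
not change the connectivity: a cut with a cut off multiplicity has at least the capacity of the
cut that separates just the entry of the sink. -/
theorem conn_eq_toDemand {S : Finset (Fin x.n)} {J : List ℕ} (hSJ : ∀ u, u ∈ S ↔ (u : ℕ) ∈ J)
    (v : Fin x.n) : x.conn S v = (x.toDemand v).conn J := by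
  obtain ⟨⟨X, hXs, hXt, hX⟩, h1⟩ := x.conn_eq_min_cut S v
  obtain ⟨-, ⟨Y, hYs, hYt, hY⟩, h2⟩ := maxFlow_spec
    ((x.toDemand v).2.2.1 ++ selArcs (x.toDemand v).2.2.2 J) (x.isStar_toDemand v).1
  rw [x.cutVal_toDemand v J hYs] at hY
  replace hYt : Y (2 * (v : ℕ)) = false := hYt
  have hb : (if (x.toDemand v).2.1.1 ∈ J then (x.toDemand v).2.1.2 else 0) =
      ∑ u, if u = v then (if u ∈ S then x.p u else 0) else 0 := by
    rw [Finset.sum_ite_eq' Finset.univ v, if_pos (Finset.mem_univ _)]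
    have : v ∈ S ↔ (x.toDemand v).2.1.1 ∈ J := hSJ v
    by_cases h : v ∈ S
    · rw [if_pos h, if_pos (this.1 h)]
      rfl
    · rw [if_neg h, if_neg fun h' => h (this.2 h')]
  have hp : ∀ Z : ℕ → Bool, ∑ u ∈ S, (!Z (2 * u)).toNat * x.p u =
      ∑ u, if u ∈ S then (!Z (2 * u)).toNat * x.p u else 0 := fun Z => by
    rw [Finset.sum_ite_mem, Finset.univ_inter]
  unfold Demand.conn
  apply le_antisymm
  · rw [← hY, hb]
    by_cases hc : ∃ w ∈ S, w ≠ v ∧ Y (2 * w) = false ∧ x.E.length < x.p w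
    · obtain ⟨w, hw, hwv, hYw, hlt⟩ := hc
      have h3 := h1 (fun i => decide (i ≠ 2 * v)) (by simp; omega) (by simp)
      have h4 : x.baseCut (fun i => decide (i ≠ 2 * v)) ≤ x.E.length := by
        unfold baseCut
        have h5 : ∀ u : Fin x.n, ¬ 2 * (u : ℕ) + 1 = 2 * v := fun u => by omega
        simp only [ne_eq, h5, not_false_eq_true, decide_true, Bool.not_true, Bool.and_false,
          Bool.toNat_false, zero_mul, Finset.sum_const_zero, add_zero]
        refine (Finset.sum_le_card_nsmul _ _ 1 fun i _ => Bool.toNat_le _).trans (by simp)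
      have h5 : ∑ u ∈ S, (!decide ((2 * (u : ℕ)) ≠ 2 * v)).toNat * x.p u =
          ∑ u, if u = v then (if u ∈ S then x.p u else 0) else 0 := by
        rw [hp fun i => decide (i ≠ 2 * v)]
        refine Finset.sum_congr rfl fun u _ => ?_
        by_cases huv : u = v
        · simp [huv]
        · simp [huv, Fin.val_inj]
      have h6 : x.E.length ≤ ∑ u : Fin x.n,
          (decide ((u : ℕ) ∈ J) && !Y (2 * u)).toNat * x.sourceMult v u := by
        refine le_trans (le_of_eq ?_) (Finset.single_le_sum (fun _ _ => Nat.zero_le _)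
          (Finset.mem_univ w))
        simp [(hSJ w).1 hw, hYw, sourceMult, hwv, hlt.le]
      beta_reduce at h3
      omega
    · push Not at hc
      have h3 := h1 Y hYs hYt
      refine h3.trans ?_
      rw [hp, add_left_comm, ← Finset.sum_add_distrib]
      refine Nat.add_le_add_left (Finset.sum_le_sum fun u _ => ?_) _
      by_cases huS : u ∈ S
      · have huJ := (hSJ u).1 huS
        by_cases huv : u = v
        · subst huv
          simp [huS, hYt]
        · cases hYu : Y (2 * u)
          · have := hc u huS huv hYu
            simp [huS, huJ, huv, sourceMult, this]
          · simp
      · simp [huS]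
  · have h3 := h2 X hXs hXt
    rw [x.cutVal_toDemand v J hXs] at h3
    rw [← hX, hb]
    refine (Nat.add_le_add_left h3 _).trans ?_
    rw [hp, add_left_comm, ← Finset.sum_add_distrib]
    refine Nat.add_le_add_left (Finset.sum_le_sum fun u _ => ?_) _
    by_cases huS : u ∈ S
    · have huJ := (hSJ u).1 huS
      by_cases huv : u = v
      · subst huv
        simp [huS, hXt, sourceMult]
      · cases hXu : X (2 * u) <;> simp [huS, huJ, huv, sourceMult]
    · have huJ : (u : ℕ) ∉ J := fun h => huS ((hSJ u).2 h)
      simp [huS, huJ]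

end SSLInstance

theorem SSL_admitsRatio :
    SSL.AdmitsRatio
      (fun x => harmonic (min (SSLInstance.totalDemand x) (x.n * SSLInstance.pMax x))) := by
  refine .of_polyTime (f := sslGreedy) PolyTime.sslGreedy ?_
  intro (x : SSLInstance) (S₀ : Finset (Fin x.n)) hS₀
  have hG : sslGreedy (SSL.encode x) =
      greedy (coverage (List.ofFn x.toDemand)) (List.ofFn x.c) := by
    rw [sslGreedy, x.sslDemands_encode]
    rfl
  rw [hG]
  have hstar : ∀ d ∈ List.ofFn x.toDemand, d.IsStar := by
    intro d hd
    obtain ⟨v, rfl⟩ := List.mem_ofFn.1 hd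
    exact x.isStar_toDemand v
  have hM : ∀ j, ∀ d ∈ List.ofFn x.toDemand,
      (d.2.2.2.countP fun p => p.1 = j) + (if d.2.1.1 = j then d.2.1.2 else 0) ≤ x.pMax := by
    intro j d hd
    obtain ⟨v, rfl⟩ := List.mem_ofFn.1 hd
    have h1 : (x.toDemand v).2.2.2.countP (fun p => p.1 = j) =
        ∑ u : Fin x.n, (decide ((u : ℕ) = j)).toNat * x.sourceMult v u :=
      x.countP_sourceArcs v _
    have h2 : ∀ u, x.p u ≤ x.pMax := fun u => Finset.le_sup (f := x.p) (Finset.mem_univ u)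
    rw [h1]
    by_cases hj : j < x.n
    · rw [Finset.sum_eq_single (⟨j, hj⟩ : Fin x.n)]
      · have h3 : (x.toDemand v).2.1.1 = j ↔ (⟨j, hj⟩ : Fin x.n) = v :=
          ⟨fun h => Fin.ext h.symm, fun h => by rw [← h]; rfl⟩
        by_cases h4 : (⟨j, hj⟩ : Fin x.n) = v
        · rw [if_pos (h3.2 h4), SSLInstance.sourceMult, if_pos h4, mul_zero, zero_add]
          exact h2 v
        · rw [if_neg fun h => h4 (h3.1 h), SSLInstance.sourceMult, if_neg h4]
          have := h2 ⟨j, hj⟩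
          simp
          omega
      · intro u _ hu
        have : (u : ℕ) ≠ j := fun h => hu (Fin.ext h)
        simp [this]
      · simp
    · have h3 : ¬ (x.toDemand v).2.1.1 = j := fun h => hj (h ▸ v.2)
      rw [if_neg h3, Finset.sum_eq_zero]
      · exact Nat.zero_le _
      · intro u _
        have : (u : ℕ) ≠ j := fun h => hj (h ▸ u.2)
        simp [this]
  have hsum : ((List.ofFn x.toDemand).map fun d => d.1.1).sum = x.totalDemand := by
    rw [List.map_ofFn, List.sum_ofFn]
    rfl
  have key := fun (S : Finset (Fin x.n)) (hS : SSL.Feasible x S) =>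
    greedy_coverage hstar (List.ofFn x.c) hM (map_valEmbedding_subset x.c S) (by
      intro d hd
      obtain ⟨v, rfl⟩ := List.mem_ofFn.1 hd
      refine (hS v).trans (x.conn_eq_toDemand (fun u => ?_) v).le
      simp [Fin.val_inj])
  simp only [hsum, List.length_ofFn, ← sum_getD_ofFn] at key
  have hlt := greedy_lt (D := List.ofFn x.toDemand) (List.ofFn x.c)
  rw [List.length_ofFn] at hlt
  set G := greedy (coverage (List.ofFn x.toDemand)) (List.ofFn x.c)
  let S : Finset (Fin x.n) := Finset.univ.filter fun u => (u : ℕ) ∈ G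
  have hS : ∀ u, u ∈ S ↔ (u : ℕ) ∈ G := fun u => by simp [S]
  refine ⟨S, fun i => ⟨fun hi => ⟨hlt i hi, (hS _).2 hi⟩, fun ⟨hi, h⟩ => (hS _).1 h⟩,
    fun v => ?_, ?_⟩
  · rw [x.conn_eq_toDemand hS v]
    exact (key S₀ hS₀).1 _ (List.mem_ofFn.2 ⟨v, rfl⟩)
  · intro (S' : Finset (Fin x.n)) hS'
    refine le_trans ?_ (key S' hS').2
    have : ∑ u ∈ S, x.c u ≤ ∑ j ∈ G.toFinset, (List.ofFn x.c).getD j 0 := by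
      rw [sum_getD_ofFn]
      refine Finset.sum_le_sum_of_subset fun j hj => ?_
      obtain ⟨u, hu, rfl⟩ := Finset.mem_map.1 hj
      exact List.mem_toFinset.2 ((hS u).1 hu)
    exact_mod_cast this

theorem theorem2 :
    SNAEdgeCosts.AdmitsRatio (fun x => harmonic x.1.numDemands) ∧
    SNANodeCosts.AdmitsRatio
      (fun x => harmonic (min x.1.totalReq (x.1.numDemands * x.1.pMax))) ∧
    SSL.AdmitsRatio
      (fun x => harmonic (min (SSLInstance.totalDemand x) (x.n * SSLInstance.pMax x))) :=
  ⟨SNAEdgeCosts_admitsRatio, SNANodeCosts_admitsRatio, SSL_admitsRatio⟩
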